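/- Let $k\ge 2$ be an integer. *The $k$-cut number.* Let $(T_{i,v})_{i\ge1,v\ge1}$ be i.i.d. $\mathrm{Exp}(1)$ random variables and let $G_{r,v}=\sum_{i=1}^{r}T_{i,v}$, the time at which the alarm clock of node $v$ rings for the $r$-th time. On the path with nodes $1,\dots,n$, rooted at $1$, node $v$ is an $r$-record if $G_{r,v}<G_{k,u}$ for all $1\le u<v$. The $k$-cut number of the path is the total number of records, $$\mathcal X_n=\sum_{r=1}^{k}\#\{1\le v\le n: v\text{ is an } r\text{-record}\}.$$ *The limit.* Let $U_1,E_1,U_2,E_2,\dots$ be mutually independent with $U_j$ uniform on $[0,1]$ and $E_j\sim\mathrm{Exp}(1)$, and put, for $p\ge1$ (an empty product is one), $$S_p=\Bigl(k!\sum_{1\le s\le p}\Bigl(\prod_{s\le j<p}U_j\Bigr)E_s\Bigr)^{1/k},\qquad B_p=(1-U_p)\Bigl(\prod_{1\le j<p}U_j\Bigr)^{1-\frac1k}S_p,\qquad \mathcal B_k=\sum_{p\ge1}B_p .$$ *The constants.* Let $$\eta_{k,1}=\frac{(k!)^{1/k}}{k-1}\,\Gamma\!\left(\tfrac1k\right),\qquad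 \gamma_k=\frac{\Gamma(2/k)(k!)^{2/k}}{k-1}+2\lambda_k,\qquad \rho_{k,p}=\frac{p!}{\Gamma\left(p+1-\frac pk\right)}\left(\frac{\pi\,(k!)^{1/k}}{k\,\sin(\pi/k)}\right)^{p},$$ where $\lambda_2=\pi^2/4$ and $\lambda_k=\dfrac{\pi\cot(\pi/k)\,\Gamma(2/k)\,(k!)^{2/k}}{2(k-2)(k-1)}$ for $k>2$. *Theorem.* The series defining $\mathcal B_k$ converges almost surely, and as $n\to\infty$ $$\frac{\mathcal X_n}{n^{1-1/k}}\longrightarrow\mathcal B_k\quad\text{in distribution.}$$ The convergence also holds in $L^p$ for all real $p>0$, in the following sense: $\mathcal B_k$ has finite moments of all orders; there are random variables $Y_1,Y_2,\dots$ and $Z$ on a common probability space, with $Y_n$ distributed as $\mathcal X_n/n^{1-1/k}$ and $Z$ distributed as $\mathcal B_k$, such that $\mathbf E|Y_n-Z|^p\to0$ for every $p>0$; and $\mathbf E\bigl[(\mathcal X_n/n^{1-1/k})^p\bigr]\to\mathbf E[\mathcal B_k^p]$ for every $p>0$. Moreover, $$\mathbf E\,\mathcal B_k=\eta_{k,1},\qquad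 \mathbf E\,\mathcal B_k^2=\gamma_k,\qquad \mathbf E\,\mathcal B_k^p\in[\eta_{k,1}^p,\rho_{k,p}]\quad(p\in\mathbb N).$$ -/

import Mathlib

open MeasureTheory ProbabilityTheory Filter Topology

noncomputable section

namespace KCut

/-! Indices start at `0`: `T i v` is the holding time `T_{i+1,v+1}` of the alarm clock of node
`v + 1` of the path (the root is node `0` here), and `U p`, `E p` are `U_{p+1}`, `E_{p+1}`. -/

/-- `G_{r,v} = ∑_{i=1}^r T_{i,v}`: the time at which the clock of node `v` rings for the `r`-th
time. -/
def ringTime {Ω : Type*} (T : ℕ → ℕ → Ω → ℝ) (r v : ℕ) (ω : Ω) : ℝ :=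
  ∑ i ∈ Finset.range r, T i v ω

/-- Node `v` of the path is an `r`-record: its clock rings for the `r`-th time strictly before the
clock of any of its ancestors (the nodes `u < v`) rings for the `k`-th time. The root has no
ancestors, so that it is an `r`-record for all `r`. -/
def IsRecord {Ω : Type*} (k : ℕ) (T : ℕ → ℕ → Ω → ℝ) (r v : ℕ) (ω : Ω) : Prop :=
  ∀ u < v, ringTime T r v ω < ringTime T k u ω

open Classical in
/-- The number of `r`-records of the path with `n` nodes. -/
def recordCount {Ω : Type*} (k : ℕ) (T : ℕ → ℕ → Ω → ℝ) (n r : ℕ) (ω : Ω) : ℕ :=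
  ∑ v ∈ Finset.range n, if IsRecord k T r v ω then 1 else 0

/-- The `k`-cut number `𝒳_n` of the path with `n` nodes: the total number of `r`-records,
`r = 1, …, k`. -/
def cutNumber {Ω : Type*} (k : ℕ) (T : ℕ → ℕ → Ω → ℝ) (n : ℕ) (ω : Ω) : ℕ :=
  ∑ r ∈ Finset.Icc 1 k, recordCount k T n r ω

/-- The rescaled `k`-cut number `𝒳_n / n^{1-1/k}`. -/
def scaledCutNumber {Ω : Type*} (k : ℕ) (T : ℕ → ℕ → Ω → ℝ) (n : ℕ) (ω : Ω) : ℝ :=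
  (cutNumber k T n ω : ℝ) / (n : ℝ) ^ (1 - 1 / (k : ℝ))

/-- `S_{p+1} = (k! ∑_{1 ≤ s ≤ p+1} (∏_{s ≤ j < p+1} U_j) E_s)^{1/k}`. -/
def limitS {Ω : Type*} (k : ℕ) (U E : ℕ → Ω → ℝ) (p : ℕ) (ω : Ω) : ℝ :=
  ((k.factorial : ℝ) *
    ∑ s ∈ Finset.range (p + 1), (∏ j ∈ Finset.Ico s p, U j ω) * E s ω) ^ (1 / (k : ℝ))

/-- `B_{p+1} = (1 - U_{p+1}) (∏_{1 ≤ j < p+1} U_j)^{1-1/k} S_{p+1}`. -/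
def limitB {Ω : Type*} (k : ℕ) (U E : ℕ → Ω → ℝ) (p : ℕ) (ω : Ω) : ℝ :=
  (1 - U p ω) * (∏ j ∈ Finset.range p, U j ω) ^ (1 - 1 / (k : ℝ)) * limitS k U E p ω

/-- `𝓑_k = ∑_{p ≥ 1} B_p`. -/
def limitVar {Ω : Type*} (k : ℕ) (U E : ℕ → Ω → ℝ) (ω : Ω) : ℝ :=
  ∑' p, limitB k U E p ω

/-- `η_{k,r} = (k!)^{r/k} / (k - r) · Γ(r/k) / Γ(r)`. -/
def eta (k r : ℕ) : ℝ :=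
  (k.factorial : ℝ) ^ ((r : ℝ) / k) / ((k : ℝ) - r) *
    (Real.Gamma ((r : ℝ) / k) / Real.Gamma r)

/-- `λ_k`, for `k ≥ 2`. -/
def lam (k : ℕ) : ℝ :=
  if k = 2 then Real.pi ^ 2 / 4
  else Real.pi * Real.cot (Real.pi / k) * Real.Gamma (2 / (k : ℝ)) *
      (k.factorial : ℝ) ^ (2 / (k : ℝ)) / (2 * ((k : ℝ) - 2) * ((k : ℝ) - 1))

/-- `γ_k = Γ(2/k) (k!)^{2/k} / (k - 1) + 2 λ_k`. -/
def gam (k : ℕ) : ℝ :=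
  Real.Gamma (2 / (k : ℝ)) * (k.factorial : ℝ) ^ (2 / (k : ℝ)) / ((k : ℝ) - 1) + 2 * lam k

/-- `ρ_{k,ℓ} = ℓ! / Γ(ℓ + 1 - ℓ/k) · ((π/k) (k!)^{1/k} / sin(π/k))^ℓ`. -/
def rho (k l : ℕ) : ℝ :=
  (l.factorial : ℝ) / Real.Gamma ((l : ℝ) + 1 - (l : ℝ) / k) *
    (Real.pi / k * (k.factorial : ℝ) ^ (1 / (k : ℝ)) / Real.sin (Real.pi / k)) ^ l

end KCut

end

noncomputable section

namespace KCut

/-! ### Exponential measures -/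

section Exponential

open Set
open scoped ENNReal

/-! The `k`-th ringing time of a clock has survival function `exp (-t) * expSum k t`. Minus the
logarithm of this, `hazard k`, turns these times into i.i.d. Exp(1) variables `W_v`
(`IsClock.hasLaw_hazard`, `IsClock.iIndepFun_hazard`). Let `M_i` be the least `k`-th ringing time
among the nodes `0, …, i`. Given these nodes, node `i + 1` is a one-record with probability `1 - exp
(-M_i)`, which is close to `M_i`, and `M_i` is close to `(k! min_{j ≤ i} W_j)^{1/k}` because the
hazard behaves like `t^k / k!` at zero. An `r`-record with `r ≥ 2` needs two holding times below
`M_i`, which costs `M_i ^ 2` and is of lower order. The compensated one-record indicators have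
orthogonal increments. Hence the cut number differs from `∑ i, (k! min_{j ≤ i} W_j)^{1/k}` by
`o(n^{1-1/k})` in `L^1` (`IsClock.tendsto_lintegral_scaledCutNumber_sub`).

Divided by `n^{1-1/k}`, this sum is a Riemann sum of mesh `1/n` over running minima of independent
Exp(1/n) variables. Think of each variable as the minimum over an interval whose length is its rate.
The minimum over `[0, L]` is then `e / L`, attained at `u L`, with `e` exponential and `u` uniform.
To the left of `u L` the excesses over it form a fresh copy, by memorylessness
(`lintegral_minMeasure_restart`). Iteration gives the decreasing step function `chainMin`, whose
value at `x` is the sum of `E_s / (U_1 ⋯ U_{s-1})` over all `s` with `x < U_1 ⋯ U_{s-1}`. At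
finitely many points it has exactly the law of the discrete running minima (`IsChain.map_chainMin`),
and the integral of `(k! chainMin)^{1/k}` over `(0, 1)` is the series `𝓑_k`
(`IsGood.pathIntegral_eq`). So for each `n` the sum of minima has the law of a Riemann sum that
converges almost surely to `𝓑_k`, and convergence in distribution follows.

The mean comes from Tonelli, since `chainMin` at `x` is Exp(x). For the second moment, the values at
`x < y` are `(Z, min Z W)` with independent `Z`, `W`; a layer-cake computation leaves
`secondMomentIntegral`, which a geometric series turns into `∑ 1 / (2j+1)^2` for `k = 2` and into
the partial fractions of the cotangent for `k > 2`. For the `p`-th moment, a `p`-th power is bounded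
by `p!` times a sum over increasing indices, up to a small correction
(`pow_le_factorial_mul_gapSum`). Each minimum is enlarged to the minimum since the previously chosen
index, so the factors become independent, and the resulting convolutions are bounded by Beta
integrals (`lintegral_gapSum_le`, `convSum_le`). The same device, applied to one-record indicators,
bounds all moments of the rescaled cut number uniformly in `n`. Quantile functions realise the
convergence in distribution almost surely, and the moment bounds turn it into convergence in `L^p`
and of moments. -/

lemma lintegral_expMeasure (a : ℝ) {f : ℝ → ℝ≥0∞} (hf : Measurable f) :
    ∫⁻ x, f x ∂expMeasure a = ∫⁻ x in Ioi 0, ENNReal.ofReal (a * Real.exp (-(a * x))) * f x := by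
  have hm : Measurable (gammaPDF 1 a) := (measurable_gammaPDFReal 1 a).ennreal_ofReal
  rw [expMeasure, gammaMeasure, lintegral_withDensity_eq_lintegral_mul _ hm hf,
    ← lintegral_add_compl _ (measurableSet_Ici (a := (0 : ℝ))), compl_Ici,
    setLIntegral_congr_fun (g := fun _ => 0) measurableSet_Iio, lintegral_zero, add_zero,
    setLIntegral_congr Ioi_ae_eq_Ici.symm]
  · refine setLIntegral_congr_fun measurableSet_Ioi fun x hx => ?_
    have := exponentialPDF_of_nonneg (r := a) (le_of_lt (mem_Ioi.1 hx))
    simp only [Pi.mul_apply]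
    congr 1
  · intro x hx
    simp [gammaPDF_of_neg (mem_Iio.1 hx)]

lemma expMeasure_Ioi {a t : ℝ} (ha : 0 < a) (ht : 0 ≤ t) :
    expMeasure a (Ioi t) = ENNReal.ofReal (Real.exp (-(a * t))) := by
  have := isProbabilityMeasure_expMeasure ha
  have h := cdf_expMeasure_eq ha t
  rw [cdf_eq_real, if_pos ht] at h
  have h2 := probReal_compl_eq_one_sub (μ := expMeasure a) (measurableSet_Iic (a := t))
  rw [compl_Iic, h, sub_sub_cancel] at h2
  rw [← h2, ofReal_measureReal]

/-- Tails at `t ≥ 0` suffice: the tail at `0` is already `1`, so nothing is charged below `0` and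
the distribution functions agree everywhere. -/
lemma expMeasure_unique {a : ℝ} (ha : 0 < a) {μ : Measure ℝ} [IsProbabilityMeasure μ]
    (h : ∀ t, 0 ≤ t → μ (Ioi t) = ENNReal.ofReal (Real.exp (-(a * t)))) : μ = expMeasure a := by
  have := isProbabilityMeasure_expMeasure ha
  have key : ∀ t : ℝ, μ (Ioi t) = expMeasure a (Ioi t) := by
    intro t
    rcases le_or_gt 0 t with ht | ht
    · rw [h t ht, expMeasure_Ioi ha ht]
    · have h0 := h 0 le_rfl
      have h1 := expMeasure_Ioi ha le_rfl
      simp only [mul_zero, neg_zero, Real.exp_zero, ENNReal.ofReal_one] at h0 h1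
      rw [le_antisymm prob_le_one (h0 ▸ measure_mono (Ioi_subset_Ioi ht.le)),
        le_antisymm prob_le_one (h1 ▸ measure_mono (Ioi_subset_Ioi ht.le))]
  refine Measure.eq_of_cdf _ _ ?_
  ext t
  rw [cdf_eq_real, cdf_eq_real, measureReal_def, measureReal_def, ← compl_Ioi,
    prob_compl_eq_one_sub measurableSet_Ioi, prob_compl_eq_one_sub measurableSet_Ioi, key]

lemma ae_expMeasure_pos {a : ℝ} (ha : 0 < a) : ∀ᵐ x ∂expMeasure a, 0 < x := by
  have := isProbabilityMeasure_expMeasure ha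
  have h1 := expMeasure_Ioi ha le_rfl
  simp only [mul_zero, neg_zero, Real.exp_zero, ENNReal.ofReal_one] at h1
  exact (prob_compl_eq_zero_iff measurableSet_Ioi).2 h1

lemma map_div_expMeasure {a c : ℝ} (ha : 0 < a) (hc : 0 < c) :
    (expMeasure a).map (fun x => x / c) = expMeasure (a * c) := by
  have := isProbabilityMeasure_expMeasure ha
  have hm : Measurable fun x : ℝ => x / c := by fun_prop
  have := Measure.isProbabilityMeasure_map (μ := expMeasure a) hm.aemeasurable
  refine expMeasure_unique (mul_pos ha hc) fun t ht => ?_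
  have hpre : (fun x : ℝ => x / c) ⁻¹' Ioi t = Ioi (t * c) := by
    ext x
    simp [lt_div_iff₀ hc]
  rw [Measure.map_apply hm measurableSet_Ioi, hpre,
    expMeasure_Ioi ha (mul_nonneg ht hc.le)]
  ring_nf

lemma lintegral_rpow_expMeasure {a s : ℝ} (ha : 0 < a) (hs : -1 < s) :
    ∫⁻ x, ENNReal.ofReal (x ^ s) ∂expMeasure a
      = ENNReal.ofReal (Real.Gamma (1 + s) * a ^ (-s)) := by
  rw [lintegral_expMeasure _ (by fun_prop)]
  have h1 : ∫⁻ x in Ioi 0, ENNReal.ofReal (a * Real.exp (-(a * x))) * ENNReal.ofReal (x ^ s)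
      = ∫⁻ x in Ioi 0, ENNReal.ofReal (a * (x ^ (1 + s - 1) * Real.exp (-(a * x)))) := by
    refine setLIntegral_congr_fun measurableSet_Ioi fun x hx => ?_
    rw [← ENNReal.ofReal_mul (by positivity)]
    ring_nf
  have hv := Real.integral_rpow_mul_exp_neg_mul_Ioi (a := 1 + s) (by linarith) ha
  have hv' : ∫ x in Ioi (0 : ℝ), a * (x ^ (1 + s - 1) * Real.exp (-(a * x)))
      = Real.Gamma (1 + s) * a ^ (-s) := by
    rw [integral_const_mul, hv, one_div, Real.inv_rpow ha.le, ← Real.rpow_neg ha.le]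
    have : a ^ (-s) = a * a ^ (-(1 + s)) := by
      nth_rewrite 2 [← Real.rpow_one a]
      rw [← Real.rpow_add ha]
      ring_nf
    rw [this]; ring
  have hint : IntegrableOn (fun x => a * (x ^ (1 + s - 1) * Real.exp (-(a * x)))) (Ioi 0) := by
    -- The Bochner integral of a non-integrable function is `0` by convention, so a positive value
    -- proves integrability.
    by_contra hni
    have h0 := integral_undef hni
    rw [hv'] at h0
    have : 0 < Real.Gamma (1 + s) * a ^ (-s) :=
      mul_pos (Real.Gamma_pos_of_pos (by linarith)) (Real.rpow_pos_of_pos ha _)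
    linarith
  rw [h1, ← hv', ofReal_integral_eq_lintegral_ofReal hint]
  refine (ae_restrict_iff' measurableSet_Ioi).2 (ae_of_all _ fun x hx => ?_)
  have : 0 < x := hx
  simp only [Pi.zero_apply]
  positivity

lemma lintegral_Ioi_eq_lintegral_add (x : ℝ) (f : ℝ → ℝ≥0∞) :
    ∫⁻ z in Ioi x, f z = ∫⁻ z in Ioi 0, f (x + z) := by
  have h := (measurePreserving_add_left (volume : Measure ℝ) x).setLIntegral_comp_preimage_emb
    (measurableEmbedding_addLeft x) f (Ioi x)
  rw [← h]
  congr 2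
  ext z; simp

/-- Memorylessness: beyond `x` the law is a fresh copy started at `x`, with weight `exp (-b x)`. -/
lemma setLIntegral_Ioi_expMeasure {b x : ℝ} (hx : 0 ≤ x) {f : ℝ → ℝ≥0∞}
    (hf : Measurable f) :
    ∫⁻ z in Ioi x, f z ∂expMeasure b
      = ENNReal.ofReal (Real.exp (-(b * x))) * ∫⁻ z, f (x + z) ∂expMeasure b := by
  rw [← lintegral_indicator measurableSet_Ioi, lintegral_expMeasure _ (hf.indicator measurableSet_Ioi),
    lintegral_expMeasure _ (by fun_prop), ← lintegral_const_mul _ (by fun_prop)]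
  have : ∫⁻ z in Ioi 0, ENNReal.ofReal (b * Real.exp (-(b * z))) * (Ioi x).indicator f z
      = ∫⁻ z in Ioi x, ENNReal.ofReal (b * Real.exp (-(b * z))) * f z := by
    rw [← lintegral_indicator measurableSet_Ioi, ← lintegral_indicator measurableSet_Ioi]
    congr 1 with z
    by_cases hz : x < z
    · simp [hz, lt_of_le_of_lt hx hz]
    · simp [hz]
  rw [this, lintegral_Ioi_eq_lintegral_add]
  refine lintegral_congr fun z => ?_
  rw [← mul_assoc, ← ENNReal.ofReal_mul (by positivity), mul_add, neg_add, Real.exp_add]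
  ring_nf

/-- The minimum of two independent exponential variables, the index of the minimum, and the excess
of the larger one. -/
lemma lintegral_lintegral_expMeasure_min {a b : ℝ} (ha : 0 < a) (hb : 0 < b)
    {F : ℝ → ℝ → ℝ≥0∞} (hF : Measurable (Function.uncurry F)) :
    ∫⁻ x, ∫⁻ z, F x z ∂expMeasure b ∂expMeasure a
      = ∫⁻ m, (ENNReal.ofReal (a / (a + b)) * ∫⁻ z, F m (m + z) ∂expMeasure b
          + ENNReal.ofReal (b / (a + b)) * ∫⁻ x, F (m + x) m ∂expMeasure a)
          ∂expMeasure (a + b) := by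
  have := isProbabilityMeasure_expMeasure ha
  have := isProbabilityMeasure_expMeasure hb
  have hab : 0 < a + b := by linarith
  have hFm : ∀ x, Measurable (F x) := fun x => hF.comp measurable_prodMk_left
  have hFm' : ∀ z, Measurable fun x => F x z := fun z => hF.comp measurable_prodMk_right
  -- Ties are null, so only the cases `x < z` and `z < x` have to be treated.
  have hdiag : ∀ x, expMeasure b {x} = 0 := fun x => by
    rw [expMeasure, gammaMeasure]
    exact withDensity_absolutelyContinuous _ _ (by simp)
  have m1 : Measurable fun m => ∫⁻ z, F m (m + z) ∂expMeasure b :=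
    Measurable.lintegral_prod_right' (f := fun p : ℝ × ℝ => F p.1 (p.1 + p.2))
      (hF.comp (by fun_prop : Measurable fun p : ℝ × ℝ => (p.1, p.1 + p.2)))
  have m2 : Measurable fun m => ∫⁻ x, F (m + x) m ∂expMeasure a :=
    Measurable.lintegral_prod_right' (f := fun p : ℝ × ℝ => F (p.1 + p.2) p.1)
      (hF.comp (by fun_prop : Measurable fun p : ℝ × ℝ => (p.1 + p.2, p.1)))
  have hsplit : ∀ x, ∫⁻ z, F x z ∂expMeasure b
      = ∫⁻ z, (Ioi x).indicator (F x) z ∂expMeasure b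
        + ∫⁻ z, (Iio x).indicator (F x) z ∂expMeasure b := by
    intro x
    rw [lintegral_indicator measurableSet_Ioi, lintegral_indicator measurableSet_Iio,
      ← lintegral_add_compl _ (measurableSet_Ioi (a := x)), compl_Ioi]
    congr 1
    refine (setLIntegral_congr ?_).symm
    rw [← Iio_union_right]
    exact (union_ae_eq_left_of_ae_eq_empty (ae_eq_empty.2 (hdiag x))).symm
  have mi1 : Measurable fun p : ℝ × ℝ => (Ioi p.1).indicator (F p.1) p.2 := by
    have : (fun p : ℝ × ℝ => (Ioi p.1).indicator (F p.1) p.2)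
        = {p : ℝ × ℝ | p.1 < p.2}.indicator (Function.uncurry F) := by
      ext p; simp [indicator, Function.uncurry]
    rw [this]
    exact hF.indicator (measurableSet_lt measurable_fst measurable_snd)
  have mi2 : Measurable fun p : ℝ × ℝ => (Iio p.1).indicator (F p.1) p.2 := by
    have : (fun p : ℝ × ℝ => (Iio p.1).indicator (F p.1) p.2)
        = {p : ℝ × ℝ | p.2 < p.1}.indicator (Function.uncurry F) := by
      ext p; simp [indicator, Function.uncurry]
    rw [this]
    exact hF.indicator (measurableSet_lt measurable_snd measurable_fst)
  simp_rw [hsplit]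
  rw [lintegral_add_left (Measurable.lintegral_prod_right' mi1),
    lintegral_lintegral_swap (f := fun x z => (Iio x).indicator (F x) z) mi2.aemeasurable,
    lintegral_add_left (m1.const_mul _)]
  congr 1
  -- On `x < z`, memorylessness of `z` multiplies the density of `x` by `exp (-b x)`; the product is
  -- `a / (a + b)` times the density of rate `a + b`. The other case is symmetric.
  · have e1 : ∀ᵐ x ∂expMeasure a, ∫⁻ z, (Ioi x).indicator (F x) z ∂expMeasure b
        = ENNReal.ofReal (Real.exp (-(b * x))) * ∫⁻ z, F x (x + z) ∂expMeasure b := by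
      filter_upwards [ae_expMeasure_pos ha] with x hx
      rw [lintegral_indicator measurableSet_Ioi, setLIntegral_Ioi_expMeasure hx.le (hFm x)]
    rw [lintegral_congr_ae e1, lintegral_expMeasure _ (by fun_prop),
      lintegral_expMeasure _ (by fun_prop)]
    refine lintegral_congr fun x => ?_
    rw [← mul_assoc, ← mul_assoc, ← ENNReal.ofReal_mul (by positivity),
      ← ENNReal.ofReal_mul (by positivity), add_mul a b x, neg_add, Real.exp_add]
    congr 2
    field_simp
  · have e1 : ∀ᵐ z ∂expMeasure b, ∫⁻ x, (Iio x).indicator (F x) z ∂expMeasure a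
        = ENNReal.ofReal (Real.exp (-(a * z))) * ∫⁻ x, F (z + x) z ∂expMeasure a := by
      filter_upwards [ae_expMeasure_pos hb] with z hz
      rw [← setLIntegral_Ioi_expMeasure hz.le (hFm' z), ← lintegral_indicator measurableSet_Ioi]
      rfl
    rw [lintegral_congr_ae e1, lintegral_expMeasure _ (by fun_prop),
      lintegral_expMeasure _ (by fun_prop)]
    refine lintegral_congr fun x => ?_
    rw [← mul_assoc, ← mul_assoc, ← ENNReal.ofReal_mul (by positivity),
      ← ENNReal.ofReal_mul (by positivity), add_mul a b x, neg_add, Real.exp_add]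
    congr 2
    field_simp

end Exponential

/-! ### Independence -/

section Independence

open scoped ENNReal

variable {Ω β γ : Type*} [MeasurableSpace Ω] [MeasurableSpace β] [MeasurableSpace γ]
  {μ : Measure Ω}

/-- The form in which independence is mostly checked below: two variables generated by disjoint
index sets of one independent family. -/
lemma indepFun_of_disjoint {ι : Type*} {f : ι → Ω → ℝ} (hf : iIndepFun f μ)
    (hm : ∀ i, Measurable (f i)) {S T : Set ι} (hST : Disjoint S T) {X : Ω → β} {Y : Ω → γ}
    (hX : Measurable[⨆ i ∈ S, MeasurableSpace.comap (f i) inferInstance] X)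
    (hY : Measurable[⨆ i ∈ T, MeasurableSpace.comap (f i) inferInstance] Y) :
    IndepFun X Y μ := by
  have h := indep_iSup_of_disjoint (fun i => (hm i).comap_le) hf hST
  rw [IndepFun_iff_Indep]
  exact indep_of_indep_of_le_left (indep_of_indep_of_le_right h hY.comap_le) hX.comap_le

lemma measurable_iSup_comap {ι Ω : Type*} (f : ι → Ω → ℝ) {S : Set ι} {i : ι} (hi : i ∈ S) :
    Measurable[⨆ i ∈ S, MeasurableSpace.comap (f i) inferInstance] (f i) :=
  (comap_measurable (f i)).mono (le_iSup₂_of_le i hi le_rfl) le_rfl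

lemma lintegral_indepFun [SFinite μ] {X : Ω → β} {Y : Ω → γ} {ν : Measure γ} [SFinite ν]
    (h : IndepFun X Y μ) (hX : Measurable X) (hY : HasLaw Y ν μ)
    [IsFiniteMeasure μ] {g : β × γ → ℝ≥0∞} (hg : Measurable g) :
    ∫⁻ ω, g (X ω, Y ω) ∂μ = ∫⁻ ω, ∫⁻ y, g (X ω, y) ∂ν ∂μ := by
  have h1 := (indepFun_iff_map_prod_eq_prod_map_map hX.aemeasurable hY.aemeasurable).1 h
  rw [hY.map_eq] at h1
  calc ∫⁻ ω, g (X ω, Y ω) ∂μ = ∫⁻ p, g p ∂(μ.map fun ω => (X ω, Y ω)) :=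
        (lintegral_map' hg.aemeasurable (hX.aemeasurable.prodMk hY.aemeasurable)).symm
    _ = ∫⁻ x, ∫⁻ y, g (x, y) ∂ν ∂(μ.map X) := by rw [h1, lintegral_prod _ hg.aemeasurable]
    _ = _ := lintegral_map hg.lintegral_prod_right' hX

end Independence

/-! ### Running minima -/

section RunMin

open Set
open scoped ENNReal

/-- The running minima of a sequence. -/
def runMin (z : ℕ → ℝ) : ℕ → ℝ
  | 0 => z 0
  | i + 1 => min (runMin z i) (z (i + 1))

/-- Extends running minima `v 0, …, v (n - 1)` by the minimum that takes `z` into account. -/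
def minStep (n : ℕ) (p : (ℕ → ℝ) × ℝ) : ℕ → ℝ :=
  Function.update p.1 n (if n = 0 then p.2 else min (p.1 (n - 1)) p.2)

lemma measurable_update_prod (n : ℕ) {α : Type*} [MeasurableSpace α] {f : α → ℕ → ℝ} {g : α → ℝ}
    (hf : Measurable f) (hg : Measurable g) :
    Measurable fun a => Function.update (f a) n (g a) := by
  refine measurable_pi_iff.2 fun i => ?_
  by_cases h : i = n
  · subst h; simpa using hg
  · simpa [Function.update_of_ne h, Function.comp_def] using (measurable_pi_apply i).comp hf

@[fun_prop]
lemma measurable_minStep (n : ℕ) : Measurable (minStep n) := by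
  unfold minStep
  refine measurable_update_prod n measurable_fst ?_
  split_ifs
  · fun_prop
  · exact ((measurable_pi_apply _).comp measurable_fst).min measurable_snd

/-- The law of the first `n` running minima of independent exponential variables with rates
`d 0, d 1, …`, continued by zeros. -/
def minMeasure (d : ℕ → ℝ) : ℕ → Measure (ℕ → ℝ)
  | 0 => Measure.dirac 0
  | n + 1 => ((minMeasure d n).prod (expMeasure (d n))).map (minStep n)

lemma isProbabilityMeasure_minMeasure {d : ℕ → ℝ} (hd : ∀ i, 0 < d i) (n : ℕ) :
    IsProbabilityMeasure (minMeasure d n) := by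
  induction n with
  | zero => exact Measure.dirac.isProbabilityMeasure
  | succ n ih =>
    have := isProbabilityMeasure_expMeasure (hd n)
    exact Measure.isProbabilityMeasure_map (measurable_minStep n).aemeasurable

lemma lintegral_minMeasure_succ {d : ℕ → ℝ} (hd : ∀ i, 0 < d i) (n : ℕ) {Φ : (ℕ → ℝ) → ℝ≥0∞}
    (hΦ : Measurable Φ) :
    ∫⁻ v, Φ v ∂minMeasure d (n + 1)
      = ∫⁻ v, ∫⁻ z, Φ (minStep n (v, z)) ∂expMeasure (d n) ∂minMeasure d n := by
  have := isProbabilityMeasure_minMeasure hd n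
  have := isProbabilityMeasure_expMeasure (hd n)
  rw [minMeasure, lintegral_map hΦ (measurable_minStep n),
    lintegral_prod (fun p => Φ (minStep n p)) (hΦ.comp (measurable_minStep n)).aemeasurable]

lemma minMeasure_congr {d d' : ℕ → ℝ} {n : ℕ} (h : ∀ i < n, d i = d' i) :
    minMeasure d n = minMeasure d' n := by
  induction n with
  | zero => rfl
  | succ n ih => rw [minMeasure, minMeasure, ih fun i hi => h i (by lia), h n (by lia)]

/-- Cuts a sequence off after `n` terms. -/
def cutoff (n : ℕ) (v : ℕ → ℝ) (i : ℕ) : ℝ := if i < n then v i else 0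

@[fun_prop]
lemma measurable_cutoff (n : ℕ) : Measurable (cutoff n) := by
  refine measurable_pi_iff.2 fun i => ?_
  unfold cutoff
  split_ifs <;> fun_prop

/-- Consistency: later variables do not alter the earlier running minima. -/
lemma lintegral_minMeasure_cutoff {d : ℕ → ℝ} (hd : ∀ i, 0 < d i) {m n : ℕ} (hmn : m ≤ n)
    {Φ : (ℕ → ℝ) → ℝ≥0∞} (hΦ : Measurable Φ) :
    ∫⁻ v, Φ (cutoff m v) ∂minMeasure d n = ∫⁻ v, Φ (cutoff m v) ∂minMeasure d m := by
  induction n, hmn using Nat.le_induction with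
  | base => rfl
  | succ n hmn ih =>
    have := isProbabilityMeasure_expMeasure (hd n)
    rw [lintegral_minMeasure_succ hd n (by fun_prop), ← ih]
    refine lintegral_congr fun v => ?_
    have : ∀ z, cutoff m (minStep n (v, z)) = cutoff m v := by
      intro z; ext i
      unfold cutoff minStep
      by_cases h : i < m
      · simp [Function.update_of_ne (show i ≠ n by lia)]
      · simp [h]
    simp [this]

/-- The point `d 0 + ⋯ + d i`. -/
def point (d : ℕ → ℝ) (i : ℕ) : ℝ := ∑ j ∈ Finset.range (i + 1), d j

lemma point_strictMono {d : ℕ → ℝ} (hd : ∀ i, 0 < d i) : StrictMono (point d) :=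
  strictMono_nat_of_lt_succ fun i => by
    simp only [point, Finset.sum_range_succ _ (i + 1)]; linarith [hd (i + 1)]

lemma point_pos {d : ℕ → ℝ} (hd : ∀ i, 0 < d i) (i : ℕ) : 0 < point d i :=
  Finset.sum_pos (fun j _ => hd j) ⟨0, by simp⟩

/-- The running minima after one step: the last minimum is `e`, attained at the position `w`. -/
def restart (d : ℕ → ℝ) (n : ℕ) (e w : ℝ) (v : ℕ → ℝ) (i : ℕ) : ℝ :=
  if i < n then e + (if point d i < w then v i else 0) else 0

lemma measurable_restart (d : ℕ → ℝ) (n : ℕ) :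
    Measurable fun q : ℝ × ℝ × (ℕ → ℝ) => restart d n q.1 q.2.1 q.2.2 := by
  refine measurable_pi_iff.2 fun i => ?_
  unfold restart
  split_ifs
  · refine measurable_fst.add (Measurable.ite ?_ (by fun_prop) measurable_const)
    exact measurableSet_lt measurable_const (by fun_prop)
  · exact measurable_const

lemma restart_succ {d : ℕ → ℝ} {n : ℕ} {e w : ℝ} {v : ℕ → ℝ} (hw : w < point d n) :
    restart d (n + 1) e w v = Function.update (restart d n e w v) n e := by
  ext i
  rcases lt_trichotomy i n with h | rfl | h
  · simp [restart, Function.update_of_ne h.ne, h, h.trans (Nat.lt_succ_self n)]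
  · simp [restart, hw.not_gt]
  · simp [restart, Function.update_of_ne h.ne', show ¬ i < n by lia, show ¬ i < n + 1 by lia]

/-- Induction on `n`. Let the minimum so far have rate `a = d 0 + ⋯ + d n`, and let a new variable
of rate `b` arrive. With probability `a / (a + b)` the old minimum survives and its position stays
uniform on `(0, a)`. With probability `b / (a + b)` the new variable is the minimum, its position is
placed in `(a, a + b)`, and the excesses of all old running minima are a fresh copy. The two cases
mix to a uniform position on `(0, a + b)`. -/
lemma lintegral_minMeasure_restart_last {d : ℕ → ℝ} (hd : ∀ i, 0 < d i) (n : ℕ)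
    {Φ : (ℕ → ℝ) → ℝ≥0∞} (hΦ : Measurable Φ) :
    ∫⁻ v, Φ v ∂minMeasure d (n + 1)
      = ∫⁻ e, (ENNReal.ofReal (1 / point d n) * ∫⁻ w in Ioo 0 (point d n),
          ∫⁻ v, Φ (restart d (n + 1) e w v) ∂minMeasure d (n + 1))
          ∂expMeasure (point d n) := by
  induction n generalizing Φ with
  | zero =>
    have := isProbabilityMeasure_minMeasure hd 1
    have hp : point d 0 = d 0 := by simp [point]
    have := isProbabilityMeasure_expMeasure (hd 0)
    rw [lintegral_minMeasure_succ hd 0 hΦ, minMeasure, lintegral_dirac' _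
      (Measurable.lintegral_prod_right' (f := fun p => Φ (minStep 0 p))
        (hΦ.comp (measurable_minStep 0))), hp]
    refine lintegral_congr fun e => ?_
    have : ∫⁻ w in Ioo 0 (d 0), ∫⁻ v, Φ (restart d (0 + 1) e w v) ∂minMeasure d (0 + 1)
        = ∫⁻ w in Ioo 0 (d 0), Φ (minStep 0 (0, e)) := by
      refine setLIntegral_congr_fun measurableSet_Ioo fun w hw => ?_
      have : ∀ v, restart d (0 + 1) e w v = minStep 0 (0, e) := by
        intro v
        rw [restart_succ (by rw [hp]; exact hw.2)]
        unfold minStep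
        congr 1
      simp [this]
    rw [this, setLIntegral_const, Real.volume_Ioo, sub_zero, mul_left_comm,
      ← ENNReal.ofReal_mul (by have := hd 0; positivity), one_div_mul_cancel (hd 0).ne']
    simp
  | succ n ih =>
    set a := point d n with ha_def
    set b := d (n + 1) with hb_def
    have ha : 0 < a := point_pos hd n
    have hb : 0 < b := hd (n + 1)
    have hab : point d (n + 1) = a + b := by
      rw [point, Finset.sum_range_succ]; rfl
    have P1 := isProbabilityMeasure_minMeasure hd (n + 1)
    have P2 := isProbabilityMeasure_minMeasure hd (n + 2)
    have P3 := isProbabilityMeasure_expMeasure ha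
    have P4 := isProbabilityMeasure_expMeasure hb
    have P5 := isProbabilityMeasure_expMeasure (add_pos ha hb)
    -- the inner expectation as a function of the two last minima
    let K : ℝ → ℝ → ℝ≥0∞ := fun e r => ENNReal.ofReal (1 / a) * ∫⁻ w in Ioo 0 a,
      ∫⁻ v, Φ (Function.update (restart d (n + 1) e w v) (n + 1) r) ∂minMeasure d (n + 1)
    have hK0 : Measurable fun q : ((ℝ × ℝ) × ℝ) × (ℕ → ℝ) =>
        Φ (Function.update (restart d (n + 1) q.1.1.1 q.1.2 q.2) (n + 1) q.1.1.2) := by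
      refine hΦ.comp (measurable_update_prod _ ?_ (by fun_prop))
      exact (measurable_restart d (n + 1)).comp
        (by fun_prop : Measurable fun q : ((ℝ × ℝ) × ℝ) × (ℕ → ℝ) => (q.1.1.1, q.1.2, q.2))
    have hK : Measurable (Function.uncurry K) :=
      (Measurable.lintegral_prod_right' hK0.lintegral_prod_right').const_mul _
    let Φ' : ℝ → (ℕ → ℝ) → ℝ≥0∞ := fun m v =>
      Φ (Function.update (cutoff (n + 1) fun i => m + v i) (n + 1) m)
    have hΦ' : ∀ m, Measurable (Φ' m) := fun m =>
      hΦ.comp (measurable_update_prod _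
        ((measurable_cutoff _).comp (by fun_prop)) measurable_const)
    -- left-hand side
    have lhs : ∫⁻ v, Φ v ∂minMeasure d (n + 1 + 1)
        = ∫⁻ e, ∫⁻ z, K e (min e z) ∂expMeasure b ∂expMeasure a := by
      rw [lintegral_minMeasure_succ hd _ hΦ,
        lintegral_lintegral_swap (by
          exact (hΦ.comp ((measurable_minStep _))).aemeasurable)]
      have : ∀ z, ∫⁻ v, Φ (minStep (n + 1) (v, z)) ∂minMeasure d (n + 1)
          = ∫⁻ e, K e (min e z) ∂expMeasure a := by
        intro z
        rw [ih (Φ := fun v => Φ (minStep (n + 1) (v, z)))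
          (hΦ.comp ((measurable_minStep _).comp measurable_prodMk_right))]
        refine lintegral_congr fun e => ?_
        simp only [K]
        congr 1
        refine setLIntegral_congr_fun measurableSet_Ioo fun w hw => ?_
        refine lintegral_congr fun v => ?_
        simp only [minStep]
        have : restart d (n + 1) e w v n = e := by
          rw [restart_succ hw.2]; simp
        simp [this]
      simp_rw [this]
      exact lintegral_lintegral_swap (f := fun z e => K e (min e z)) (hK.comp (by fun_prop :
        Measurable fun q : ℝ × ℝ => (q.2, min q.2 q.1))).aemeasurable
    -- If the new variable is the minimum `m`, the former minimum is `m + x` with `x` again of rate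
    -- `a`. The induction hypothesis, read backwards, reassembles the old running minima, all raised
    -- by `m`.
    have second : ∀ m, ∫⁻ x, K (m + x) m ∂expMeasure a
        = ∫⁻ v, Φ' m v ∂minMeasure d (n + 1) := by
      intro m
      rw [ih (hΦ' m)]
      refine lintegral_congr fun x => ?_
      simp only [K]
      congr 1
      refine setLIntegral_congr_fun measurableSet_Ioo fun w hw => lintegral_congr fun v => ?_
      simp only [Φ']
      congr 2
      ext i
      simp only [cutoff, restart]
      split_ifs <;> ring
    rw [lhs, lintegral_lintegral_expMeasure_min ha hb
      (F := fun e z => K e (min e z))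
      (hK.comp (by fun_prop : Measurable fun q : ℝ × ℝ => (q.1, min q.1 q.2))), hab]
    refine lintegral_congr_ae ?_
    filter_upwards [ae_expMeasure_pos (add_pos ha hb)] with m hm
    have e1 : ∫⁻ z, K m (min m (m + z)) ∂expMeasure b = K m m := by
      have : ∀ᵐ z ∂expMeasure b, K m (min m (m + z)) = K m m := by
        filter_upwards [ae_expMeasure_pos hb] with z hz
        rw [min_eq_left (by linarith)]
      rw [lintegral_congr_ae this]; simp
    have e2 : ∫⁻ x, K (m + x) (min (m + x) m) ∂expMeasure a
        = ∫⁻ v, Φ' m v ∂minMeasure d (n + 1) := by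
      rw [← second m]
      refine lintegral_congr_ae ?_
      filter_upwards [ae_expMeasure_pos ha] with x hx
      rw [min_eq_right (by linarith)]
    -- As `w` lies to the left of the last point, the last entry is `m` whatever `v` is, so only the
    -- first `n + 1` entries of `v` matter.
    have marg : ∀ w < a + b, ∫⁻ v, Φ (restart d (n + 1 + 1) m w v) ∂minMeasure d (n + 1 + 1)
        = ∫⁻ v, Φ (Function.update (restart d (n + 1) m w v) (n + 1) m)
            ∂minMeasure d (n + 1) := by
      intro w hw
      have h0 : ∀ v, restart d (n + 1 + 1) m w v
          = Function.update (restart d (n + 1) m w (cutoff (n + 1) v)) (n + 1) m := by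
        intro v
        rw [restart_succ (hab ▸ hw)]
        congr 1
        ext i
        simp only [restart, cutoff]
        split_ifs <;> rfl
      have h1 : ∀ v, Function.update (restart d (n + 1) m w v) (n + 1) m
          = Function.update (restart d (n + 1) m w (cutoff (n + 1) v)) (n + 1) m := by
        intro v
        congr 1
        ext i
        simp only [restart, cutoff]
        split_ifs <;> rfl
      simp_rw [h0]
      rw [lintegral_minMeasure_cutoff hd (Nat.le_succ (n + 1))
        (Φ := fun v => Φ (Function.update (restart d (n + 1) m w v) (n + 1) m))]
      · exact lintegral_congr fun v => by rw [← h1]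
      · exact hΦ.comp (measurable_update_prod _ ((measurable_restart d (n + 1)).comp
          (by fun_prop : Measurable fun v : ℕ → ℝ => (m, w, v))) measurable_const)
    -- For `w` in `(a, a + b)` all earlier points lie to the left of `w`, so the integrand does not
    -- depend on `w`; the point `a` is null.
    have split : ∫⁻ w in Ioo 0 (a + b),
          ∫⁻ v, Φ (restart d (n + 1 + 1) m w v) ∂minMeasure d (n + 1 + 1)
        = (∫⁻ w in Ioo 0 a,
          ∫⁻ v, Φ (Function.update (restart d (n + 1) m w v) (n + 1) m) ∂minMeasure d (n + 1))
          + ENNReal.ofReal b * ∫⁻ v, Φ' m v ∂minMeasure d (n + 1) := by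
      rw [← setLIntegral_congr (μ := volume) (s := Ioo 0 a ∪ Ioo a (a + b)),
        lintegral_union measurableSet_Ioo]
      · congr 1
        · exact setLIntegral_congr_fun measurableSet_Ioo fun w hw =>
            marg w (by linarith [hw.2])
        · rw [setLIntegral_congr_fun (g := fun _ => ∫⁻ v, Φ' m v ∂minMeasure d (n + 1))
            measurableSet_Ioo, setLIntegral_const, Real.volume_Ioo, mul_comm]
          · ring_nf
          · intro w hw
            simp only
            rw [marg w hw.2]
            refine lintegral_congr fun v => ?_
            simp only [Φ']
            congr 2
            ext i
            simp only [restart, cutoff]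
            split_ifs with h1 h2
            · rfl
            · exact absurd (((point_strictMono hd).monotone
                (by lia : i ≤ n)).trans_lt hw.1) h2
            · rfl
      · rw [Set.disjoint_left]
        intro w h1 h2
        exact absurd h1.2 (not_lt.2 h2.1.le)
      · have : Ioo 0 (a + b) = Ioo 0 a ∪ Ioo a (a + b) ∪ {a} := by
          ext w
          simp only [mem_union, mem_Ioo, mem_singleton_iff]
          constructor
          · rintro ⟨h1, h2⟩
            rcases lt_trichotomy w a with h | h | h
            · exact Or.inl (Or.inl ⟨h1, h⟩)
            · exact Or.inr h
            · exact Or.inl (Or.inr ⟨h, h2⟩)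
          · rintro ((h | h) | h) <;> constructor <;> linarith [h]
        rw [this]
        exact (union_ae_eq_left_of_ae_eq_empty (ae_eq_empty.2 (by simp))).symm
    rw [e1, e2, split, mul_add]
    have hfac : ENNReal.ofReal (a / (a + b))
        = ENNReal.ofReal (1 / (a + b)) * ENNReal.ofReal a := by
      rw [← ENNReal.ofReal_mul (by positivity)]; congr 1; ring
    have hfac2 : ENNReal.ofReal (b / (a + b))
        = ENNReal.ofReal (1 / (a + b)) * ENNReal.ofReal b := by
      rw [← ENNReal.ofReal_mul (by positivity)]; congr 1; ring
    congr 1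
    · simp only [K]
      rw [hfac, mul_assoc, ← mul_assoc (ENNReal.ofReal a), ← ENNReal.ofReal_mul ha.le,
        mul_one_div_cancel ha.ne']
      simp
    · rw [hfac2, mul_assoc]

end RunMin

/-! ### Restarting at an arbitrary endpoint `L`, and the joint law of running minima. -/

section RunMin

open Set
open scoped ENNReal

lemma exists_forall_lt_iff {d : ℕ → ℝ} (hd : ∀ i, 0 < d i) (n : ℕ) (L : ℝ) :
    ∃ m ≤ n, ∀ i, (i < n ∧ point d i < L) ↔ i < m := by
  induction n with
  | zero => exact ⟨0, le_rfl, by simp⟩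
  | succ n ih =>
    by_cases h : point d n < L
    · refine ⟨n + 1, le_rfl, fun i => ⟨fun hi => hi.1, fun hi => ⟨hi, ?_⟩⟩⟩
      exact ((point_strictMono hd).monotone (by lia)).trans_lt h
    · obtain ⟨m, hm, hi⟩ := ih
      refine ⟨m, by lia, fun i => ?_⟩
      rw [← hi i]
      constructor
      · rintro ⟨h1, h2⟩
        refine ⟨lt_of_le_of_ne (by lia) ?_, h2⟩
        rintro rfl
        exact h h2
      · rintro ⟨h1, h2⟩
        exact ⟨by lia, h2⟩

lemma lintegral_Ioo_eq_lintegral_Icc_mul {L : ℝ} (hL : 0 < L) {f : ℝ → ℝ≥0∞} :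
    ENNReal.ofReal (1 / L) * ∫⁻ w in Ioo 0 L, f w = ∫⁻ u in Icc 0 1, f (u * L) := by
  have h := lintegral_image_eq_lintegral_abs_deriv_mul (s := Icc (0 : ℝ) 1)
    (f := fun u => u * L) (f' := fun _ => L) measurableSet_Icc
    (fun x _ => by simpa using ((hasDerivAt_id x).mul_const L).hasDerivWithinAt)
    (fun x _ y _ hxy => by simpa [hL.ne'] using hxy) f
  have him : (fun u : ℝ => u * L) '' Icc 0 1 = Icc 0 L := by
    rw [image_mul_right_Icc (by norm_num) hL.le]; simp
  rw [setLIntegral_congr Ioo_ae_eq_Icc, ← him, h, lintegral_const_mul' _ _ (by simp), ← mul_assoc,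
    ← ENNReal.ofReal_mul (by positivity), abs_of_pos hL, one_div_mul_cancel hL.ne']
  simp

/-- The running minima at the points to the left of `L` have the same law as those obtained in
one step: the minimum on `[0, L]` is `e / L`, attained at `u L`, with `e` exponential and `u`
uniform, and to the left of it the running minima start afresh. -/
lemma lintegral_minMeasure_restart {d : ℕ → ℝ} (hd : ∀ i, 0 < d i) (n : ℕ) {L : ℝ} (hL : 0 < L)
    {Φ : (ℕ → ℝ) → ℝ≥0∞} (hΦ : Measurable Φ) :
    ∫⁻ v, Φ (fun i => if i < n ∧ point d i < L then v i else 0) ∂minMeasure d n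
      = ∫⁻ e, (∫⁻ u in Icc 0 1, ∫⁻ v, Φ (fun i => if i < n ∧ point d i < L then
          e / L + (if point d i < u * L then v i else 0) else 0) ∂minMeasure d n)
          ∂expMeasure 1 := by
  obtain ⟨m, hmn, hm⟩ := exists_forall_lt_iff hd n L
  simp_rw [hm]
  change ∫⁻ v, Φ (cutoff m v) ∂minMeasure d n
    = ∫⁻ e, (∫⁻ u in Icc 0 1, ∫⁻ v, Φ (restart d m (e / L) (u * L) v) ∂minMeasure d n)
      ∂expMeasure 1
  have hgap : 0 < L - ∑ j ∈ Finset.range m, d j := by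
    rcases Nat.eq_zero_or_pos m with rfl | h0
    · simpa using hL
    · have := ((hm (m - 1)).2 (by lia)).2
      rw [point, Nat.sub_add_cancel h0] at this
      linarith
  -- `L` need not be one of the points. Adjusting the length with index `m` makes `L` the point of
  -- index `m` for `d'`, where `lintegral_minMeasure_restart_last` applies; the points below `L` do
  -- not change.
  set d' := Function.update d m (L - ∑ j ∈ Finset.range m, d j) with hd'_def
  have hdd : ∀ i < m, d i = d' i := fun i hi => by
    rw [hd'_def, Function.update_of_ne hi.ne]
  have hd' : ∀ i, 0 < d' i := by
    intro i
    by_cases h : i = m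
    · subst h; simpa [hd'_def] using hgap
    · rw [hd'_def, Function.update_of_ne h]; exact hd i
  have hp : ∀ i < m, point d' i = point d i := fun i hi =>
    Finset.sum_congr rfl fun j hj => (hdd j (by have := Finset.mem_range.1 hj; lia)).symm
  have hpm : point d' m = L := by
    rw [point, Finset.sum_range_succ, Finset.sum_congr rfl fun j hj =>
      (hdd j (Finset.mem_range.1 hj)).symm]
    simp [hd'_def]
  have hrm : ∀ e w, Measurable fun v => restart d m e w v := fun e w =>
    (measurable_restart d m).comp (by fun_prop : Measurable fun v : ℕ → ℝ => (e, w, v))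
  have hr : ∀ e w v, cutoff m (restart d' (m + 1) e w v) = restart d m e w (cutoff m v) := by
    intro e w v
    ext i
    simp only [cutoff, restart]
    split_ifs with h1 h2 h3 h4 h5 <;> first | rfl | skip
    · rw [hp i h1] at h3; exact absurd h3 h4
    · rw [hp i h1] at h3; exact absurd h5 h3
    · lia
    · lia
  have hr2 : ∀ e w v, restart d m e w v = restart d m e w (cutoff m v) := by
    intro e w v
    ext i
    simp only [cutoff, restart]
    split_ifs <;> rfl
  have hinner : ∀ e w, ∫⁻ v, Φ (cutoff m (restart d' (m + 1) e w v)) ∂minMeasure d' (m + 1)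
      = ∫⁻ v, Φ (restart d m e w v) ∂minMeasure d n := by
    intro e w
    have h2 : ∀ ν : Measure (ℕ → ℝ), ∫⁻ v, Φ (restart d m e w v) ∂ν
        = ∫⁻ v, Φ (restart d m e w (cutoff m v)) ∂ν := fun ν =>
      lintegral_congr fun v => by rw [← hr2]
    rw [h2]
    simp_rw [hr]
    rw [lintegral_minMeasure_cutoff hd' (Nat.le_succ m) (Φ := fun v => Φ (restart d m e w v))
        (hΦ.comp (hrm e w)), ← minMeasure_congr hdd,
      lintegral_minMeasure_cutoff hd hmn (Φ := fun v => Φ (restart d m e w v))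
        (hΦ.comp (hrm e w))]
  have : IsProbabilityMeasure (minMeasure d n) := isProbabilityMeasure_minMeasure hd n
  rw [lintegral_minMeasure_cutoff hd hmn hΦ, minMeasure_congr hdd,
    ← lintegral_minMeasure_cutoff hd' (Nat.le_succ m) hΦ,
    lintegral_minMeasure_restart_last hd' m (Φ := fun v => Φ (cutoff m v))
      (hΦ.comp (measurable_cutoff m))]
  simp only [hinner, hpm]
  simp_rw [lintegral_Ioo_eq_lintegral_Icc_mul hL]
  -- A minimum of rate `L` is written as `e / L` with `e` of rate `1`.
  rw [← one_mul L, ← map_div_expMeasure one_pos hL, one_mul, lintegral_map _ (by fun_prop)]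
  have h3 : Measurable fun q : (ℝ × ℝ) × (ℕ → ℝ) => Φ (restart d m q.1.1 (q.1.2 * L) q.2) :=
    hΦ.comp ((measurable_restart d m).comp (by fun_prop :
      Measurable fun q : (ℝ × ℝ) × (ℕ → ℝ) => (q.1.1, q.1.2 * L, q.2)))
  exact Measurable.lintegral_prod_right' h3.lintegral_prod_right'

/-- The law of the running minima of independent exponential variables. -/
lemma map_runMin {Ω : Type*} [MeasurableSpace Ω] {P : Measure Ω} [IsProbabilityMeasure P]
    {d : ℕ → ℝ} {Z : ℕ → Ω → ℝ} (hZ : ∀ i, HasLaw (Z i) (expMeasure (d i)) P)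
    (hm : ∀ i, Measurable (Z i)) (hind : iIndepFun Z P) (n : ℕ) :
    P.map (fun ω => cutoff n (runMin fun i => Z i ω)) = minMeasure d n := by
  have hmeas : ∀ {m : MeasurableSpace Ω} (n : ℕ), (∀ i < n, Measurable[m] (Z i)) →
      Measurable[m] (fun ω => cutoff n (runMin fun i => Z i ω)) := by
    intro m n h
    have hr : ∀ i < n, Measurable[m] fun ω => runMin (fun i => Z i ω) i := by
      intro i hi
      induction i with
      | zero => exact h 0 hi
      | succ i ih => exact (ih (by lia)).min (h _ hi)
    refine measurable_pi_iff.2 fun i => ?_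
    unfold cutoff
    split_ifs with hi
    · exact hr i hi
    · exact measurable_const
  induction n with
  | zero =>
    have : (fun ω => cutoff 0 (runMin fun i => Z i ω)) = fun _ => 0 := by
      ext ω i; simp [cutoff]
    rw [this, Measure.map_const]
    simp [minMeasure]
  | succ n ih =>
    have hi : IndepFun (fun ω => cutoff n (runMin fun i => Z i ω)) (Z n) P := by
      refine indepFun_of_disjoint hind hm (S := Iio n) (T := {n}) (by simp) ?_ ?_
      · exact hmeas n fun i hi => measurable_iSup_comap Z hi
      · exact measurable_iSup_comap Z rfl
    have h1 := (indepFun_iff_map_prod_eq_prod_map_map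
      (hmeas n fun i _ => hm i).aemeasurable (hm n).aemeasurable).1 hi
    rw [minMeasure, ← ih, ← (hZ n).map_eq, ← h1, Measure.map_map (measurable_minStep n)
      ((hmeas n fun i _ => hm i).prodMk (hm n))]
    congr 1
    ext ω i
    simp only [Function.comp_apply, minStep]
    rcases lt_trichotomy i n with h | rfl | h
    · simp [cutoff, Function.update_of_ne h.ne, h, h.trans (Nat.lt_succ_self n)]
    · cases i with
      | zero => simp [cutoff, runMin]
      | succ i => simp [cutoff, runMin]
    · simp [cutoff, Function.update_of_ne h.ne', show ¬ i < n by lia, show ¬ i < n + 1 by lia]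

end RunMin

/-! ### The chain of successive minima -/

section Chain

open Set
open scoped ENNReal

variable {Ω : Type*}

/-- The position `U 0 ⋯ U (s - 1)`. -/
def chainPos (U : ℕ → Ω → ℝ) (s : ℕ) (ω : Ω) : ℝ := ∏ j ∈ Finset.range s, U j ω

/-- The `s`-th increment of the minimum on `[0, x]`. -/
def chainInc (U E : ℕ → Ω → ℝ) (x : ℝ) (s : ℕ) (ω : Ω) : ℝ :=
  if x < chainPos U s ω then E s ω / chainPos U s ω else 0

/-- The minimum on `[0, x]` after `N` steps. -/
def chainSum (U E : ℕ → Ω → ℝ) (x : ℝ) (N : ℕ) (ω : Ω) : ℝ :=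
  ∑ s ∈ Finset.range N, chainInc U E x s ω

/-- The minimum on `[0, x]`. -/
def chainMin (U E : ℕ → Ω → ℝ) (x : ℝ) (ω : Ω) : ℝ≥0∞ :=
  ∑' s, ENNReal.ofReal (chainInc U E x s ω)

lemma chainPos_succ (U : ℕ → Ω → ℝ) (s : ℕ) (ω : Ω) :
    chainPos U (s + 1) ω = U s ω * chainPos U s ω := by
  rw [chainPos, Finset.prod_range_succ, mul_comm]; rfl

lemma measurable_chainPos {m : MeasurableSpace Ω} {U : ℕ → Ω → ℝ} {s : ℕ}
    (h : ∀ j < s, Measurable (U j)) : Measurable (chainPos U s) :=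
  Finset.measurable_fun_prod _ fun j hj => h j (Finset.mem_range.1 hj)

lemma measurable_chainInc {m : MeasurableSpace Ω} {U E : ℕ → Ω → ℝ} {s : ℕ} (x : ℝ)
    (hU : ∀ j < s, Measurable (U j)) (hE : Measurable (E s)) : Measurable (chainInc U E x s) :=
  Measurable.ite (measurableSet_lt measurable_const (measurable_chainPos hU))
    (hE.div (measurable_chainPos hU)) measurable_const

lemma measurable_chainSum {m : MeasurableSpace Ω} {U E : ℕ → Ω → ℝ} {N : ℕ} (x : ℝ)
    (hU : ∀ j < N, Measurable (U j)) (hE : ∀ j < N, Measurable (E j)) :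
    Measurable (chainSum U E x N) :=
  Finset.measurable_fun_sum _ fun s hs => by
    have := Finset.mem_range.1 hs
    exact measurable_chainInc x (fun j hj => hU j (by lia)) (hE s this)

variable [MeasurableSpace Ω]

/-- The standing assumptions on the uniform and exponential variables of the limit. -/
structure IsChain (U E : ℕ → Ω → ℝ) (Q : Measure Ω) : Prop where
  measurable_U : ∀ j, Measurable (U j)
  measurable_E : ∀ j, Measurable (E j)
  law_U : ∀ j, HasLaw (U j) (volume.restrict (Icc (0 : ℝ) 1)) Q
  law_E : ∀ j, HasLaw (E j) (expMeasure 1) Q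
  indep : iIndepFun (Sum.elim U E) Q

variable {U E : ℕ → Ω → ℝ} {Q : Measure Ω}

lemma IsChain.ae_mem_Ioo (h : IsChain U E Q) : ∀ᵐ ω ∂Q, ∀ j, U j ω ∈ Ioo (0 : ℝ) 1 := by
  rw [ae_all_iff]
  intro j
  refine (h.law_U j).ae_iff (p := fun x => x ∈ Ioo (0 : ℝ) 1) ?_ |>.2 ?_
  · exact measurableSet_Ioo.mem
  · rw [← restrict_Ioo_eq_restrict_Icc]
    exact ae_restrict_mem measurableSet_Ioo

lemma IsChain.ae_pos (h : IsChain U E Q) : ∀ᵐ ω ∂Q, ∀ j, 0 < E j ω := by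
  rw [ae_all_iff]
  intro j
  refine (h.law_E j).ae_iff (p := fun x => 0 < x) ?_ |>.2 (ae_expMeasure_pos one_pos)
  exact measurableSet_Ioi.mem

/-- The value at the points of the running minima after `N` steps, continued by `v`. -/
def chainJoin (U E : ℕ → Ω → ℝ) (d : ℕ → ℝ) (n N : ℕ) (ω : Ω) (v : ℕ → ℝ) (i : ℕ) : ℝ :=
  if i < n then chainSum U E (point d i) N ω
    + (if point d i < chainPos U N ω then v i else 0) else 0

/-- Induction on `N`: one step decomposes the fresh minima `v` on `[0, chainPos U N]` by
`lintegral_minMeasure_restart`, with `E N` and `U N`, independent of the past, as the exponential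
and the uniform variable. So the law of the joined sequence does not depend on `N`. -/
lemma lintegral_chainJoin (h : IsChain U E Q) [IsProbabilityMeasure Q] {d : ℕ → ℝ}
    (hd : ∀ i, 0 < d i) {n : ℕ} (hn : ∀ i < n, point d i < 1) (N : ℕ) {Φ : (ℕ → ℝ) → ℝ≥0∞}
    (hΦ : Measurable Φ) :
    ∫⁻ ω, ∫⁻ v, Φ (chainJoin U E d n N ω v) ∂minMeasure d n ∂Q
      = ∫⁻ v, Φ (cutoff n v) ∂minMeasure d n := by
  have := isProbabilityMeasure_minMeasure hd n
  have := isProbabilityMeasure_expMeasure one_pos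
  induction N with
  | zero =>
    have : ∀ ω v, chainJoin U E d n 0 ω v = cutoff n v := by
      intro ω v
      ext i
      simp only [chainJoin, cutoff, chainSum, chainPos, Finset.range_zero, Finset.sum_empty,
        Finset.prod_empty, zero_add]
      by_cases h1 : i < n
      · simp [h1, hn i h1]
      · simp [h1]
    simp [this]
  | succ N ih =>
    rw [← ih]
    let X : Ω → (ℕ → ℝ) × ℝ := fun ω => (fun i => chainSum U E (point d i) N ω, chainPos U N ω)
    have hXm : ∀ {m : MeasurableSpace Ω}, (∀ j < N, Measurable[m] (U j)) →
        (∀ j < N, Measurable[m] (E j)) → Measurable[m] X := fun hU hE =>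
      (measurable_pi_iff.2 fun i => measurable_chainSum _ hU hE).prodMk (measurable_chainPos hU)
    have hS : ∀ i, Measurable (Sum.elim U E i) := by
      rintro (i | i)
      · exact h.measurable_U i
      · exact h.measurable_E i
    have hUE : IndepFun (E N) (U N) Q :=
      h.indep.indepFun (show (Sum.inr N : ℕ ⊕ ℕ) ≠ Sum.inl N by simp)
    have hXY : IndepFun X (fun ω => (E N ω, U N ω)) Q := by
      refine indepFun_of_disjoint h.indep hS
        (S := {i | ∃ j < N, i = Sum.inl j ∨ i = Sum.inr j}) (T := {Sum.inl N, Sum.inr N}) ?_ ?_ ?_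
      · rw [Set.disjoint_left]
        rintro i ⟨j, hj, rfl | rfl⟩ <;> simp [hj.ne]
      · refine hXm (fun j hj => ?_) (fun j hj => ?_)
        · exact measurable_iSup_comap (Sum.elim U E) (i := Sum.inl j) ⟨j, hj, Or.inl rfl⟩
        · exact measurable_iSup_comap (Sum.elim U E) (i := Sum.inr j) ⟨j, hj, Or.inr rfl⟩
      · refine Measurable.prodMk ?_ ?_
        · exact measurable_iSup_comap (Sum.elim U E) (i := Sum.inr N) (by simp)
        · exact measurable_iSup_comap (Sum.elim U E) (i := Sum.inl N) (by simp)
    have hlaw : HasLaw (fun ω => (E N ω, U N ω))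
        ((expMeasure 1).prod (volume.restrict (Icc (0 : ℝ) 1))) Q := by
      refine ⟨((h.measurable_E N).prodMk (h.measurable_U N)).aemeasurable, ?_⟩
      rw [(indepFun_iff_map_prod_eq_prod_map_map (h.measurable_E N).aemeasurable
        (h.measurable_U N).aemeasurable).1 hUE, (h.law_E N).map_eq, (h.law_U N).map_eq]
    -- the joined sequence as a function of the past and of the last two variables
    let J : (((ℕ → ℝ) × ℝ) × (ℝ × ℝ)) × (ℕ → ℝ) → ℕ → ℝ := fun q i =>
      if i < n then q.1.1.1 i + (if i < n ∧ point d i < q.1.1.2 then q.1.2.1 / q.1.1.2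
        + (if point d i < q.1.2.2 * q.1.1.2 then q.2 i else 0) else 0) else 0
    have hJ : Measurable J := by
      refine measurable_pi_iff.2 fun i => ?_
      simp only [J]
      by_cases hi : i < n
      · simp only [hi, if_true, true_and]
        refine Measurable.add (by fun_prop) (Measurable.ite
          (measurableSet_lt measurable_const (by fun_prop)) (Measurable.add (by fun_prop)
            (Measurable.ite (measurableSet_lt measurable_const (by fun_prop)) (by fun_prop)
              measurable_const)) measurable_const)
      · simp [hi]
    have e1 : ∀ᵐ ω ∂Q, ∫⁻ v, Φ (chainJoin U E d n (N + 1) ω v) ∂minMeasure d n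
        = ∫⁻ v, Φ (J ((X ω, (E N ω, U N ω)), v)) ∂minMeasure d n := by
      filter_upwards [h.ae_mem_Ioo] with ω hω
      refine lintegral_congr fun v => ?_
      congr 1
      ext i
      have hpos : 0 < chainPos U N ω := Finset.prod_pos fun j _ => (hω j).1
      have hle : U N ω * chainPos U N ω ≤ chainPos U N ω := by
        nlinarith [(hω N).2]
      simp only [chainJoin, J, X, chainSum, Finset.sum_range_succ, chainInc, chainPos_succ]
      by_cases h1 : i < n
      · by_cases h2 : point d i < chainPos U N ω
        · simp only [h1, h2, if_true, true_and]
          ring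
        · have h3 : ¬ point d i < U N ω * chainPos U N ω := fun h3 => h2 (h3.trans_le hle)
          simp [h1, h2, h3]
      · simp [h1]
    rw [lintegral_congr_ae e1, lintegral_indepFun hXY
      (hXm (fun j _ => h.measurable_U j) fun j _ => h.measurable_E j) hlaw
      (g := fun q => ∫⁻ v, Φ (J (q, v)) ∂minMeasure d n)
      ((hΦ.comp hJ).lintegral_prod_right')]
    refine lintegral_congr_ae ?_
    filter_upwards [h.ae_mem_Ioo] with ω hω
    have hpos : 0 < chainPos U N ω := Finset.prod_pos fun j _ => (hω j).1
    -- With `ω` frozen, the past enters only through the shifts `c` and through `chainPos U N ω`,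
    -- which plays the role of `L`.
    let c : ℕ → ℝ := fun i => chainSum U E (point d i) N ω
    have hc : Measurable fun y : ℕ → ℝ => Φ (cutoff n fun i => c i + y i) := by
      refine hΦ.comp ((measurable_cutoff n).comp (by fun_prop))
    have key := lintegral_minMeasure_restart hd n hpos hc
    have hJ2 : Measurable fun y : ℝ × ℝ => ∫⁻ v, Φ (J ((X ω, y), v)) ∂minMeasure d n :=
      (((hΦ.comp hJ).lintegral_prod_right')).comp measurable_prodMk_left
    rw [lintegral_prod _ hJ2.aemeasurable]
    refine Eq.trans ?_ (key.symm.trans ?_)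
    · rfl
    · refine lintegral_congr fun v => ?_
      congr 1
      ext i
      simp only [cutoff, chainJoin, c]
      split_ifs <;> simp_all

end Chain

/-! ### The path of successive minima: almost sure shape, integral, and finite-dimensional laws. -/

section Chain

open Set
open scoped ENNReal

variable {Ω : Type*} {U E : ℕ → Ω → ℝ}

lemma measurable_chainMin_prod [MeasurableSpace Ω] (hU : ∀ j, Measurable (U j))
    (hE : ∀ j, Measurable (E j)) : Measurable fun q : ℝ × Ω => chainMin U E q.1 q.2 := by
  refine Measurable.tsum fun s => ?_
  have hp : Measurable (chainPos U s) := measurable_chainPos fun j _ => hU j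
  refine Measurable.ennreal_ofReal (Measurable.ite ?_ ?_ measurable_const)
  · exact measurableSet_lt measurable_fst (hp.comp measurable_snd)
  · exact ((hE s).div hp).comp measurable_snd

lemma measurable_chainMin [MeasurableSpace Ω] (hU : ∀ j, Measurable (U j))
    (hE : ∀ j, Measurable (E j)) (x : ℝ) : Measurable (chainMin U E x) :=
  (measurable_chainMin_prod hU hE).comp measurable_prodMk_left

/-- The sample points at which the chain behaves as it does almost surely. -/
structure IsGood (U E : ℕ → Ω → ℝ) (ω : Ω) : Prop where
  mem_Ioo : ∀ j, U j ω ∈ Ioo (0 : ℝ) 1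
  pos : ∀ j, 0 < E j ω
  tendsto : Tendsto (fun s => chainPos U s ω) atTop (𝓝 0)

lemma IsGood.chainPos_pos {ω : Ω} (h : IsGood U E ω) (s : ℕ) : 0 < chainPos U s ω :=
  Finset.prod_pos fun j _ => (h.mem_Ioo j).1

lemma IsGood.chainPos_strictAnti {ω : Ω} (h : IsGood U E ω) :
    StrictAnti fun s => chainPos U s ω :=
  strictAnti_nat_of_succ_lt fun s => by
    rw [chainPos_succ]
    have := h.chainPos_pos s
    nlinarith [(h.mem_Ioo s).2]

lemma IsGood.chainInc_nonneg {ω : Ω} (h : IsGood U E ω) (x : ℝ) (s : ℕ) :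
    0 ≤ chainInc U E x s ω := by
  unfold chainInc
  split_ifs
  · exact (div_pos (h.pos s) (h.chainPos_pos s)).le
  · exact le_rfl

/-- The positions decrease, so after the first one that is at most `x` all increments vanish. -/
lemma IsGood.chainMin_eq {ω : Ω} (h : IsGood U E ω) {x : ℝ} {N : ℕ}
    (hx : chainPos U N ω ≤ x) : chainMin U E x ω = ENNReal.ofReal (chainSum U E x N ω) := by
  have h0 : ∀ s ∉ Finset.range N, ENNReal.ofReal (chainInc U E x s ω) = 0 := by
    intro s hs
    have : chainPos U s ω ≤ x :=
      (h.chainPos_strictAnti.antitone (by simpa using hs)).trans hx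
    simp [chainInc, this.not_gt]
  rw [chainMin, tsum_eq_sum h0, chainSum, ENNReal.ofReal_sum_of_nonneg]
  exact fun s _ => h.chainInc_nonneg x s

lemma IsGood.chainSum_eq {ω : Ω} (h : IsGood U E ω) {x : ℝ} {p : ℕ}
    (hx : x ∈ Ico (chainPos U (p + 1) ω) (chainPos U p ω)) :
    chainSum U E x (p + 1) ω = ∑ s ∈ Finset.range (p + 1), E s ω / chainPos U s ω := by
  refine Finset.sum_congr rfl fun s hs => ?_
  have : x < chainPos U s ω :=
    hx.2.trans_le (h.chainPos_strictAnti.antitone (by simpa [Nat.lt_succ_iff] using hs))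
  simp [chainInc, this]

lemma IsGood.chainMin_antitone {ω : Ω} (h : IsGood U E ω) : Antitone fun x => chainMin U E x ω := by
  intro x y hxy
  refine ENNReal.tsum_le_tsum fun s => ENNReal.ofReal_le_ofReal ?_
  by_cases hy : y < chainPos U s ω
  · simp [chainInc, hy, hxy.trans_lt hy]
  · simp only [chainInc, hy, if_false]
    exact h.chainInc_nonneg x s

/-- `(k! h)^{1/k}`. -/
def rootFun (k : ℕ) (h : ℝ≥0∞) : ℝ≥0∞ := ((k.factorial : ℝ≥0∞) * h) ^ (1 / (k : ℝ))

@[fun_prop]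
lemma measurable_rootFun (k : ℕ) : Measurable (rootFun k) := by
  unfold rootFun; fun_prop

lemma rootFun_mono (k : ℕ) : Monotone (rootFun k) := fun a b h => by
  unfold rootFun; gcongr

lemma rootFun_ofReal (k : ℕ) {x : ℝ} (hx : 0 ≤ x) :
    rootFun k (ENNReal.ofReal x) = ENNReal.ofReal (((k.factorial : ℝ) * x) ^ (1 / (k : ℝ))) := by
  rw [rootFun, ← ENNReal.ofReal_natCast, ← ENNReal.ofReal_mul (by positivity),
    ENNReal.ofReal_rpow_of_nonneg (by positivity) (by positivity)]

/-- The limit variable as an integral over the path of successive minima. -/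
def pathIntegral (k : ℕ) (U E : ℕ → Ω → ℝ) (ω : Ω) : ℝ≥0∞ :=
  ∫⁻ x in Ioo 0 1, rootFun k (chainMin U E x ω)

/-- `B_p` is the area of a rectangle under the path: an interval between consecutive positions times
the constant height there. Since `∏_{s ≤ j < p} U_j` is `chainPos U p / chainPos U s`, a factor
`(chainPos U p)^{1/k}` leaves the root and completes the exponent `1 - 1/k` to `1`. -/
lemma IsGood.limitB_eq {ω : Ω} (h : IsGood U E ω) (k p : ℕ) :
    limitB k U E p ω = (chainPos U p ω - chainPos U (p + 1) ω)
      * ((k.factorial : ℝ) * ∑ s ∈ Finset.range (p + 1), E s ω / chainPos U s ω) ^ (1 / (k : ℝ)) := by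
  have hp := h.chainPos_pos p
  have hsum : ∑ s ∈ Finset.range (p + 1), (∏ j ∈ Finset.Ico s p, U j ω) * E s ω
      = chainPos U p ω * ∑ s ∈ Finset.range (p + 1), E s ω / chainPos U s ω := by
    rw [Finset.mul_sum]
    refine Finset.sum_congr rfl fun s hs => ?_
    have hsp : s ≤ p := by simpa [Nat.lt_succ_iff] using hs
    have := Finset.prod_range_mul_prod_Ico (fun j => U j ω) hsp
    have hs0 := h.chainPos_pos s
    rw [chainPos, ← this]
    change _ = chainPos U s ω * _ * _
    field_simp
  have hnn : 0 ≤ ∑ s ∈ Finset.range (p + 1), E s ω / chainPos U s ω :=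
    Finset.sum_nonneg fun s _ => (div_pos (h.pos s) (h.chainPos_pos s)).le
  rw [limitB, limitS, hsum, chainPos_succ]
  change _ * chainPos U p ω ^ _ * _ = _
  rw [mul_left_comm, Real.mul_rpow hp.le (by positivity), Real.rpow_sub hp, Real.rpow_one]
  have : chainPos U p ω ^ (1 / (k : ℝ)) ≠ 0 := (Real.rpow_pos_of_pos hp _).ne'
  field_simp

lemma IsGood.limitB_nonneg {ω : Ω} (h : IsGood U E ω) (k p : ℕ) :
    0 ≤ limitB k U E p ω := by
  rw [h.limitB_eq k]
  have := h.chainPos_strictAnti (Nat.lt_succ_self p)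
  have hnn : 0 ≤ ∑ s ∈ Finset.range (p + 1), E s ω / chainPos U s ω :=
    Finset.sum_nonneg fun s _ => (div_pos (h.pos s) (h.chainPos_pos s)).le
  have : 0 ≤ chainPos U p ω - chainPos U (p + 1) ω := by linarith
  positivity

/-- The path is constant between consecutive positions, and these intervals tile `(0, 1)` up to a
null set because the positions start at `1` and tend to `0`. -/
lemma IsGood.pathIntegral_eq {ω : Ω} (h : IsGood U E ω) (k : ℕ) :
    pathIntegral k U E ω = ∑' p, ENNReal.ofReal (limitB k U E p ω) := by
  have hun : Ioo (0 : ℝ) 1 = ⋃ p, Ico (chainPos U (p + 1) ω) (chainPos U p ω) := by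
    ext x
    simp only [mem_iUnion]
    constructor
    · rintro ⟨h0, h1⟩
      have hex : ∃ p, chainPos U p ω ≤ x :=
        ((h.tendsto.eventually (gt_mem_nhds h0)).exists).imp fun p hp => hp.le
      classical
      have hf := Nat.find_spec hex
      have hpos : Nat.find hex ≠ 0 := by
        intro h00
        rw [h00] at hf
        simp [chainPos] at hf
        linarith
      refine ⟨Nat.find hex - 1, ?_, ?_⟩
      · rwa [Nat.sub_add_cancel (Nat.pos_of_ne_zero hpos)]
      · exact not_le.1 (Nat.find_min hex (by lia))
    · rintro ⟨p, hp⟩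
      refine ⟨(h.chainPos_pos _).trans_le hp.1, hp.2.trans_le ?_⟩
      have := h.chainPos_strictAnti.antitone (Nat.zero_le p)
      simpa [chainPos] using this
  have hdisj : Pairwise (Function.onFun Disjoint
      fun p => Ico (chainPos U (p + 1) ω) (chainPos U p ω)) :=
    h.chainPos_strictAnti.antitone.pairwise_disjoint_on_Ico_succ
  rw [pathIntegral, hun, lintegral_iUnion (fun p => measurableSet_Ico) hdisj]
  refine tsum_congr fun p => ?_
  have hnn : 0 ≤ ∑ s ∈ Finset.range (p + 1), E s ω / chainPos U s ω :=
    Finset.sum_nonneg fun s _ => (div_pos (h.pos s) (h.chainPos_pos s)).le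
  rw [setLIntegral_congr_fun (g := fun _ => ENNReal.ofReal (((k.factorial : ℝ) *
      ∑ s ∈ Finset.range (p + 1), E s ω / chainPos U s ω) ^ (1 / (k : ℝ)))) measurableSet_Ico,
    setLIntegral_const, Real.volume_Ico, h.limitB_eq k,
    mul_comm (chainPos U p ω - _), ENNReal.ofReal_mul (by positivity)]
  intro x hx
  simp only
  rw [h.chainMin_eq hx.1, h.chainSum_eq hx, rootFun_ofReal k hnn]

variable [MeasurableSpace Ω] {Q : Measure Ω}

/-- The means are geometric, so the positions are almost surely summable; this is how they are shown
to tend to `0`. -/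
lemma IsChain.lintegral_chainPos (h : IsChain U E Q) [IsProbabilityMeasure Q] (s : ℕ) :
    ∫⁻ ω, ENNReal.ofReal (chainPos U s ω) ∂Q = (2⁻¹ : ℝ≥0∞) ^ s := by
  induction s with
  | zero => simp [chainPos]
  | succ s ih =>
    have hi : IndepFun (chainPos U s) (U s) Q := by
      refine indepFun_of_disjoint (f := U) ?_ h.measurable_U (S := Iio s) (T := {s}) (by simp)
        (measurable_chainPos fun j hj => measurable_iSup_comap U hj)
        (measurable_iSup_comap U rfl)
      exact h.indep.precomp (g := Sum.inl) Sum.inl_injective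
    have hpos : ∀ᵐ ω ∂Q, 0 ≤ chainPos U s ω := by
      filter_upwards [h.ae_mem_Ioo] with ω hω
      exact Finset.prod_nonneg fun j _ => (hω j).1.le
    have hhalf : ∫⁻ u in Icc (0 : ℝ) 1, ENNReal.ofReal u = 2⁻¹ := by
      rw [← ofReal_integral_eq_lintegral_ofReal, integral_Icc_eq_integral_Ioc,
        ← intervalIntegral.integral_of_le zero_le_one, integral_id]
      · rw [show ((1 : ℝ) ^ 2 - 0 ^ 2) / 2 = 2⁻¹ by norm_num,
          ENNReal.ofReal_inv_of_pos two_pos, ENNReal.ofReal_ofNat]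
      · exact continuous_id.integrableOn_Icc
      · exact (ae_restrict_iff' measurableSet_Icc).2 (ae_of_all _ fun x hx => hx.1)
    have e := lintegral_indepFun hi (measurable_chainPos fun j _ => h.measurable_U j)
      (h.law_U s) (g := fun q => ENNReal.ofReal q.1 * ENNReal.ofReal q.2) (by fun_prop)
    simp only at e
    calc ∫⁻ ω, ENNReal.ofReal (chainPos U (s + 1) ω) ∂Q
        = ∫⁻ ω, ENNReal.ofReal (chainPos U s ω) * ENNReal.ofReal (U s ω) ∂Q := by
          refine lintegral_congr_ae ?_
          filter_upwards [hpos] with ω hω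
          rw [chainPos_succ, mul_comm, ENNReal.ofReal_mul hω]
      _ = _ := by
          rw [e]
          simp_rw [lintegral_const_mul' _ _ ENNReal.ofReal_ne_top, hhalf]
          rw [lintegral_mul_const' _ _ (by simp), ih, pow_succ]

lemma IsChain.ae_isGood (h : IsChain U E Q) [IsProbabilityMeasure Q] :
    ∀ᵐ ω ∂Q, IsGood U E ω := by
  have hm : ∀ s, Measurable fun ω => ENNReal.ofReal (chainPos U s ω) := fun s =>
    (measurable_chainPos fun j _ => h.measurable_U j).ennreal_ofReal
  have hs : ∫⁻ ω, ∑' s, ENNReal.ofReal (chainPos U s ω) ∂Q ≠ ∞ := by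
    rw [lintegral_tsum fun s => (hm s).aemeasurable]
    simp_rw [h.lintegral_chainPos]
    rw [ENNReal.tsum_geometric]
    simp
  filter_upwards [h.ae_mem_Ioo, h.ae_pos, ae_lt_top' (Measurable.tsum hm).aemeasurable hs]
    with ω h1 h2 h3
  refine ⟨h1, h2, ?_⟩
  have h4 := (ENNReal.tendsto_toReal ENNReal.zero_ne_top).comp
    (ENNReal.tendsto_atTop_zero_of_tsum_ne_top h3.ne)
  simp only [ENNReal.toReal_zero] at h4
  refine h4.congr fun s => ?_
  exact ENNReal.toReal_ofReal (Finset.prod_nonneg fun j _ => (h1 j).1.le)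

/-- The minima on `[0, x]` at finitely many points `x` have the law of running minima of
independent exponential variables. -/
lemma IsChain.lintegral_chainMin (h : IsChain U E Q) [IsProbabilityMeasure Q] {d : ℕ → ℝ}
    (hd : ∀ i, 0 < d i) {n : ℕ} (hn : ∀ i < n, point d i < 1) {A : Set (ℕ → ℝ≥0∞)}
    (hA : MeasurableSet A) :
    Q.map (fun ω i => if i < n then chainMin U E (point d i) ω else 0) A
      = (minMeasure d n).map (fun v i => ENNReal.ofReal (cutoff n v i)) A := by
  have := isProbabilityMeasure_minMeasure hd n
  have hr : Measurable fun (v : ℕ → ℝ) i => ENNReal.ofReal (v i) :=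
    measurable_pi_iff.2 fun i => by fun_prop
  have hHm : Measurable fun ω i => if i < n then chainMin U E (point d i) ω else 0 := by
    refine measurable_pi_iff.2 fun i => ?_
    split_ifs
    · exact measurable_chainMin h.measurable_U h.measurable_E _
    · exact measurable_const
  let Φ : (ℕ → ℝ) → ℝ≥0∞ := fun v => A.indicator 1 fun i => ENNReal.ofReal (v i)
  have hΦ : Measurable Φ := (measurable_one.indicator hA).comp hr
  have hjm : ∀ N, Measurable fun ω => ∫⁻ v, Φ (chainJoin U E d n N ω v) ∂minMeasure d n := by
    intro N
    refine Measurable.lintegral_prod_right' (f := fun q : Ω × (ℕ → ℝ) =>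
      Φ (chainJoin U E d n N q.1 q.2)) (hΦ.comp (measurable_pi_iff.2 fun i => ?_))
    simp only [chainJoin]
    have h1 : Measurable (chainPos U N) := measurable_chainPos fun j _ => h.measurable_U j
    have h2 : ∀ x, Measurable (chainSum U E x N) := fun x =>
      measurable_chainSum x (fun j _ => h.measurable_U j) fun j _ => h.measurable_E j
    split_ifs
    · exact ((h2 _).comp measurable_fst).add (Measurable.ite
        (measurableSet_lt measurable_const (h1.comp measurable_fst)) (by fun_prop)
        measurable_const)
    · exact measurable_const
  -- Once `chainPos U N ω` is at most the first point, the joined sequence no longer depends on `v`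
  -- and equals `chainMin` at the points. This eventual equality replaces continuity, which the
  -- indicator of `A` lacks.
  have lim : Tendsto (fun N => ∫⁻ ω, ∫⁻ v, Φ (chainJoin U E d n N ω v) ∂minMeasure d n ∂Q) atTop
      (𝓝 (∫⁻ ω, A.indicator 1 (fun i => if i < n then chainMin U E (point d i) ω else 0) ∂Q)) := by
    refine tendsto_lintegral_of_dominated_convergence (fun _ => 1) hjm ?_ (by simp) ?_
    · intro N
      refine ae_of_all _ fun ω => ?_
      calc ∫⁻ v, Φ (chainJoin U E d n N ω v) ∂minMeasure d n ≤ ∫⁻ v, 1 ∂minMeasure d n :=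
            lintegral_mono fun v => indicator_le_self' (by simp) _
        _ = 1 := by simp
    · filter_upwards [h.ae_isGood] with ω hω
      refine tendsto_const_nhds.congr' ?_
      have hev : ∀ᶠ N in atTop, chainPos U N ω ≤ point d 0 :=
        (hω.tendsto.eventually (gt_mem_nhds (point_pos hd 0))).mono fun N hN => hN.le
      filter_upwards [hev] with N hN
      have hi : ∀ i, chainPos U N ω ≤ point d i := fun i =>
        hN.trans ((point_strictMono hd).monotone (Nat.zero_le i))
      have : ∀ v, Φ (chainJoin U E d n N ω v)
          = A.indicator 1 (fun i => if i < n then chainMin U E (point d i) ω else 0) := by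
        intro v
        simp only [Φ]
        congr 1
        ext i
        simp only [chainJoin, (hi i).not_gt, if_false, add_zero, hω.chainMin_eq (hi i)]
        split_ifs <;> simp
      simp [this]
  simp_rw [lintegral_chainJoin h hd hn _ hΦ] at lim
  have hlim := tendsto_nhds_unique lim tendsto_const_nhds
  have hrc : Measurable fun v i => ENNReal.ofReal (cutoff n v i) := hr.comp (measurable_cutoff n)
  rw [Measure.map_apply hHm hA, Measure.map_apply hrc hA,
    ← lintegral_indicator_one (hHm hA), ← lintegral_indicator_one (hrc hA)]
  exact hlim

lemma IsChain.map_chainMin (h : IsChain U E Q) [IsProbabilityMeasure Q] {d : ℕ → ℝ}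
    (hd : ∀ i, 0 < d i) {n : ℕ} (hn : ∀ i < n, point d i < 1) :
    Q.map (fun ω i => if i < n then chainMin U E (point d i) ω else 0)
      = (minMeasure d n).map (fun v i => ENNReal.ofReal (cutoff n v i)) :=
  Measure.ext fun _ hA => h.lintegral_chainMin hd hn hA

lemma IsChain.lintegral_comp_chainMin (h : IsChain U E Q) [IsProbabilityMeasure Q] {x : ℝ}
    (hx : x ∈ Ioo (0 : ℝ) 1) {g : ℝ≥0∞ → ℝ≥0∞} (hg : Measurable g) :
    ∫⁻ ω, g (chainMin U E x ω) ∂Q = ∫⁻ z, g (ENNReal.ofReal z) ∂expMeasure x := by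
  have hd : ∀ i : ℕ, 0 < (fun _ : ℕ => x) i := fun _ => hx.1
  have := isProbabilityMeasure_expMeasure hx.1
  have hp : point (fun _ => x) 0 = x := by simp [point]
  have key := h.map_chainMin hd (n := 1) (by intro i hi; obtain rfl : i = 0 := by lia
                                             rw [hp]; exact hx.2)
  have e := congrArg (fun μ => ∫⁻ v, g (v 0) ∂μ) key
  rw [lintegral_map (by fun_prop), lintegral_map (by fun_prop) (by
      refine measurable_pi_iff.2 fun i => ?_
      exact ((measurable_pi_apply i).comp (measurable_cutoff 1)).ennreal_ofReal)] at e
  · simp only [zero_lt_one, if_true, hp, cutoff] at e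
    rw [e, lintegral_minMeasure_succ hd 0 (by fun_prop), minMeasure, lintegral_dirac']
    · simp [minStep]
    · exact Measurable.lintegral_prod_right' (f := fun p => g (ENNReal.ofReal (minStep 0 p 0)))
        (hg.comp ((measurable_pi_apply 0).comp (measurable_minStep 0)).ennreal_ofReal)
  · refine measurable_pi_iff.2 fun i => ?_
    split_ifs
    · exact measurable_chainMin h.measurable_U h.measurable_E _
    · exact measurable_const

/-- With the two intervals of lengths `x` and `y - x`, the minima at `x` and `y` are `Z` and `min Z
W` for independent exponentials of these rates. -/
lemma IsChain.lintegral_comp_chainMin₂ (h : IsChain U E Q) [IsProbabilityMeasure Q] {x y : ℝ}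
    (hx : 0 < x) (hxy : x < y) (hy : y < 1) {g : ℝ≥0∞ × ℝ≥0∞ → ℝ≥0∞} (hg : Measurable g) :
    ∫⁻ ω, g (chainMin U E x ω, chainMin U E y ω) ∂Q
      = ∫⁻ z, ∫⁻ w, g (ENNReal.ofReal z, ENNReal.ofReal (min z w))
          ∂expMeasure (y - x) ∂expMeasure x := by
  let d : ℕ → ℝ := fun i => if i = 0 then x else y - x
  have hd : ∀ i : ℕ, 0 < d i := fun i => by
    simp only [d]; split_ifs <;> linarith
  have := isProbabilityMeasure_expMeasure (hd 0)
  have := isProbabilityMeasure_expMeasure (hd 1)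
  have hp0 : point d 0 = x := by simp [point, d]
  have hp1 : point d 1 = y := by simp [point, d, Finset.sum_range_succ]
  have key := h.map_chainMin hd (n := 2) (by
    intro i hi
    interval_cases i
    · rw [hp0]; linarith
    · rw [hp1]; exact hy)
  have e := congrArg (fun μ => ∫⁻ v, g (v 0, v 1) ∂μ) key
  rw [lintegral_map (by fun_prop), lintegral_map (by fun_prop) (by
      refine measurable_pi_iff.2 fun i => ?_
      exact ((measurable_pi_apply i).comp (measurable_cutoff 2)).ennreal_ofReal)] at e
  · simp only [show 0 < 2 by norm_num, show 1 < 2 by norm_num, if_true, hp0, hp1, cutoff] at e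
    rw [e, lintegral_minMeasure_succ hd 1 (by fun_prop), lintegral_minMeasure_succ hd 0, minMeasure,
      lintegral_dirac']
    · simp [minStep, d]
    · refine Measurable.lintegral_prod_right' (f := fun p => ∫⁻ z, g (ENNReal.ofReal
        (minStep 1 (minStep 0 p, z) 0), ENNReal.ofReal (minStep 1 (minStep 0 p, z) 1))
        ∂expMeasure (d 1)) ?_
      refine Measurable.lintegral_prod_right' (f := fun q : ((ℕ → ℝ) × ℝ) × ℝ =>
        g (ENNReal.ofReal (minStep 1 (minStep 0 q.1, q.2) 0),
          ENNReal.ofReal (minStep 1 (minStep 0 q.1, q.2) 1))) ?_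
      have hm : Measurable fun q : ((ℕ → ℝ) × ℝ) × ℝ => minStep 1 (minStep 0 q.1, q.2) := by
        fun_prop
      exact hg.comp (((measurable_pi_apply 0).comp hm).ennreal_ofReal.prodMk
        ((measurable_pi_apply 1).comp hm).ennreal_ofReal)
    · refine Measurable.lintegral_prod_right' (f := fun q : (ℕ → ℝ) × ℝ =>
        g (ENNReal.ofReal (minStep 1 q 0), ENNReal.ofReal (minStep 1 q 1))) ?_
      exact hg.comp (((measurable_pi_apply 0).comp (measurable_minStep 1)).ennreal_ofReal.prodMk
        ((measurable_pi_apply 1).comp (measurable_minStep 1)).ennreal_ofReal)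
  · refine measurable_pi_iff.2 fun i => ?_
    split_ifs
    · exact measurable_chainMin h.measurable_U h.measurable_E _
    · exact measurable_const

end Chain

/-! ### Riemann sums of antitone functions -/

section Riemann

open Set
open scoped ENNReal

lemma riemannSum_le {f : ℝ → ℝ≥0∞} (hf : AntitoneOn f (Ioc 0 1)) (n : ℕ) :
    ∑ i ∈ Finset.range n, ENNReal.ofReal (1 / n) * f ((i + 1 : ℕ) / n) ≤ ∫⁻ x in Ioo 0 1, f x := by
  rcases Nat.eq_zero_or_pos n with rfl | hn
  · simp
  have hn' : (0 : ℝ) < n := by exact_mod_cast hn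
  let S : ℕ → Set ℝ := fun i => Ioc ((i : ℝ) / n) ((i + 1 : ℕ) / n)
  have hdisj : Set.PairwiseDisjoint (↑(Finset.range n)) S := by
    intro i _ j _ hij
    have hm : Monotone fun i : ℕ => (i : ℝ) / n := fun a b hab => by
      simp only; gcongr
    exact hm.pairwise_disjoint_on_Ioc_succ hij
  have hle1 : ∀ i < n, ((i + 1 : ℕ) : ℝ) / n ≤ 1 := fun i hi => by
    rw [div_le_one hn']; exact_mod_cast hi
  have hsub : (⋃ i ∈ Finset.range n, S i) ⊆ Ioc 0 1 := by
    intro x hx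
    simp only [mem_iUnion, Finset.mem_range] at hx
    obtain ⟨i, hi, hx⟩ := hx
    exact ⟨lt_of_le_of_lt (by positivity) hx.1, hx.2.trans (hle1 i hi)⟩
  calc ∑ i ∈ Finset.range n, ENNReal.ofReal (1 / n) * f ((i + 1 : ℕ) / n)
      ≤ ∑ i ∈ Finset.range n, ∫⁻ x in S i, f x := by
        refine Finset.sum_le_sum fun i hi => ?_
        have hvol : volume (S i) = ENNReal.ofReal (1 / n) := by
          rw [Real.volume_Ioc]
          congr 1
          push_cast
          ring
        rw [mul_comm, ← hvol, ← setLIntegral_const]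
        refine setLIntegral_mono' measurableSet_Ioc fun x hx => hf ?_ ?_ hx.2
        · exact ⟨lt_of_le_of_lt (by positivity) hx.1, hx.2.trans (hle1 i (Finset.mem_range.1 hi))⟩
        · exact ⟨by positivity, hle1 i (Finset.mem_range.1 hi)⟩
    _ = ∫⁻ x in ⋃ i ∈ Finset.range n, S i, f x :=
        (lintegral_biUnion_finset hdisj (fun i _ => measurableSet_Ioc) f).symm
    _ ≤ ∫⁻ x in Ioc 0 1, f x := lintegral_mono_set hsub
    _ = _ := setLIntegral_congr Ioo_ae_eq_Ioc.symm

/-- The `n - 1` values are taken at left endpoints of the intervals that cover `(1/n, 1)`; the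
interval next to `0` is left out, since `f` may blow up there. -/
lemma le_riemannSum {f : ℝ → ℝ≥0∞} (hf : AntitoneOn f (Ioc 0 1)) {n : ℕ} (hn : 0 < n) :
    ∫⁻ x in Ioo ((1 : ℝ) / n) 1, f x
      ≤ ∑ i ∈ Finset.range (n - 1), ENNReal.ofReal (1 / n) * f ((i + 1 : ℕ) / n) := by
  have hn' : (0 : ℝ) < n := by exact_mod_cast hn
  let S : ℕ → Set ℝ := fun i => Ioc (((i + 1 : ℕ) : ℝ) / n) ((i + 2 : ℕ) / n)
  have hsub : Ioo ((1 : ℝ) / n) 1 ⊆ ⋃ i ∈ Finset.range (n - 1), S i := by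
    intro x hx
    simp only [mem_iUnion, Finset.mem_range]
    have h1 : 1 < n * x := by have := (div_lt_iff₀' hn').1 hx.1; linarith
    have h2 : n * x < n := by nlinarith [hx.2]
    have hc1 : 1 < ⌈n * x⌉₊ := Nat.lt_ceil.2 (by simpa using h1)
    have hc2 : ⌈n * x⌉₊ ≤ n := Nat.ceil_le.2 h2.le
    have hceil := Nat.ceil_lt_add_one (show 0 ≤ n * x by linarith)
    have hceil2 := Nat.le_ceil ((n : ℝ) * x)
    refine ⟨⌈n * x⌉₊ - 2, by lia, ?_, ?_⟩
    · rw [div_lt_iff₀ hn', show ⌈n * x⌉₊ - 2 + 1 = ⌈n * x⌉₊ - 1 by lia, Nat.cast_sub hc1.le]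
      push_cast; linarith
    · rw [le_div_iff₀ hn', show ⌈n * x⌉₊ - 2 + 2 = ⌈n * x⌉₊ by lia]
      linarith
  calc ∫⁻ x in Ioo ((1 : ℝ) / n) 1, f x ≤ ∫⁻ x in ⋃ i ∈ Finset.range (n - 1), S i, f x :=
        lintegral_mono_set hsub
    _ ≤ ∑ i ∈ Finset.range (n - 1), ∫⁻ x in S i, f x := by
        have := lintegral_iUnion_le (μ := volume)
          (fun i : Finset.range (n - 1) => S i) f
        rw [tsum_fintype, Finset.univ_eq_attach,
          Finset.sum_attach _ (fun i => ∫⁻ x in S i, f x)] at this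
        refine le_trans (lintegral_mono_set ?_) this
        simp only [iUnion_subset_iff]
        intro i hi
        exact subset_iUnion (fun i : Finset.range (n - 1) => S i) ⟨i, hi⟩
    _ ≤ _ := by
        refine Finset.sum_le_sum fun i hi => ?_
        have hi' : i + 2 ≤ n := by have := Finset.mem_range.1 hi; lia
        have hvol : volume (S i) = ENNReal.ofReal (1 / n) := by
          rw [Real.volume_Ioc]
          congr 1
          push_cast
          ring
        rw [mul_comm, ← hvol, ← setLIntegral_const]
        have h2 : (((i + 2 : ℕ) : ℝ)) / n ≤ 1 := by
          rw [div_le_one hn']; exact_mod_cast hi'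
        refine setLIntegral_mono' measurableSet_Ioc fun x hx => hf ?_ ?_ hx.1.le
        · refine ⟨by positivity, hx.1.le.trans (hx.2.trans h2)⟩
        · exact ⟨lt_trans (by positivity) hx.1, hx.2.trans h2⟩

lemma tendsto_setLIntegral_Ioo (f : ℝ → ℝ≥0∞) :
    Tendsto (fun n : ℕ => ∫⁻ x in Ioo ((1 : ℝ) / n) 1, f x) atTop
      (𝓝 (∫⁻ x in Ioo 0 1, f x)) := by
  have hun : ⋃ n : ℕ, Ioo (1 / ((n : ℝ) + 1)) 1 = Ioo 0 1 := by
    ext x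
    simp only [mem_iUnion, mem_Ioo]
    constructor
    · rintro ⟨n, h1, h2⟩
      exact ⟨lt_trans (by positivity) h1, h2⟩
    · rintro ⟨h1, h2⟩
      obtain ⟨n, hn⟩ := exists_nat_one_div_lt h1
      exact ⟨n, hn, h2⟩
  have hmono : Monotone fun n : ℕ => Ioo (1 / ((n : ℝ) + 1)) 1 := by
    intro a b hab
    refine Ioo_subset_Ioo_left ?_
    exact one_div_le_one_div_of_le (by positivity) (by gcongr)
  have h : Tendsto (fun n : ℕ => ∫⁻ x in Ioo (1 / ((n : ℝ) + 1)) 1, f x) atTop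
      (𝓝 (⨆ n : ℕ, ∫⁻ x in Ioo (1 / ((n : ℝ) + 1)) 1, f x)) :=
    tendsto_atTop_iSup fun a b hab => lintegral_mono_set (hmono hab)
  rw [← setLIntegral_iUnion_of_directed f (directed_of_isDirected_le hmono), hun] at h
  rw [← tendsto_add_atTop_iff_nat 1]
  simpa using h

/-- Monotonicity squeezes the sums, even for unbounded `f`. The value at `1` is omitted because the
chain is compared with running minima only at points below `1`. -/
lemma tendsto_riemannSum {f : ℝ → ℝ≥0∞} (hf : AntitoneOn f (Ioc 0 1)) :
    Tendsto (fun n : ℕ => ∑ i ∈ Finset.range (n - 1), ENNReal.ofReal (1 / n) * f ((i + 1 : ℕ) / n))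
      atTop (𝓝 (∫⁻ x in Ioo 0 1, f x)) := by
  refine tendsto_of_tendsto_of_tendsto_of_le_of_le' (tendsto_setLIntegral_Ioo f)
    tendsto_const_nhds ?_ ?_
  · filter_upwards [eventually_gt_atTop 0] with n hn
    exact le_riemannSum hf hn
  · refine Eventually.of_forall fun n => le_trans ?_ (riemannSum_le hf n)
    exact Finset.sum_le_sum_of_subset (Finset.range_subset_range.2 (Nat.sub_le n 1))

/-- The product is at most the integral over `(0, 1/n]`, which vanishes in the limit. For antitone
`f` it is the largest term of the Riemann sum and later serves as the bound `δ` on single terms. -/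
lemma tendsto_mesh_mul {f : ℝ → ℝ≥0∞} (hf : AntitoneOn f (Ioc 0 1))
    (hfin : ∫⁻ x in Ioo 0 1, f x ≠ ∞) :
    Tendsto (fun n : ℕ => ENNReal.ofReal (1 / n) * f (1 / n)) atTop (𝓝 0) := by
  have h1 := ENNReal.Tendsto.sub tendsto_const_nhds (tendsto_setLIntegral_Ioo f)
    (a := ∫⁻ x in Ioo 0 1, f x) (Or.inl hfin)
  rw [tsub_self] at h1
  refine tendsto_of_tendsto_of_tendsto_of_le_of_le' tendsto_const_nhds h1
    (Eventually.of_forall fun _ => zero_le) ?_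
  filter_upwards [eventually_gt_atTop 1] with n hn
  have hn' : (1 : ℝ) < n := by exact_mod_cast hn
  have hsplit : ∫⁻ x in Ioo 0 1, f x
      = (∫⁻ x in Ioc 0 ((1 : ℝ) / n), f x) + ∫⁻ x in Ioo ((1 : ℝ) / n) 1, f x := by
    rw [← lintegral_union measurableSet_Ioo, Ioc_union_Ioo_eq_Ioo (by positivity)]
    · rw [div_lt_one (by linarith)]; exact hn'
    · rw [Set.disjoint_left]
      intro x h1 h2
      exact absurd h1.2 (not_le.2 h2.1)
  refine ENNReal.le_sub_of_add_le_right ?_ ?_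
  · exact ne_top_of_le_ne_top hfin (hsplit ▸ le_add_self)
  · rw [hsplit]
    gcongr
    have hvol : volume (Ioc 0 ((1 : ℝ) / n)) = ENNReal.ofReal (1 / n) := by
      rw [Real.volume_Ioc, sub_zero]
    rw [mul_comm, ← hvol, ← setLIntegral_const]
    refine setLIntegral_mono' measurableSet_Ioc fun x hx => hf ?_ ?_ hx.2
    · exact ⟨hx.1, hx.2.trans (by rw [div_le_one (by linarith)]; exact hn'.le)⟩
    · exact ⟨by positivity, by rw [div_le_one (by linarith)]; exact hn'.le⟩

end Riemann

/-! ### Ordered sums -/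

section OrderedSums

open scoped ENNReal

/-- The sum over all `s ≤ v₁`, `v₁ < v₂ < ⋯ < v_p < n` of `b s v₁ * b (v₁ + 1) v₂ ⋯`. -/
def gapSum {R : Type*} [CommSemiring R] (b : ℕ → ℕ → R) (n : ℕ) : ℕ → ℕ → R
  | 0, _ => 1
  | p + 1, s => ∑ v ∈ Finset.Ico s n, b s v * gapSum b n p (v + 1)

lemma ofReal_gapSum {a : ℕ → ℕ → ℝ} (ha : ∀ s v, 0 ≤ a s v) (n p s : ℕ) :
    0 ≤ gapSum a n p s ∧
      ENNReal.ofReal (gapSum a n p s) = gapSum (fun s v => ENNReal.ofReal (a s v)) n p s := by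
  induction p generalizing s with
  | zero => simp [gapSum]
  | succ p ih =>
    have hnn : ∀ v, 0 ≤ a s v * gapSum a n p (v + 1) := fun v => mul_nonneg (ha s v) (ih _).1
    refine ⟨Finset.sum_nonneg fun v _ => hnn v, ?_⟩
    simp only [gapSum]
    rw [ENNReal.ofReal_sum_of_nonneg fun v _ => hnn v]
    refine Finset.sum_congr rfl fun v _ => ?_
    rw [ENNReal.ofReal_mul (ha s v), (ih _).2]

lemma gapSum_mono {b b' : ℕ → ℕ → ℝ≥0∞} (h : ∀ s v, s ≤ v → b s v ≤ b' s v) (n p s : ℕ) :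
    gapSum b n p s ≤ gapSum b' n p s := by
  induction p generalizing s with
  | zero => exact le_rfl
  | succ p ih =>
    exact Finset.sum_le_sum fun v hv =>
      mul_le_mul' (h s v (Finset.mem_Ico.1 hv).1) (ih _)

lemma pow_succ_sub_pow_succ_le {x y : ℝ} (hx : 0 ≤ x) (hxy : x ≤ y) (p : ℕ) :
    y ^ (p + 1) - x ^ (p + 1) ≤ (p + 1) * (y - x) * y ^ p := by
  induction p with
  | zero => simp
  | succ p ih =>
    have h1 : x ^ (p + 1) ≤ y ^ (p + 1) := pow_le_pow_left₀ hx hxy _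
    have h2 := mul_le_mul_of_nonneg_left ih (hx.trans hxy)
    have h3 := mul_le_mul_of_nonneg_right h1 (sub_nonneg.2 hxy)
    push_cast
    calc y ^ (p + 1 + 1) - x ^ (p + 1 + 1)
        = y * (y ^ (p + 1) - x ^ (p + 1)) + x ^ (p + 1) * (y - x) := by ring
      _ ≤ y * ((p + 1) * (y - x) * y ^ p) + y ^ (p + 1) * (y - x) := add_le_add h2 h3
      _ = _ := by ring

/-- A `p`-th power of a sum is `p!` times the sum over increasing indices plus terms with repeated
indices. Subtracting `p * δ` from the base pays for the repetitions. The proof differentiates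
discretely in `s`: the `(p + 1)`-st power increases by at most `(p + 1) * a s` times a `p`-th power.
As `a s ≤ δ`, dropping the term `a s` is paid for by one of the `p + 1` copies of `δ`, which brings
that `p`-th power under the bound for `p`. -/
lemma pow_le_factorial_mul_gapSum {a : ℕ → ℝ} {δ : ℝ} (h0 : ∀ v, 0 ≤ a v) {n : ℕ}
    (hδ : ∀ v < n, a v ≤ δ) (hδ0 : 0 ≤ δ) (p s : ℕ) :
    (max (∑ v ∈ Finset.Ico s n, a v - p * δ) 0) ^ p
      ≤ p.factorial * gapSum (fun _ v => a v) n p s := by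
  induction p generalizing s with
  | zero => simp [gapSum]
  | succ p ih =>
    let f : ℕ → ℝ := fun s => max (∑ v ∈ Finset.Ico s n, a v - (p + 1 : ℕ) * δ) 0
    have hend : ∀ s, n ≤ s → f s = 0 := by
      intro s hs
      simp only [f, Finset.Ico_eq_empty_of_le hs, Finset.sum_empty, zero_sub]
      exact max_eq_right (by have : 0 ≤ ((p + 1 : ℕ) : ℝ) * δ := by positivity
                             linarith)
    change f s ^ (p + 1) ≤ _
    rcases le_or_gt n s with hs | hs
    · rw [hend s hs]
      simp [gapSum, Finset.Ico_eq_empty_of_le hs]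
    · induction hs.le using Nat.decreasingInduction with
      | self =>
        rw [hend n le_rfl]
        simp [gapSum]
      | of_succ s hsn ihs =>
        have ihs' : f (s + 1) ^ (p + 1)
            ≤ (p + 1).factorial * gapSum (fun _ v => a v) n (p + 1) (s + 1) := by
          rcases Nat.lt_or_ge (s + 1) n with h | h
          · exact ihs h
          · rw [hend _ h]
            simp [gapSum, Finset.Ico_eq_empty_of_le h]
        have hsum : ∑ v ∈ Finset.Ico s n, a v = a s + ∑ v ∈ Finset.Ico (s + 1) n, a v :=
          Finset.sum_eq_sum_Ico_succ_bot hsn _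
        have hmono : f (s + 1) ≤ f s := by
          simp only [f, hsum]
          exact max_le_max (by linarith [h0 s]) le_rfl
        have hdiff : f s - f (s + 1) ≤ a s := by
          simp only [f, hsum]
          rcases max_cases (∑ v ∈ Finset.Ico (s + 1) n, a v - (p + 1 : ℕ) * δ) 0 with h | h <;>
          rcases max_cases (a s + ∑ v ∈ Finset.Ico (s + 1) n, a v - (p + 1 : ℕ) * δ) 0 with h' | h' <;>
          linarith [h0 s]
        have hle : f s ≤ max (∑ v ∈ Finset.Ico (s + 1) n, a v - p * δ) 0 := by
          simp only [f, hsum]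
          refine max_le_max ?_ le_rfl
          push_cast
          linarith [hδ s hsn]
        have hf0 : 0 ≤ f s := le_max_right _ _
        have hg : gapSum (fun _ v => a v) n (p + 1) s
            = a s * gapSum (fun _ v => a v) n p (s + 1)
              + gapSum (fun _ v => a v) n (p + 1) (s + 1) := by
          simp only [gapSum]
          exact Finset.sum_eq_sum_Ico_succ_bot hsn _
        have h1 := pow_succ_sub_pow_succ_le (le_max_right _ _ : 0 ≤ f (s + 1)) hmono p
        have h2 : f s ^ p ≤ p.factorial * gapSum (fun _ v => a v) n p (s + 1) :=
          (pow_le_pow_left₀ hf0 hle p).trans (ih (s + 1))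
        have h3 : (p + 1) * (f s - f (s + 1)) * f s ^ p
            ≤ (p + 1) * a s * (p.factorial * gapSum (fun _ v => a v) n p (s + 1)) := by
          refine mul_le_mul ?_ h2 (pow_nonneg hf0 _) (by have := h0 s; positivity)
          exact mul_le_mul_of_nonneg_left hdiff (by positivity)
        rw [hg, Nat.factorial_succ]
        rw [Nat.factorial_succ] at ihs'
        push_cast at ihs' ⊢
        linarith

/-- The iterated convolution sums of `e`. -/
def convSum (e : ℕ → ℝ) : ℕ → ℕ → ℝ
  | 0, _ => 1
  | p + 1, m => ∑ w ∈ Finset.range m, e w * convSum e p (m - 1 - w)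

lemma convSum_nonneg {e : ℕ → ℝ} (he : ∀ w, 0 ≤ e w) (p m : ℕ) : 0 ≤ convSum e p m := by
  induction p generalizing m with
  | zero => exact zero_le_one
  | succ p ih => exact Finset.sum_nonneg fun w _ => mul_nonneg (he w) (ih _)

/-- The factor `b s v` sees only nodes in `[s, v]`, and the rest of the product only nodes after
`v`. Expectations therefore factor, and the recursion of `gapSum` becomes that of `convSum`. -/
lemma lintegral_gapSum_le {Ω ι : Type*} [MeasurableSpace Ω] {P : Measure Ω}
    [IsProbabilityMeasure P] {f : ι → Ω → ℝ} (hind : iIndepFun f P) (hf : ∀ i, Measurable (f i))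
    (node : ι → ℕ) {b : ℕ → ℕ → Ω → ℝ≥0∞}
    (hb : ∀ s v, s ≤ v → Measurable[⨆ i ∈ {i | node i ∈ Set.Icc s v},
      MeasurableSpace.comap (f i) inferInstance] (b s v))
    {e : ℕ → ℝ} (he : ∀ w, 0 ≤ e w)
    (hbe : ∀ s v, s ≤ v → ∫⁻ ω, b s v ω ∂P ≤ ENNReal.ofReal (e (v - s))) (n p s : ℕ) :
    ∫⁻ ω, gapSum (fun s v => b s v ω) n p s ∂P ≤ ENNReal.ofReal (convSum e p (n - s)) := by
  have hmono : ∀ {S T : Set ι}, S ⊆ T → (⨆ i ∈ S, MeasurableSpace.comap (f i) inferInstance)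
      ≤ ⨆ i ∈ T, MeasurableSpace.comap (f i) inferInstance := fun h => biSup_mono h
  have hle : ∀ S : Set ι, (⨆ i ∈ S, MeasurableSpace.comap (f i) inferInstance)
      ≤ (inferInstance : MeasurableSpace Ω) := fun S => iSup₂_le fun i _ => (hf i).comap_le
  have hg : ∀ p s, Measurable[⨆ i ∈ {i | s ≤ node i},
      MeasurableSpace.comap (f i) inferInstance] fun ω => gapSum (fun s v => b s v ω) n p s := by
    intro p
    induction p with
    | zero => intro s; exact measurable_const
    | succ p ih =>
      intro s
      refine Finset.measurable_fun_sum _ fun v hv => ?_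
      have hsv := (Finset.mem_Ico.1 hv).1
      refine Measurable.mul ?_ ?_
      · exact (hb s v hsv).mono (hmono fun i hi => hi.1) le_rfl
      · exact (ih (v + 1)).mono (hmono fun i (hi : v + 1 ≤ node i) => by
          change s ≤ node i; lia) le_rfl
  induction p generalizing s with
  | zero => simp [gapSum, convSum]
  | succ p ih =>
    have hm1 : ∀ v ∈ Finset.Ico s n, Measurable (b s v) := fun v hv =>
      (hb s v (Finset.mem_Ico.1 hv).1).mono (hle _) le_rfl
    have hm2 : ∀ v, Measurable fun ω => gapSum (fun s v => b s v ω) n p v := fun v =>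
      (hg p v).mono (hle _) le_rfl
    simp only [gapSum]
    rw [lintegral_finsetSum (f := fun v ω => b s v ω * gapSum (fun s v => b s v ω) n p (v + 1)) _
        fun v hv => (hm1 v hv).mul (hm2 _), convSum,
      ENNReal.ofReal_sum_of_nonneg fun w _ => mul_nonneg (he w) (convSum_nonneg he _ _),
      Finset.sum_Ico_eq_sum_range]
    refine Finset.sum_le_sum fun w hw => ?_
    have hw' := Finset.mem_range.1 hw
    have hi : IndepFun (b s (s + w)) (fun ω => gapSum (fun s v => b s v ω) n p (s + w + 1)) P := by
      refine indepFun_of_disjoint hind hf ?_ (hb s (s + w) (by lia)) (hg p (s + w + 1))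
      rw [Set.disjoint_left]
      rintro i h1 h2
      have h1' := h1.2
      have h2' : s + w + 1 ≤ node i := h2
      lia
    have := lintegral_mul_eq_lintegral_mul_lintegral_of_indepFun (hm1 _ (by simp; lia)) (hm2 _) hi
    simp only [Pi.mul_apply] at this
    rw [this, ENNReal.ofReal_mul (he w)]
    refine mul_le_mul' ?_ ?_
    · simpa using hbe s (s + w) (by lia)
    · have := ih (s + w + 1)
      rwa [show n - (s + w + 1) = n - s - 1 - w by lia] at this

lemma lintegral_beta {a b : ℝ} (ha : 0 < a) (hb : 0 < b) :
    ∫⁻ x in Set.Ioo (0 : ℝ) 1, ENNReal.ofReal (x ^ (a - 1) * (1 - x) ^ (b - 1))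
      = ENNReal.ofReal (beta a b) := by
  have h1 := lintegral_betaPDF_eq_one ha hb
  have h2 : ∫⁻ x, betaPDF a b x = ENNReal.ofReal (1 / beta a b) *
      ∫⁻ x in Set.Ioo (0 : ℝ) 1, ENNReal.ofReal (x ^ (a - 1) * (1 - x) ^ (b - 1)) := by
    rw [← lintegral_const_mul' _ _ ENNReal.ofReal_ne_top, ← lintegral_indicator measurableSet_Ioo]
    refine lintegral_congr fun x => ?_
    have hpos := beta_pos ha hb
    by_cases hx : x ∈ Set.Ioo (0 : ℝ) 1
    · rw [Set.indicator_of_mem hx, betaPDF_of_pos_lt_one hx.1 hx.2,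
        ← ENNReal.ofReal_mul (by positivity), mul_assoc]
    · rw [Set.indicator_of_notMem hx, betaPDF_eq, if_neg (by simpa using hx)]
      simp
  rw [h1] at h2
  have hpos := beta_pos ha hb
  have h3 := congrArg (fun z => ENNReal.ofReal (beta a b) * z) h2
  rw [mul_one, ← mul_assoc, ← ENNReal.ofReal_mul hpos.le, mul_one_div_cancel hpos.ne'] at h3
  simpa using h3.symm

/-- Divided by `m ^ (β + 1 - α)` this is the right-endpoint Riemann sum of the antitone function `x
^ (-α) * (1 - x) ^ β`, since `m - 1 - w = m - (w + 1)`. -/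
lemma sum_rpow_mul_rpow_le {α β : ℝ} (hα0 : 0 ≤ α) (hα : α < 1) (hβ : 0 ≤ β) (m : ℕ) :
    ∑ w ∈ Finset.range m, ((w + 1 : ℕ) : ℝ) ^ (-α) * ((m - 1 - w : ℕ) : ℝ) ^ β
      ≤ (m : ℝ) ^ (β + (1 - α)) * beta (1 - α) (β + 1) := by
  rcases Nat.eq_zero_or_pos m with rfl | hm
  · have := beta_pos (sub_pos.2 hα) (show 0 < β + 1 by linarith)
    simp only [Finset.range_zero, Finset.sum_empty]
    positivity
  have hm' : (0 : ℝ) < m := by exact_mod_cast hm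
  let G : ℝ → ℝ≥0∞ := fun y => ENNReal.ofReal (y ^ (1 - α - 1) * (1 - y) ^ (β + 1 - 1))
  have hG : AntitoneOn G (Set.Ioc 0 1) := by
    intro x hx y hy hxy
    refine ENNReal.ofReal_le_ofReal ?_
    have h1 : y ^ (1 - α - 1) ≤ x ^ (1 - α - 1) :=
      Real.rpow_le_rpow_of_nonpos hx.1 hxy (by linarith)
    have h2 : (1 - y) ^ (β + 1 - 1) ≤ (1 - x) ^ (β + 1 - 1) :=
      Real.rpow_le_rpow (by linarith [hy.2]) (by linarith) (by linarith)
    exact mul_le_mul h1 h2 (Real.rpow_nonneg (by linarith [hy.2]) _)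
      (Real.rpow_nonneg hx.1.le _)
  have key := riemannSum_le hG m
  have hbeta := beta_pos (sub_pos.2 hα) (show 0 < β + 1 by linarith)
  rw [lintegral_beta (by linarith) (by linarith)] at key
  have hterm : ∀ w ∈ Finset.range m, ENNReal.ofReal (1 / m) * G ((w + 1 : ℕ) / m)
      = ENNReal.ofReal ((m : ℝ) ^ (-(β + (1 - α)))
        * (((w + 1 : ℕ) : ℝ) ^ (-α) * ((m - 1 - w : ℕ) : ℝ) ^ β)) := by
    intro w hw
    have hw' : w < m := Finset.mem_range.1 hw
    simp only [G]
    rw [← ENNReal.ofReal_mul (by positivity)]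
    congr 1
    have hsub : 1 - ((w + 1 : ℕ) : ℝ) / m = ((m - 1 - w : ℕ) : ℝ) / m := by
      rw [show m - 1 - w = m - (w + 1) by lia, Nat.cast_sub (by lia)]
      field_simp
    rw [hsub, Real.div_rpow (by positivity) hm'.le, Real.div_rpow (by positivity) hm'.le,
      show 1 - α - 1 = -α by ring, show β + 1 - 1 = β by ring,
      show -(β + (1 - α)) = -β + α + (-1) by ring, Real.rpow_add hm', Real.rpow_add hm',
      Real.rpow_neg hm'.le β, Real.rpow_neg hm'.le α, Real.rpow_neg_one]
    field_simp
  rw [Finset.sum_congr rfl hterm, ← ENNReal.ofReal_sum_of_nonneg (fun w _ => by positivity),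
    ENNReal.ofReal_le_ofReal_iff hbeta.le, ← Finset.mul_sum, Real.rpow_neg hm'.le,
    inv_mul_le_iff₀ (by positivity)] at key
  exact key

/-- Each convolution contributes a Beta function, whose numerator `Γ(β + 1)` cancels the denominator
of the previous bound, so the Gamma factors telescope. -/
lemma convSum_le {e : ℕ → ℝ} {α c : ℝ} (he0 : ∀ w, 0 ≤ e w) (hc : 0 ≤ c) (hα0 : 0 ≤ α)
    (hα : α < 1) (he : ∀ w, e w ≤ c * ((w + 1 : ℕ) : ℝ) ^ (-α)) (p m : ℕ) :
    convSum e p m ≤ (c * Real.Gamma (1 - α)) ^ p / Real.Gamma (p * (1 - α) + 1)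
      * (m : ℝ) ^ (p * (1 - α)) := by
  induction p generalizing m with
  | zero => simp [convSum]
  | succ p ih =>
    have h1α : 0 < 1 - α := by linarith
    set β : ℝ := p * (1 - α) with hβ_def
    have hβ : 0 ≤ β := by positivity
    have hG1 : 0 < Real.Gamma (β + 1) := Real.Gamma_pos_of_pos (by linarith)
    have hG2 : 0 < Real.Gamma (1 - α) := Real.Gamma_pos_of_pos h1α
    have hG3 : 0 < Real.Gamma (β + (1 - α) + 1) := Real.Gamma_pos_of_pos (by linarith)
    set K := (c * Real.Gamma (1 - α)) ^ p / Real.Gamma (β + 1) with hK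
    have hK0 : 0 ≤ K := by positivity
    calc convSum e (p + 1) m
        = ∑ w ∈ Finset.range m, e w * convSum e p (m - 1 - w) := rfl
      _ ≤ ∑ w ∈ Finset.range m, c * K *
          (((w + 1 : ℕ) : ℝ) ^ (-α) * ((m - 1 - w : ℕ) : ℝ) ^ β) := by
        refine Finset.sum_le_sum fun w _ => ?_
        refine (mul_le_mul (he w) (ih (m - 1 - w)) (convSum_nonneg he0 _ _)
          (by positivity)).trans (le_of_eq ?_)
        ring
      _ ≤ c * K * ((m : ℝ) ^ (β + (1 - α)) * beta (1 - α) (β + 1)) := by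
        rw [← Finset.mul_sum]
        exact mul_le_mul_of_nonneg_left (sum_rpow_mul_rpow_le hα0 hα hβ m) (by positivity)
      _ = _ := by
        have hexp : ((p + 1 : ℕ) : ℝ) * (1 - α) = β + (1 - α) := by
          rw [hβ_def]; push_cast; ring
        rw [hexp, beta, hK, show 1 - α + (β + 1) = β + (1 - α) + 1 by ring, pow_succ]
        field_simp

end OrderedSums

/-! ### Comparison and one-dimensional law of running minima. -/

section RunMin

open scoped ENNReal

lemma measurable_runMin {Ω : Type*} {m : MeasurableSpace Ω} {Z : ℕ → Ω → ℝ} {i : ℕ}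
    (h : ∀ j ≤ i, Measurable (Z j)) : Measurable fun ω => runMin (fun j => Z j ω) i := by
  induction i with
  | zero => exact h 0 le_rfl
  | succ i ih => exact (ih fun j hj => h j (by lia)).min (h _ le_rfl)

lemma lt_runMin_iff {z : ℕ → ℝ} {t : ℝ} {i : ℕ} : t < runMin z i ↔ ∀ j ≤ i, t < z j := by
  induction i with
  | zero => simp [runMin]
  | succ i ih =>
    simp only [runMin, lt_min_iff, ih]
    constructor
    · rintro ⟨h1, h2⟩ j hj
      rcases Nat.lt_or_ge j (i + 1) with h | h
      · exact h1 j (by lia)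
      · obtain rfl : j = i + 1 := by lia
        exact h2
    · exact fun h => ⟨fun j hj => h j (by lia), h _ le_rfl⟩

lemma runMin_le_runMin_shift (z : ℕ → ℝ) {s v : ℕ} (hsv : s ≤ v) :
    runMin z v ≤ runMin (fun j => z (s + j)) (v - s) :=
  le_of_forall_lt fun _ ht => lt_runMin_iff.2 fun j hj => lt_runMin_iff.1 ht (s + j) (by lia)

lemma runMin_pos {z : ℕ → ℝ} {i : ℕ} (h : ∀ j, 0 < z j) : 0 < runMin z i :=
  lt_runMin_iff.2 fun j _ => h j

lemma hasLaw_runMin {Ω : Type*} [MeasurableSpace Ω] {P : Measure Ω} [IsProbabilityMeasure P]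
    {d : ℕ → ℝ} {Z : ℕ → Ω → ℝ} (hZ : ∀ i, HasLaw (Z i) (expMeasure (d i)) P)
    (hm : ∀ i, Measurable (Z i)) (hd : ∀ i, 0 < d i) (hind : iIndepFun Z P) (i : ℕ) :
    HasLaw (fun ω => runMin (fun j => Z j ω) i) (expMeasure (point d i)) P := by
  have hmr := measurable_runMin (i := i) fun j _ => hm j
  refine ⟨hmr.aemeasurable, ?_⟩
  have := Measure.isProbabilityMeasure_map (μ := P) hmr.aemeasurable
  refine expMeasure_unique (point_pos hd i) fun t ht => ?_
  rw [Measure.map_apply hmr measurableSet_Ioi]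
  have hset : (fun ω => runMin (fun j => Z j ω) i) ⁻¹' Set.Ioi t
      = ⋂ j ∈ Finset.range (i + 1), Z j ⁻¹' Set.Ioi t := by
    ext ω
    simp [lt_runMin_iff]
  rw [hset, hind.measure_inter_preimage_eq_mul _ fun j _ => measurableSet_Ioi]
  have : ∀ j, P (Z j ⁻¹' Set.Ioi t) = ENNReal.ofReal (Real.exp (-(d j * t))) := fun j => by
    rw [← Measure.map_apply (hm j) measurableSet_Ioi, (hZ j).map_eq, expMeasure_Ioi (hd j) ht]
  simp_rw [this]
  rw [← ENNReal.ofReal_prod_of_nonneg fun j _ => (Real.exp_pos _).le, ← Real.exp_sum]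
  simp [point, Finset.sum_mul]

end RunMin

/-! ### Ordered sums with values in `ℝ≥0∞`. -/

section OrderedSums

open scoped ENNReal

lemma gapSum_congr {R : Type*} [CommSemiring R] {b b' : ℕ → ℕ → R} {n : ℕ}
    (h : ∀ s v, v < n → b s v = b' s v) (p s : ℕ) : gapSum b n p s = gapSum b' n p s := by
  induction p generalizing s with
  | zero => rfl
  | succ p ih =>
    exact Finset.sum_congr rfl fun v hv => by rw [h s v (Finset.mem_Ico.1 hv).2, ih]

lemma measurable_gapSum {α : Type*} [MeasurableSpace α] {b : ℕ → ℕ → α → ℝ≥0∞}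
    (hb : ∀ s v, Measurable (b s v)) (n p s : ℕ) :
    Measurable fun x => gapSum (fun s v => b s v x) n p s := by
  induction p generalizing s with
  | zero => exact measurable_const
  | succ p ih => exact Finset.measurable_fun_sum _ fun v _ => (hb s v).mul (ih _)

/-- Truncated subtraction takes over the role of the maximum with `0`. -/
lemma pow_le_factorial_mul_gapSum_ennreal {A : ℕ → ℝ≥0∞} {δ : ℝ≥0∞} {n : ℕ} (hA : ∀ v, A v ≠ ∞)
    (hδ : ∀ v < n, A v ≤ δ) (hδ' : δ ≠ ∞) (p : ℕ) :
    (∑ v ∈ Finset.range n, A v - p * δ) ^ p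
      ≤ p.factorial * gapSum (fun _ v => A v) n p 0 := by
  have h := pow_le_factorial_mul_gapSum (a := fun v => (A v).toReal) (δ := δ.toReal)
    (fun v => ENNReal.toReal_nonneg) (n := n)
    (fun v hv => ENNReal.toReal_mono hδ' (hδ v hv)) ENNReal.toReal_nonneg p 0
  have h2 := ENNReal.ofReal_le_ofReal h
  rw [ENNReal.ofReal_mul (by positivity), (ofReal_gapSum (fun _ v => ENNReal.toReal_nonneg)
    n p 0).2, ENNReal.ofReal_natCast] at h2
  simp only [ENNReal.ofReal_toReal (hA _)] at h2
  refine le_trans (le_of_eq ?_) h2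
  rw [ENNReal.ofReal_pow (le_max_right _ _)]
  congr 1
  rw [Finset.range_eq_Ico, ENNReal.ofReal_max, ENNReal.ofReal_zero, max_eq_left zero_le,
    ENNReal.ofReal_sub _ (by positivity),
    ENNReal.ofReal_sum_of_nonneg (fun v _ => ENNReal.toReal_nonneg),
    ENNReal.ofReal_mul (by positivity), ENNReal.ofReal_natCast, ENNReal.ofReal_toReal hδ']
  simp only [ENNReal.ofReal_toReal (hA _)]

end OrderedSums

/-! ### Mean, summability and moment bounds of the limit. -/

section Limit

open Set
open scoped ENNReal

variable {Ω : Type*} [MeasurableSpace Ω] {Q : Measure Ω} {U E : ℕ → Ω → ℝ} {k : ℕ}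

/-- Both sides are images of `minMeasure`. This carries statements between the chain and any
concrete independent exponentials, and is used with all rates `1/n`. -/
lemma IsChain.map_chainMin_eq_map_runMin (h : IsChain U E Q) [IsProbabilityMeasure Q] {d : ℕ → ℝ}
    (hd : ∀ i, 0 < d i) {n : ℕ} (hn : ∀ i < n, point d i < 1)
    {Ω' : Type*} [MeasurableSpace Ω'] {P : Measure Ω'} [IsProbabilityMeasure P]
    {Z : ℕ → Ω' → ℝ} (hZ : ∀ i, HasLaw (Z i) (expMeasure (d i)) P)
    (hm : ∀ i, Measurable (Z i)) (hind : iIndepFun Z P) :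
    Q.map (fun ω i => if i < n then chainMin U E (point d i) ω else 0)
      = P.map (fun ω i => if i < n then ENNReal.ofReal (runMin (fun j => Z j ω) i) else 0) := by
  have hr : Measurable fun (v : ℕ → ℝ) i => ENNReal.ofReal (cutoff n v i) :=
    measurable_pi_iff.2 fun i =>
      ((measurable_pi_apply i).comp (measurable_cutoff n)).ennreal_ofReal
  have hc : Measurable fun ω => cutoff n (runMin fun i => Z i ω) :=
    (measurable_cutoff n).comp (measurable_pi_iff.2 fun i => measurable_runMin fun j _ => hm j)
  rw [h.map_chainMin hd hn, ← map_runMin hZ hm hind n, Measure.map_map hr hc]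
  congr 1
  ext ω i
  simp only [Function.comp_apply, cutoff]
  split_ifs <;> simp

lemma lintegral_rootFun_expMeasure (k : ℕ) {x : ℝ} (hx : 0 < x) :
    ∫⁻ z, rootFun k (ENNReal.ofReal z) ∂expMeasure x
      = ENNReal.ofReal ((k.factorial : ℝ) ^ (1 / (k : ℝ)) * Real.Gamma (1 + 1 / k)
          * x ^ (-(1 / (k : ℝ)))) := by
  have h1 : ∀ᵐ z ∂expMeasure x, rootFun k (ENNReal.ofReal z)
      = ENNReal.ofReal ((k.factorial : ℝ) ^ (1 / (k : ℝ))) * ENNReal.ofReal (z ^ (1 / (k : ℝ))) := by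
    filter_upwards [ae_expMeasure_pos hx] with z hz
    rw [rootFun_ofReal k hz.le, Real.mul_rpow (by positivity) hz.le,
      ENNReal.ofReal_mul (by positivity)]
  rw [lintegral_congr_ae h1, lintegral_const_mul' _ _ ENNReal.ofReal_ne_top,
    lintegral_rpow_expMeasure hx (by have : (0 : ℝ) ≤ 1 / k := by positivity
                                     linarith), ← ENNReal.ofReal_mul (by positivity), mul_assoc]

lemma measurable_pathIntegral (hU : ∀ j, Measurable (U j)) (hE : ∀ j, Measurable (E j)) :
    Measurable (pathIntegral k U E) :=
  Measurable.lintegral_prod_left' (f := fun q : ℝ × Ω => rootFun k (chainMin U E q.1 q.2))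
    ((measurable_rootFun k).comp (measurable_chainMin_prod hU hE))

lemma one_div_cast_lt_one (hk : 2 ≤ k) : 1 / (k : ℝ) < 1 := by
  have : (2 : ℝ) ≤ k := by exact_mod_cast hk
  rw [div_lt_one (by linarith)]; linarith

lemma lintegral_Ioo_rpow_neg {α : ℝ} (hα : α < 1) :
    ∫⁻ x in Ioo (0 : ℝ) 1, ENNReal.ofReal (x ^ (-α)) = ENNReal.ofReal (1 / (1 - α)) := by
  have h := lintegral_beta (sub_pos.2 hα) one_pos
  have hG : Real.Gamma (1 - α) ≠ 0 := (Real.Gamma_pos_of_pos (sub_pos.2 hα)).ne'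
  rw [beta, Real.Gamma_one, Real.Gamma_add_one (sub_pos.2 hα).ne'] at h
  simp only [sub_self, Real.rpow_zero, mul_one] at h
  rw [show 1 - α - 1 = -α by ring] at h
  rw [h]
  congr 1
  have := (sub_pos.2 hα).ne'
  field_simp

lemma eta_one_eq (hk : 2 ≤ k) : eta k 1 = (k.factorial : ℝ) ^ (1 / (k : ℝ))
    * Real.Gamma (1 + 1 / k) * (1 / (1 - 1 / k)) := by
  have hk' : (2 : ℝ) ≤ k := by exact_mod_cast hk
  have h0 : (k : ℝ) ≠ 0 := by linarith
  have h1 : (k : ℝ) - 1 ≠ 0 := by linarith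
  rw [eta, add_comm, Real.Gamma_add_one (by positivity)]
  simp only [Nat.cast_one, Real.Gamma_one, div_one]
  field_simp

/-- Tonelli: the minimum at `x` is Exp(x), so its `k`-th root has mean proportional to `x ^ (-1/k)`,
which is integrable because `k ≥ 2`. -/
lemma IsChain.lintegral_pathIntegral (h : IsChain U E Q) [IsProbabilityMeasure Q] (hk : 2 ≤ k) :
    ∫⁻ ω, pathIntegral k U E ω ∂Q = ENNReal.ofReal (eta k 1) := by
  have hswap : ∫⁻ ω, pathIntegral k U E ω ∂Q
      = ∫⁻ x in Ioo 0 1, ∫⁻ ω, rootFun k (chainMin U E x ω) ∂Q := by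
    unfold pathIntegral
    exact lintegral_lintegral_swap (f := fun ω x => rootFun k (chainMin U E x ω))
      (((measurable_rootFun k).comp (measurable_chainMin_prod h.measurable_U h.measurable_E)).comp
        measurable_swap).aemeasurable
  have hx : ∫⁻ x in Ioo 0 1, ∫⁻ ω, rootFun k (chainMin U E x ω) ∂Q
      = ∫⁻ x in Ioo (0 : ℝ) 1, ENNReal.ofReal ((k.factorial : ℝ) ^ (1 / (k : ℝ))
        * Real.Gamma (1 + 1 / k)) * ENNReal.ofReal (x ^ (-(1 / (k : ℝ)))) := by
    refine setLIntegral_congr_fun measurableSet_Ioo fun x hx => ?_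
    rw [h.lintegral_comp_chainMin hx (measurable_rootFun k), lintegral_rootFun_expMeasure k hx.1,
      ENNReal.ofReal_mul (mul_nonneg (by positivity)
        (Real.Gamma_nonneg_of_nonneg (by positivity)))]
  rw [hswap, hx, lintegral_const_mul' _ _ ENNReal.ofReal_ne_top,
    lintegral_Ioo_rpow_neg (one_div_cast_lt_one hk), ← ENNReal.ofReal_mul
      (mul_nonneg (by positivity) (Real.Gamma_nonneg_of_nonneg (by positivity))), eta_one_eq hk]

/-- The path integral has finite mean, hence is almost surely finite; as it is the sum of the
nonnegative terms `limitB`, the series converges. -/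
lemma IsChain.ae_limitVar (h : IsChain U E Q) [IsProbabilityMeasure Q] (hk : 2 ≤ k) :
    ∀ᵐ ω ∂Q, IsGood U E ω ∧ Summable (fun p => limitB k U E p ω) ∧ 0 ≤ limitVar k U E ω ∧
      ENNReal.ofReal (limitVar k U E ω) = pathIntegral k U E ω := by
  have hfin : ∫⁻ ω, pathIntegral k U E ω ∂Q ≠ ∞ := by
    rw [h.lintegral_pathIntegral hk]; exact ENNReal.ofReal_ne_top
  filter_upwards [h.ae_isGood, ae_lt_top' (measurable_pathIntegral h.measurable_U
    h.measurable_E).aemeasurable hfin] with ω hω hlt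
  rw [hω.pathIntegral_eq k] at hlt ⊢
  have hs : Summable fun p => limitB k U E p ω := by
    have := ENNReal.summable_toReal hlt.ne
    refine this.congr fun p => ENNReal.toReal_ofReal (hω.limitB_nonneg k p)
  exact ⟨hω, hs, tsum_nonneg fun p => hω.limitB_nonneg k p,
    ENNReal.ofReal_tsum_of_nonneg (fun p => hω.limitB_nonneg k p) hs⟩

/-- The `n`-th Riemann sum approximations have summands `gridTerm`. -/
def gridTerm (k n : ℕ) (y : ℝ≥0∞) : ℝ≥0∞ := ENNReal.ofReal (1 / n) * rootFun k y

@[fun_prop]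
lemma measurable_gridTerm (k n : ℕ) : Measurable (gridTerm k n) := by
  unfold gridTerm; fun_prop

lemma point_const {c : ℝ} (i : ℕ) : point (fun _ => c) i = (i + 1 : ℕ) * c := by
  simp [point]

/-- Pass to independent Exp(1/n) variables and replace each running minimum by the larger minimum
over the window that starts just after the previously chosen index. Windows are independent, and a
window of `w + 1` variables gives an Exp((w + 1)/n) minimum, so `convSum_le` applies with exponent
`1/k`. -/
lemma IsChain.lintegral_gapSum_gridTerm_le (h : IsChain U E Q) [IsProbabilityMeasure Q] (hk : 2 ≤ k)
    {n : ℕ} (hn : 0 < n) (p : ℕ) :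
    ∫⁻ ω, p.factorial * gapSum (fun _ v => gridTerm k n (chainMin U E ((v + 1 : ℕ) / n) ω))
      (n - 1) p 0 ∂Q ≤ ENNReal.ofReal (rho k p) := by
  have hn' : (0 : ℝ) < n := by exact_mod_cast hn
  have hd : ∀ i : ℕ, 0 < (fun _ : ℕ => (1 : ℝ) / n) i := fun _ => by positivity
  have hlt : ∀ i < n - 1, point (fun _ => (1 : ℝ) / n) i < 1 := by
    intro i hi
    rw [point_const, mul_one_div, div_lt_one hn']
    exact_mod_cast (by lia : i + 1 < n)
  -- Any independent Exp(1/n) variables would do; rescaling `E` provides them on the same space.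
  let Z : ℕ → Ω → ℝ := fun i ω => E i ω / (1 / n)
  have hZm : ∀ i, Measurable (Z i) := fun i => (h.measurable_E i).div_const _
  have hZ : ∀ i, HasLaw (Z i) (expMeasure (1 / n)) Q := fun i => by
    refine ⟨(hZm i).aemeasurable, ?_⟩
    have h1 := map_div_expMeasure one_pos (hd 0)
    rw [one_mul] at h1
    rw [← h1, ← (h.law_E i).map_eq, Measure.map_map (by fun_prop) (h.measurable_E i)]
    rfl
  have hEind : iIndepFun E Q := h.indep.precomp (g := Sum.inr) Sum.inr_injective
  have hind : iIndepFun Z Q := hEind.comp (fun _ x => x / (1 / n)) fun _ => by fun_prop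
  have hlaw := h.map_chainMin_eq_map_runMin hd hlt hZ hZm hind
  let Ψ : (ℕ → ℝ≥0∞) → ℝ≥0∞ := fun y =>
    p.factorial * gapSum (fun _ v => gridTerm k n (y v)) (n - 1) p 0
  have hΨ : Measurable Ψ :=
    (measurable_gapSum (b := fun _ v (y : ℕ → ℝ≥0∞) => gridTerm k n (y v))
      (fun _ v => by fun_prop) _ _ _).const_mul _
  have e := congrArg (fun μ => ∫⁻ y, Ψ y ∂μ) hlaw
  rw [lintegral_map hΨ, lintegral_map hΨ] at e
  rotate_left
  · refine measurable_pi_iff.2 fun i => ?_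
    split_ifs
    · exact (measurable_runMin fun j _ => hZm j).ennreal_ofReal
    · exact measurable_const
  · refine measurable_pi_iff.2 fun i => ?_
    split_ifs
    · exact measurable_chainMin h.measurable_U h.measurable_E _
    · exact measurable_const
  have e1 : ∀ ω, Ψ (fun i => if i < n - 1 then
      chainMin U E (point (fun _ => (1 : ℝ) / n) i) ω else 0) = p.factorial *
        gapSum (fun _ v => gridTerm k n (chainMin U E ((v + 1 : ℕ) / n) ω)) (n - 1) p 0 := by
    intro ω
    simp only [Ψ]
    congr 1
    refine gapSum_congr (fun s v hv => ?_) p 0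
    rw [if_pos hv, point_const, mul_one_div]
  simp_rw [e1] at e
  rw [e]
  -- compare with the minima over windows
  let b : ℕ → ℕ → Ω → ℝ≥0∞ := fun s v ω =>
    gridTerm k n (ENNReal.ofReal (runMin (fun j => Z (s + j) ω) (v - s)))
  -- The power of `n` is the mesh `1/n` times the `n^{1/k}` that comes from the rate `(w + 1)/n`; it
  -- cancels against the final `n ^ (p (1 - 1/k))`.
  set c : ℝ := (k.factorial : ℝ) ^ (1 / (k : ℝ)) * Real.Gamma (1 + 1 / k)
    * (n : ℝ) ^ (-(1 - 1 / (k : ℝ))) with hc_def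
  have hΓ : 0 ≤ Real.Gamma (1 + 1 / (k : ℝ)) := Real.Gamma_nonneg_of_nonneg (by positivity)
  have hc : 0 ≤ c := by positivity
  let ev : ℕ → ℝ := fun w => c * ((w + 1 : ℕ) : ℝ) ^ (-(1 / (k : ℝ)))
  have hev : ∀ w, 0 ≤ ev w := fun w => by positivity
  have hbound := lintegral_gapSum_le hind hZm id (b := b) (e := ev) (fun s v hsv => by
      refine (measurable_gridTerm k n).comp (Measurable.ennreal_ofReal ?_)
      refine measurable_runMin fun j hj => ?_
      exact measurable_iSup_comap Z (by simp; lia)) hev (fun s v hsv => by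
      have hl := hasLaw_runMin (Z := fun j => Z (s + j)) (fun j => hZ (s + j))
        (fun j => hZm (s + j)) hd (hind.precomp (add_right_injective s)) (v - s)
      have hp : 0 < point (fun _ => (1 : ℝ) / n) (v - s) := point_pos hd _
      have e2 : ∫⁻ ω, b s v ω ∂Q = ∫⁻ z, gridTerm k n (ENNReal.ofReal z)
          ∂expMeasure (point (fun _ => (1 : ℝ) / n) (v - s)) := by
        rw [← hl.map_eq, lintegral_map (by fun_prop) (measurable_runMin fun j _ => hZm (s + j))]
      rw [e2]
      unfold gridTerm
      rw [lintegral_const_mul' _ _ ENNReal.ofReal_ne_top, lintegral_rootFun_expMeasure k hp,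
        ← ENNReal.ofReal_mul (by positivity)]
      refine ENNReal.ofReal_le_ofReal (le_of_eq ?_)
      simp only [ev, hc_def]
      rw [point_const, mul_one_div, Real.div_rpow (by positivity) hn'.le,
        show -(1 - 1 / (k : ℝ)) = -1 + 1 / k by ring, Real.rpow_add hn', Real.rpow_neg_one,
        Real.rpow_neg hn'.le]
      field_simp) (n - 1) p 0
  have hconv := convSum_le (e := ev) hev hc (by positivity : 0 ≤ 1 / (k : ℝ))
    (one_div_cast_lt_one hk) (fun w => le_rfl) p (n - 1 - 0)
  have hα := one_div_cast_lt_one hk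
  have hG1 : 0 < Real.Gamma (1 - 1 / (k : ℝ)) := Real.Gamma_pos_of_pos (by linarith)
  have hG2 : 0 < Real.Gamma (p * (1 - 1 / (k : ℝ)) + 1) :=
    Real.Gamma_pos_of_pos (by have : 0 ≤ 1 - 1 / (k : ℝ) := by linarith
                              positivity)
  calc _ ≤ ∫⁻ ω, p.factorial * gapSum (fun s v => b s v ω) (n - 1) p 0 ∂Q := by
        refine lintegral_mono fun ω => ?_
        simp only [Ψ]
        refine mul_le_mul' le_rfl ?_
        rw [gapSum_congr (b' := fun _ v => gridTerm k n (ENNReal.ofReal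
          (runMin (fun j => Z j ω) v))) (fun s v hv => by rw [if_pos hv])]
        refine gapSum_mono (fun s v hsv => ?_) _ _ _
        refine mul_le_mul' le_rfl (rootFun_mono k (ENNReal.ofReal_le_ofReal ?_))
        exact runMin_le_runMin_shift (fun j => Z j ω) hsv
    _ ≤ p.factorial * ENNReal.ofReal (convSum ev p (n - 1 - 0)) := by
        rw [lintegral_const_mul' _ _ (by simp)]
        exact mul_le_mul' le_rfl hbound
    _ ≤ p.factorial * ENNReal.ofReal ((c * Real.Gamma (1 - 1 / (k : ℝ))) ^ p
          / Real.Gamma (p * (1 - 1 / (k : ℝ)) + 1) * (n : ℝ) ^ (p * (1 - 1 / (k : ℝ)))) := by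
        refine mul_le_mul' le_rfl (ENNReal.ofReal_le_ofReal (hconv.trans ?_))
        refine mul_le_mul_of_nonneg_left (Real.rpow_le_rpow (by positivity) ?_ ?_) (by positivity)
        · exact_mod_cast (by lia)
        · have : 0 ≤ 1 - 1 / (k : ℝ) := by linarith
          positivity
    _ = ENNReal.ofReal (rho k p) := by
        rw [← ENNReal.ofReal_natCast, ← ENNReal.ofReal_mul (by positivity)]
        congr 1
        have hk' : (2 : ℝ) ≤ k := by exact_mod_cast hk
        have hk0 : (k : ℝ) ≠ 0 := by linarith
        -- The reflection formula turns `Γ(1 + 1/k) Γ(1 - 1/k)` into `(π/k) / sin (π/k)`.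
        have hrefl := Real.Gamma_mul_Gamma_one_sub (1 / (k : ℝ))
        have hG : Real.Gamma (1 + 1 / (k : ℝ)) = 1 / k * Real.Gamma (1 / k) := by
          rw [add_comm, Real.Gamma_add_one (by positivity)]
        have hpow : (n : ℝ) ^ (p * (1 - 1 / (k : ℝ))) = ((n : ℝ) ^ (1 - 1 / (k : ℝ))) ^ p := by
          rw [mul_comm, Real.rpow_mul hn'.le, Real.rpow_natCast]
        have hbase : c * Real.Gamma (1 - 1 / (k : ℝ)) * (n : ℝ) ^ (1 - 1 / (k : ℝ))
            = Real.pi / k * (k.factorial : ℝ) ^ (1 / (k : ℝ)) / Real.sin (Real.pi / k) := by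
          have hpi : Real.pi / k = Real.pi * (1 / k) := by ring
          rw [hc_def, hG, Real.rpow_neg hn'.le]
          have hnp : (n : ℝ) ^ (1 - 1 / (k : ℝ)) ≠ 0 := (Real.rpow_pos_of_pos hn' _).ne'
          calc _ = (k.factorial : ℝ) ^ (1 / (k : ℝ)) * (1 / k)
                * (Real.Gamma (1 / k) * Real.Gamma (1 - 1 / k)) := by field_simp
            _ = _ := by rw [hrefl, hpi]; ring
        rw [rho, ← hbase, hpow, show (p : ℝ) + 1 - p / k = p * (1 - 1 / k) + 1 by ring, mul_pow]
        ring

lemma IsGood.antitoneOn_rootFun {Ω : Type*} {U E : ℕ → Ω → ℝ} {ω : Ω} (h : IsGood U E ω) (k : ℕ) :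
    AntitoneOn (fun x => rootFun k (chainMin U E x ω)) (Ioc 0 1) :=
  fun _ _ _ _ hxy => rootFun_mono k (h.chainMin_antitone hxy)

lemma IsGood.chainMin_ne_top {Ω : Type*} {U E : ℕ → Ω → ℝ} {ω : Ω} (h : IsGood U E ω) {x : ℝ} (hx : 0 < x) :
    chainMin U E x ω ≠ ∞ := by
  obtain ⟨N, hN⟩ := (h.tendsto.eventually (gt_mem_nhds hx)).exists
  rw [h.chainMin_eq hN.le]
  exact ENNReal.ofReal_ne_top

/-- The Riemann sums of the path of successive minima. -/
def gridSum {Ω : Type*} (k : ℕ) (U E : ℕ → Ω → ℝ) (n : ℕ) (ω : Ω) : ℝ≥0∞ :=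
  ∑ i ∈ Finset.range (n - 1), gridTerm k n (chainMin U E ((i + 1 : ℕ) / n) ω)

lemma IsGood.tendsto_gridSum {Ω : Type*} {U E : ℕ → Ω → ℝ} {ω : Ω} (h : IsGood U E ω) (k : ℕ) :
    Tendsto (fun n => gridSum k U E n ω) atTop (𝓝 (pathIntegral k U E ω)) :=
  tendsto_riemannSum (h.antitoneOn_rootFun k)

lemma rootFun_ne_top {y : ℝ≥0∞} (hy : y ≠ ∞) (k : ℕ) : rootFun k y ≠ ∞ :=
  ENNReal.rpow_ne_top_of_nonneg (by positivity) (ENNReal.mul_ne_top (by simp) hy)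

/-- Fatou along the Riemann sums: the correction in `pow_le_factorial_mul_gapSum_ennreal` is `p`
times the first grid term, which tends to `0` by `tendsto_mesh_mul`. -/
lemma IsChain.lintegral_pathIntegral_pow_le (h : IsChain U E Q) [IsProbabilityMeasure Q]
    (hk : 2 ≤ k) (p : ℕ) :
    ∫⁻ ω, pathIntegral k U E ω ^ p ∂Q ≤ ENNReal.ofReal (rho k p) := by
  let g : ℕ → Ω → ℝ≥0∞ := fun n ω => p.factorial *
    gapSum (fun _ v => gridTerm k n (chainMin U E ((v + 1 : ℕ) / n) ω)) (n - 1) p 0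
  have hgm : ∀ n, Measurable (g n) := fun n =>
    (measurable_gapSum (b := fun _ v ω => gridTerm k n (chainMin U E ((v + 1 : ℕ) / n) ω))
      (fun s v => (measurable_gridTerm k n).comp
        (measurable_chainMin h.measurable_U h.measurable_E _)) _ _ _).const_mul _
  calc ∫⁻ ω, pathIntegral k U E ω ^ p ∂Q
      ≤ ∫⁻ ω, liminf (fun n => g n ω) atTop ∂Q := by
        refine lintegral_mono_ae ?_
        filter_upwards [h.ae_limitVar hk] with ω ⟨hω, _, _, hpath⟩
        have hfin : pathIntegral k U E ω ≠ ∞ := hpath ▸ ENNReal.ofReal_ne_top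
        have hδ : Tendsto (fun n : ℕ => (p : ℝ≥0∞) *
            (ENNReal.ofReal (1 / n) * rootFun k (chainMin U E (1 / n) ω))) atTop (𝓝 0) := by
          have := ENNReal.Tendsto.const_mul (a := (p : ℝ≥0∞))
            (tendsto_mesh_mul (hω.antitoneOn_rootFun k) hfin) (Or.inr (by simp))
          simpa using this
        have hlim : Tendsto (fun n : ℕ => (gridSum k U E n ω - p *
            (ENNReal.ofReal (1 / n) * rootFun k (chainMin U E (1 / n) ω))) ^ p) atTop
            (𝓝 (pathIntegral k U E ω ^ p)) := by
          have h1 := ENNReal.Tendsto.sub (hω.tendsto_gridSum k) hδ (Or.inl hfin)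
          rw [tsub_zero] at h1
          exact ENNReal.Tendsto.pow h1
        rw [← hlim.liminf_eq]
        refine liminf_le_liminf ?_
        filter_upwards [eventually_gt_atTop 0] with n hn
        have hn' : (0 : ℝ) < n := by exact_mod_cast hn
        have hne : ∀ v : ℕ, gridTerm k n (chainMin U E ((v + 1 : ℕ) / n) ω) ≠ ∞ := fun v =>
          ENNReal.mul_ne_top ENNReal.ofReal_ne_top
            (rootFun_ne_top (hω.chainMin_ne_top (by positivity)) k)
        refine pow_le_factorial_mul_gapSum_ennreal hne (fun v hv => ?_) ?_ p
        · refine mul_le_mul' le_rfl (rootFun_mono k (hω.chainMin_antitone ?_))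
          gcongr
          simp
        · exact ENNReal.mul_ne_top ENNReal.ofReal_ne_top
            (rootFun_ne_top (hω.chainMin_ne_top (by positivity)) k)
    _ ≤ liminf (fun n => ∫⁻ ω, g n ω ∂Q) atTop := lintegral_liminf_le hgm
    _ ≤ ENNReal.ofReal (rho k p) := by
        refine (liminf_le_liminf (v := fun _ => ENNReal.ofReal (rho k p)) ?_).trans ?_
        · filter_upwards [eventually_gt_atTop 0] with n hn
          exact h.lintegral_gapSum_gridTerm_le hk hn p
        · simp

end Limit

/-! ### The second moment of the limit -/

section SecondMoment

open Set
open scoped ENNReal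

lemma lintegral_Ioi_zero_eq_mul {σ : ℝ} (hσ : 0 < σ) (f : ℝ → ℝ≥0∞) :
    ∫⁻ a in Ioi 0, f a = ENNReal.ofReal σ * ∫⁻ a in Ioi 0, f (σ * a) := by
  have h := lintegral_image_eq_lintegral_abs_deriv_mul (s := Ioi (0 : ℝ))
    (f := fun u => σ * u) (f' := fun _ => σ) measurableSet_Ioi
    (fun x _ => by simpa using ((hasDerivAt_id x).const_mul σ).hasDerivWithinAt)
    (fun x _ y _ hxy => by simpa [hσ.ne'] using hxy) f
  have him : (fun u : ℝ => σ * u) '' Ioi 0 = Ioi 0 := by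
    rw [image_mul_left_Ioi hσ, mul_zero]
  rw [him] at h
  rw [h, lintegral_const_mul' _ _ (by simp), abs_of_pos hσ]

lemma lintegral_Ioo_zero_eq_mul {L : ℝ} (hL : 0 < L) (f : ℝ → ℝ≥0∞) :
    ∫⁻ w in Ioo 0 L, f w = ENNReal.ofReal L * ∫⁻ u in Ioo 0 1, f (u * L) := by
  rw [setLIntegral_congr (s := Ioo (0 : ℝ) 1) Ioo_ae_eq_Icc, ← lintegral_Ioo_eq_lintegral_Icc_mul hL,
    ← mul_assoc, ← ENNReal.ofReal_mul hL.le, mul_one_div_cancel hL.ne']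
  simp

lemma lintegral_indicator_lt (m : ℝ≥0∞) :
    ∫⁻ a in Ioi (0 : ℝ), (if ENNReal.ofReal a < m then 1 else 0 : ℝ≥0∞) = m := by
  have hset : MeasurableSet {a : ℝ | ENNReal.ofReal a < m} :=
    measurableSet_lt ENNReal.measurable_ofReal measurable_const
  have h1 : ∀ a : ℝ, (if ENNReal.ofReal a < m then 1 else 0 : ℝ≥0∞)
      = {a : ℝ | ENNReal.ofReal a < m}.indicator 1 a := fun a => by
    simp [indicator]
  simp_rw [h1]
  rw [lintegral_indicator_one hset, Measure.restrict_apply hset]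
  rcases eq_or_ne m ∞ with rfl | hm
  · simp
  · have : {a : ℝ | ENNReal.ofReal a < m} ∩ Ioi 0 = Ioo 0 m.toReal := by
      ext a
      simp only [mem_inter_iff, mem_ofPred_eq, mem_Ioi, mem_Ioo]
      constructor
      · rintro ⟨h1, h2⟩
        exact ⟨h2, (ENNReal.ofReal_lt_iff_lt_toReal h2.le hm).1 h1⟩
      · rintro ⟨h1, h2⟩
        exact ⟨(ENNReal.ofReal_lt_iff_lt_toReal h1.le hm).2 h2, h1⟩
    rw [this, Real.volume_Ioo, sub_zero, ENNReal.ofReal_toReal hm]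

lemma sq_lintegral_Ioo {f : ℝ → ℝ≥0∞} (hf : Measurable f) :
    (∫⁻ x in Ioo 0 1, f x) ^ 2 = 2 * ∫⁻ y in Ioo 0 1, ∫⁻ x in Ioo 0 y, f x * f y := by
  have hm : ∀ p : ℝ × ℝ → Prop, MeasurableSet {q | p q} →
      Measurable fun q : ℝ × ℝ => {q | p q}.indicator (fun q => f q.2 * f q.1) q := fun p hp =>
    ((hf.comp measurable_snd).mul (hf.comp measurable_fst)).indicator hp
  have e1 : ∀ y ∈ Ioo (0 : ℝ) 1, ∫⁻ x in Ioo 0 1, f x * f y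
      = (∫⁻ x in Ioo 0 y, f x * f y) + ∫⁻ x in Ioo y 1, f x * f y := by
    intro y hy
    rw [← lintegral_union measurableSet_Ioo]
    · refine (setLIntegral_congr ?_).symm
      have : Ioo (0 : ℝ) 1 = Ioo 0 y ∪ Ioo y 1 ∪ {y} := by
        ext x
        simp only [mem_union, mem_Ioo, mem_singleton_iff]
        constructor
        · rintro ⟨h1, h2⟩
          rcases lt_trichotomy x y with h | h | h
          · exact Or.inl (Or.inl ⟨h1, h⟩)
          · exact Or.inr h
          · exact Or.inl (Or.inr ⟨h, h2⟩)
        · rintro ((h | h) | h) <;> constructor <;> linarith [h, hy.1, hy.2]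
      rw [this]
      exact (union_ae_eq_left_of_ae_eq_empty (ae_eq_empty.2 (by simp))).symm
    · rw [Set.disjoint_left]
      intro w h1 h2
      exact absurd h1.2 (not_lt.2 h2.1.le)
  have ind1 : ∀ y ∈ Ioo (0 : ℝ) 1, ∫⁻ x in Ioo 0 y, f x * f y
      = ∫⁻ x in Ioo 0 1, {q : ℝ × ℝ | q.2 < q.1}.indicator (fun q => f q.2 * f q.1) (y, x) := by
    intro y hy
    rw [← lintegral_indicator measurableSet_Ioo, ← lintegral_indicator measurableSet_Ioo]
    refine lintegral_congr fun x => ?_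
    simp only [indicator, mem_Ioo, mem_ofPred_eq]
    by_cases h0 : 0 < x <;> by_cases h1 : x < y <;> simp [h0, h1]
    intro h; linarith [hy.2]
  have ind2 : ∀ y ∈ Ioo (0 : ℝ) 1, ∫⁻ x in Ioo y 1, f x * f y
      = ∫⁻ x in Ioo 0 1, {q : ℝ × ℝ | q.1 < q.2}.indicator (fun q => f q.2 * f q.1) (y, x) := by
    intro y hy
    rw [← lintegral_indicator measurableSet_Ioo, ← lintegral_indicator measurableSet_Ioo]
    refine lintegral_congr fun x => ?_
    simp only [indicator, mem_Ioo, mem_ofPred_eq]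
    by_cases h0 : x < 1 <;> by_cases h1 : y < x <;> simp [h0, h1]
    intro h; linarith [hy.1]
  have m1 := hm (fun q => q.2 < q.1) (measurableSet_lt measurable_snd measurable_fst)
  have m2 := hm (fun q => q.1 < q.2) (measurableSet_lt measurable_fst measurable_snd)
  have hsymm : ∫⁻ y in Ioo (0 : ℝ) 1, ∫⁻ x in Ioo y 1, f x * f y
      = ∫⁻ y in Ioo (0 : ℝ) 1, ∫⁻ x in Ioo 0 y, f x * f y := by
    rw [setLIntegral_congr_fun measurableSet_Ioo ind1, setLIntegral_congr_fun measurableSet_Ioo ind2,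
      lintegral_lintegral_swap (f := fun y x =>
        {q : ℝ × ℝ | q.1 < q.2}.indicator (fun q => f q.2 * f q.1) (y, x)) m2.aemeasurable]
    refine lintegral_congr fun x => lintegral_congr fun y => ?_
    simp only [indicator, mem_ofPred_eq, mul_comm]
  have h1m : Measurable fun y => ∫⁻ x in Ioo (0 : ℝ) 1,
      {q : ℝ × ℝ | q.2 < q.1}.indicator (fun q => f q.2 * f q.1) (y, x) :=
    m1.lintegral_prod_right'
  calc (∫⁻ x in Ioo 0 1, f x) ^ 2 = ∫⁻ y in Ioo 0 1, ∫⁻ x in Ioo 0 1, f x * f y := by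
        simp_rw [lintegral_mul_const _ hf]
        rw [lintegral_const_mul _ hf, sq]
    _ = ∫⁻ y in Ioo 0 1, ((∫⁻ x in Ioo 0 y, f x * f y) + ∫⁻ x in Ioo y 1, f x * f y) :=
        setLIntegral_congr_fun measurableSet_Ioo e1
    _ = (∫⁻ y in Ioo 0 1, ∫⁻ x in Ioo 0 y, f x * f y)
          + ∫⁻ y in Ioo 0 1, ∫⁻ x in Ioo y 1, f x * f y := by
        rw [setLIntegral_congr_fun (g := fun y => (∫⁻ x in Ioo (0 : ℝ) 1,
          {q : ℝ × ℝ | q.2 < q.1}.indicator (fun q => f q.2 * f q.1) (y, x))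
            + ∫⁻ x in Ioo y 1, f x * f y) measurableSet_Ioo, lintegral_add_left h1m,
          ← setLIntegral_congr_fun measurableSet_Ioo ind1]
        intro y hy
        simp only [ind1 y hy]
    _ = _ := by rw [hsymm, two_mul]

variable {Ω : Type*} [MeasurableSpace Ω] {Q : Measure Ω} {U E : ℕ → Ω → ℝ} {k : ℕ}

lemma ofReal_lt_rootFun_iff (hk : k ≠ 0) {a z : ℝ} (ha : 0 ≤ a) (hz : 0 ≤ z) :
    ENNReal.ofReal a < rootFun k (ENNReal.ofReal z) ↔ a ^ k / k.factorial < z := by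
  have hk0 : (0 : ℝ) < k := by positivity
  rw [rootFun_ofReal k hz, ENNReal.ofReal_lt_ofReal_iff_of_nonneg ha, one_div,
    Real.lt_rpow_inv_iff_of_pos ha (by positivity) hk0, Real.rpow_natCast,
    div_lt_iff₀' (by positivity)]

/-- The tail of the joint law of the minima at two points. -/
lemma IsChain.measure_lt_lt (h : IsChain U E Q) [IsProbabilityMeasure Q] (hk : k ≠ 0) {x y : ℝ}
    (hx : 0 < x) (hxy : x < y) (hy : y < 1) {a b : ℝ} (ha : 0 ≤ a) (hb : 0 ≤ b) :
    ∫⁻ ω, (if ENNReal.ofReal a < rootFun k (chainMin U E x ω) then 1 else 0)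
        * (if ENNReal.ofReal b < rootFun k (chainMin U E y ω) then 1 else 0) ∂Q
      = ENNReal.ofReal (Real.exp (-(x * ((max a b) ^ k / k.factorial)
          + (y - x) * (b ^ k / k.factorial)))) := by
  have hyx : 0 < y - x := sub_pos.2 hxy
  have := isProbabilityMeasure_expMeasure hx
  have := isProbabilityMeasure_expMeasure hyx
  have hm : ∀ c : ℝ, Measurable fun u : ℝ≥0∞ =>
      (if ENNReal.ofReal c < rootFun k u then 1 else 0 : ℝ≥0∞) := fun c =>
    Measurable.ite (measurableSet_lt measurable_const (measurable_rootFun k)) measurable_const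
      measurable_const
  rw [h.lintegral_comp_chainMin₂ hx hxy hy (g := fun q =>
    (if ENNReal.ofReal a < rootFun k q.1 then 1 else 0)
      * (if ENNReal.ofReal b < rootFun k q.2 then 1 else 0))
    (((hm a).comp measurable_fst).mul ((hm b).comp measurable_snd))]
  -- With the minima `z` and `min z w`, the two conditions on `z` merge into one threshold at `max a
  -- b`, while `w` only has to exceed the threshold of `b`.
  have key : ∀ᵐ z ∂expMeasure x, ∫⁻ w, (if ENNReal.ofReal a < rootFun k (ENNReal.ofReal z)
        then 1 else 0) * (if ENNReal.ofReal b < rootFun k (ENNReal.ofReal (min z w)) then 1 else 0)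
        ∂expMeasure (y - x)
      = (Ioi ((max a b) ^ k / k.factorial)).indicator
          (fun _ => ENNReal.ofReal (Real.exp (-((y - x) * (b ^ k / k.factorial))))) z := by
    filter_upwards [ae_expMeasure_pos hx] with z hz
    have hmax : (max a b) ^ k / k.factorial < z ↔
        a ^ k / k.factorial < z ∧ b ^ k / k.factorial < z := by
      rcases le_total a b with hab | hab
      · rw [max_eq_right hab]
        refine ⟨fun h => ⟨lt_of_le_of_lt ?_ h, h⟩, fun h => h.2⟩
        gcongr
      · rw [max_eq_left hab]
        refine ⟨fun h => ⟨h, lt_of_le_of_lt ?_ h⟩, fun h => h.1⟩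
        gcongr
    have e1 : ∀ᵐ w ∂expMeasure (y - x), (if ENNReal.ofReal a < rootFun k (ENNReal.ofReal z)
          then 1 else 0) * (if ENNReal.ofReal b < rootFun k (ENNReal.ofReal (min z w)) then 1 else 0)
        = (if (max a b) ^ k / k.factorial < z then 1 else 0 : ℝ≥0∞)
          * (Ioi (b ^ k / k.factorial)).indicator 1 w := by
      filter_upwards [ae_expMeasure_pos hyx] with w hw
      simp only [ofReal_lt_rootFun_iff hk ha hz.le,
        ofReal_lt_rootFun_iff hk hb (le_min hz.le hw.le), lt_min_iff, hmax, indicator, mem_Ioi,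
        Pi.one_apply]
      by_cases h1 : a ^ k / k.factorial < z <;> by_cases h2 : b ^ k / k.factorial < z <;>
        by_cases h3 : b ^ k / k.factorial < w <;> simp [h1, h2, h3]
    rw [lintegral_congr_ae e1, lintegral_const_mul _ (measurable_one.indicator measurableSet_Ioi),
      lintegral_indicator_one measurableSet_Ioi, expMeasure_Ioi hyx (by positivity)]
    simp only [indicator, mem_Ioi]
    split_ifs <;> simp
  rw [lintegral_congr_ae key, lintegral_indicator_const measurableSet_Ioi,
    expMeasure_Ioi hx (by positivity), ← ENNReal.ofReal_mul (by positivity), ← Real.exp_add]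
  ring_nf

lemma lintegral_mul_eq_layercake [SFinite Q] {M N : Ω → ℝ≥0∞} (hM : Measurable M)
    (hN : Measurable N) :
    ∫⁻ ω, M ω * N ω ∂Q = ∫⁻ a in Ioi (0 : ℝ), ∫⁻ b in Ioi (0 : ℝ),
      (∫⁻ ω, (if ENNReal.ofReal a < M ω then 1 else 0)
        * (if ENNReal.ofReal b < N ω then 1 else 0) ∂Q) := by
  have hi : ∀ {M : Ω → ℝ≥0∞}, Measurable M → Measurable fun q : Ω × ℝ =>
      (if ENNReal.ofReal q.2 < M q.1 then 1 else 0 : ℝ≥0∞) := fun hM =>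
    Measurable.ite (measurableSet_lt (ENNReal.measurable_ofReal.comp measurable_snd)
      (hM.comp measurable_fst)) measurable_const measurable_const
  have hi' : ∀ m : ℝ≥0∞, Measurable fun a : ℝ =>
      (if ENNReal.ofReal a < m then 1 else 0 : ℝ≥0∞) := fun m =>
    Measurable.ite (measurableSet_lt ENNReal.measurable_ofReal measurable_const)
      measurable_const measurable_const
  have e1 : ∀ ω, M ω * N ω = ∫⁻ a in Ioi (0 : ℝ), ∫⁻ b in Ioi (0 : ℝ),
        (if ENNReal.ofReal a < M ω then 1 else 0) * (if ENNReal.ofReal b < N ω then 1 else 0) := by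
    intro ω
    simp_rw [lintegral_const_mul _ (hi' (N ω)), lintegral_indicator_lt]
    rw [lintegral_mul_const _ (hi' (M ω)), lintegral_indicator_lt]
  have m3 : Measurable fun q : (Ω × ℝ) × ℝ =>
      (if ENNReal.ofReal q.1.2 < M q.1.1 then 1 else 0 : ℝ≥0∞)
        * (if ENNReal.ofReal q.2 < N q.1.1 then 1 else 0) :=
    ((hi hM).comp measurable_fst).mul ((hi hN).comp
      (by fun_prop : Measurable fun q : (Ω × ℝ) × ℝ => (q.1.1, q.2)))
  rw [lintegral_congr e1, lintegral_lintegral_swap m3.lintegral_prod_right'.aemeasurable]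
  refine lintegral_congr fun a => ?_
  exact lintegral_lintegral_swap
    (m3.comp (by fun_prop : Measurable fun q : Ω × ℝ => ((q.1, a), q.2))).aemeasurable

lemma IsChain.lintegral_mul_rootFun (h : IsChain U E Q) [IsProbabilityMeasure Q] (hk : k ≠ 0)
    {x y : ℝ} (hx : 0 < x) (hxy : x < y) (hy : y < 1) :
    ∫⁻ ω, rootFun k (chainMin U E x ω) * rootFun k (chainMin U E y ω) ∂Q
      = ∫⁻ a in Ioi (0 : ℝ), ∫⁻ b in Ioi (0 : ℝ),
        ENNReal.ofReal (Real.exp (-(x * ((max a b) ^ k / k.factorial)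
          + (y - x) * (b ^ k / k.factorial)))) := by
  have hM : ∀ x, Measurable fun ω => rootFun k (chainMin U E x ω) := fun x =>
    (measurable_rootFun k).comp (measurable_chainMin h.measurable_U h.measurable_E x)
  rw [lintegral_mul_eq_layercake (hM x) (hM y)]
  exact setLIntegral_congr_fun measurableSet_Ioi fun a ha =>
    setLIntegral_congr_fun measurableSet_Ioi fun b hb =>
      h.measure_lt_lt hk hx hxy hy (le_of_lt ha) (le_of_lt hb)

/-- The integral that remains of the second moment once all scales are integrated out. -/
def secondMomentIntegral (k : ℕ) : ℝ≥0∞ :=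
  ∫⁻ s in Ioo (0 : ℝ) 1, ∫⁻ t in Ioo (0 : ℝ) 1,
    ENNReal.ofReal ((t + (1 - t) * s ^ k) ^ (-(2 / (k : ℝ))))

lemma lintegral_mul_exp_neg_mul_pow (hk : 0 < k) {c : ℝ} (hc : 0 < c) :
    ∫⁻ a in Ioi (0 : ℝ), ENNReal.ofReal (a * Real.exp (-(c * a ^ k)))
      = ENNReal.ofReal (Real.Gamma (2 / k) / k * c ^ (-(2 / (k : ℝ)))) := by
  have hk' : (0 : ℝ) < k := by exact_mod_cast hk
  have h := integral_rpow_mul_exp_neg_mul_rpow hk' (q := 1) (by norm_num) hc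
  have hval : ∫ a in Ioi (0 : ℝ), a * Real.exp (-(c * a ^ k))
      = Real.Gamma (2 / k) / k * c ^ (-(2 / (k : ℝ))) := by
    have e : ∀ a : ℝ, a * Real.exp (-(c * a ^ k)) = a ^ (1 : ℝ) * Real.exp (-c * a ^ (k : ℝ)) := by
      intro a; rw [Real.rpow_one, Real.rpow_natCast, neg_mul]
    simp_rw [e]
    rw [h]
    norm_num
    rw [neg_div]
    ring
  have hpos : 0 < Real.Gamma (2 / k) / k * c ^ (-(2 / (k : ℝ))) := by
    have := Real.Gamma_pos_of_pos (s := 2 / (k : ℝ)) (by positivity)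
    positivity
  rw [← hval, ofReal_integral_eq_lintegral_ofReal]
  · by_contra hni
    rw [integral_undef hni] at hval
    linarith
  · refine (ae_restrict_iff' measurableSet_Ioi).2 (ae_of_all _ fun a ha => ?_)
    have : 0 < a := ha
    simp only [Pi.zero_apply]
    positivity

/-- Split at `b = a`. For `b > a` the integrand is `exp (-b ^ k)`, and integrating over `a < b`
gives the summand `1`. For `b < a` put `b = s a` and integrate out `a`. -/
lemma lintegral_triangle_eq (hk : 0 < k) {t : ℝ} (ht : t ∈ Ioo (0 : ℝ) 1) :
    ∫⁻ a in Ioi (0 : ℝ), ∫⁻ b in Ioi (0 : ℝ),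
        ENNReal.ofReal (Real.exp (-(t * (max a b) ^ k + (1 - t) * b ^ k)))
      = ENNReal.ofReal (Real.Gamma (2 / k) / k) * (1 + ∫⁻ s in Ioo (0 : ℝ) 1,
          ENNReal.ofReal ((t + (1 - t) * s ^ k) ^ (-(2 / (k : ℝ))))) := by
  have hk' : (0 : ℝ) < k := by exact_mod_cast hk
  have hG := Real.Gamma_pos_of_pos (s := 2 / (k : ℝ)) (by positivity)
  have split : ∀ a ∈ Ioi (0 : ℝ), ∫⁻ b in Ioi (0 : ℝ),
        ENNReal.ofReal (Real.exp (-(t * (max a b) ^ k + (1 - t) * b ^ k)))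
      = (∫⁻ s in Ioo (0 : ℝ) 1, ENNReal.ofReal
          (a * Real.exp (-((t + (1 - t) * s ^ k) * a ^ k))))
        + ∫⁻ b in Ioi (0 : ℝ), (Ioi a).indicator
          (fun b => ENNReal.ofReal (Real.exp (-(b ^ k)))) b := by
    intro a ha
    have ha' : 0 < a := ha
    rw [← Ioc_union_Ioi_eq_Ioi ha'.le, lintegral_union measurableSet_Ioi (by
      rw [Set.disjoint_left]; intro w h1 h2; exact absurd h1.2 (not_le.2 h2))]
    congr 1
    · rw [setLIntegral_congr Ioo_ae_eq_Ioc.symm, lintegral_Ioo_zero_eq_mul ha',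
        ← lintegral_const_mul' _ _ ENNReal.ofReal_ne_top]
      refine setLIntegral_congr_fun measurableSet_Ioo fun s hs => ?_
      rw [← ENNReal.ofReal_mul ha'.le, max_eq_left (by nlinarith [hs.2])]
      ring_nf
    · rw [Ioc_union_Ioi_eq_Ioi ha'.le, ← lintegral_indicator measurableSet_Ioi,
        ← lintegral_indicator measurableSet_Ioi]
      refine lintegral_congr fun b => ?_
      simp only [indicator, mem_Ioi]
      by_cases hb : a < b
      · simp only [hb, ha'.trans hb, if_true]
        rw [max_eq_right hb.le]
        ring_nf
      · simp [hb]
  have hm1 : Measurable fun q : ℝ × ℝ => ENNReal.ofReal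
      (q.1 * Real.exp (-((t + (1 - t) * q.2 ^ k) * q.1 ^ k))) := by fun_prop
  have hm2 : Measurable fun q : ℝ × ℝ => (Ioi q.1).indicator
      (fun b => ENNReal.ofReal (Real.exp (-(b ^ k)))) q.2 := by
    have : (fun q : ℝ × ℝ => (Ioi q.1).indicator
        (fun b => ENNReal.ofReal (Real.exp (-(b ^ k)))) q.2)
        = {q : ℝ × ℝ | q.1 < q.2}.indicator
          (fun q => ENNReal.ofReal (Real.exp (-(q.2 ^ k)))) := by
      ext q; simp [indicator]
    rw [this]
    exact (by fun_prop : Measurable fun q : ℝ × ℝ =>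
      ENNReal.ofReal (Real.exp (-(q.2 ^ k)))).indicator
        (measurableSet_lt measurable_fst measurable_snd)
  rw [setLIntegral_congr_fun measurableSet_Ioi split, lintegral_add_left hm1.lintegral_prod_right',
    lintegral_lintegral_swap hm1.aemeasurable,
    lintegral_lintegral_swap (f := fun a b => (Ioi a).indicator
      (fun b => ENNReal.ofReal (Real.exp (-(b ^ k)))) b) hm2.aemeasurable, mul_add, mul_one, add_comm]
  congr 1
  · have := lintegral_mul_exp_neg_mul_pow hk one_pos
    rw [Real.one_rpow, mul_one] at this
    rw [← this]
    refine setLIntegral_congr_fun measurableSet_Ioi fun b hb => ?_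
    have hb' : 0 < b := hb
    have e : ∀ a : ℝ, (Ioi a).indicator (fun b => ENNReal.ofReal (Real.exp (-(b ^ k)))) b
        = (Iio b).indicator (fun _ => ENNReal.ofReal (Real.exp (-(b ^ k)))) a := fun a => by
      simp [indicator]
    simp_rw [e]
    rw [lintegral_indicator_const measurableSet_Iio, Measure.restrict_apply measurableSet_Iio,
      Iio_inter_Ioi, Real.volume_Ioo, sub_zero, ← ENNReal.ofReal_mul (by positivity), one_mul,
      mul_comm]
  · rw [← lintegral_const_mul' _ _ ENNReal.ofReal_ne_top]
    refine setLIntegral_congr_fun measurableSet_Ioo fun s hs => ?_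
    have hc : 0 < t + (1 - t) * s ^ k := by
      have : 0 ≤ (1 - t) * s ^ k := mul_nonneg (by linarith [ht.2]) (pow_nonneg hs.1.le _)
      linarith [ht.1]
    simp only
    rw [lintegral_mul_exp_neg_mul_pow hk hc, ENNReal.ofReal_mul (by positivity)]

/-- By symmetry it suffices to take `x < y`, with factor `2`. The substitutions `x = t y` and `a, b
↦ σ a, σ b` remove `y` from the inner integrals and leave the weight `y ^ (1 - 2/k)`, whose integral
over `(0, 1)` is `k / (2 (k - 1))`. -/
lemma IsChain.lintegral_pathIntegral_sq (h : IsChain U E Q) [IsProbabilityMeasure Q]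
    (hk : 2 ≤ k) :
    ∫⁻ ω, pathIntegral k U E ω ^ 2 ∂Q
      = ENNReal.ofReal (Real.Gamma (2 / k) * (k.factorial : ℝ) ^ (2 / (k : ℝ)) / (k - 1))
        * (1 + secondMomentIntegral k) := by
  have hk0 : 0 < k := by lia
  have hk' : (2 : ℝ) ≤ k := by exact_mod_cast hk
  have hG := Real.Gamma_pos_of_pos (s := 2 / (k : ℝ)) (by positivity)
  have hM : Measurable fun q : ℝ × Ω => rootFun k (chainMin U E q.1 q.2) :=
    (measurable_rootFun k).comp (measurable_chainMin_prod h.measurable_U h.measurable_E)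
  have hM' : ∀ ω, Measurable fun x => rootFun k (chainMin U E x ω) := fun ω =>
    hM.comp measurable_prodMk_right
  have e1 : ∀ ω, pathIntegral k U E ω ^ 2 = 2 * ∫⁻ y in Ioo 0 1, ∫⁻ x in Ioo 0 y,
      rootFun k (chainMin U E x ω) * rootFun k (chainMin U E y ω) := fun ω =>
    sq_lintegral_Ioo (hM' ω)
  simp_rw [e1]
  have hm3 : Measurable fun q : (Ω × ℝ) × ℝ => {q : (Ω × ℝ) × ℝ | q.2 ∈ Ioo 0 q.1.2}.indicator
      (fun q => rootFun k (chainMin U E q.2 q.1.1) * rootFun k (chainMin U E q.1.2 q.1.1)) q := by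
    refine Measurable.indicator ?_ ?_
    · exact (hM.comp (by fun_prop : Measurable fun q : (Ω × ℝ) × ℝ => (q.2, q.1.1))).mul
        (hM.comp (by fun_prop : Measurable fun q : (Ω × ℝ) × ℝ => (q.1.2, q.1.1)))
    · exact (measurableSet_lt measurable_const measurable_snd).inter
        (measurableSet_lt measurable_snd (by fun_prop))
  have e2 : ∀ ω y, ∫⁻ x in Ioo 0 y, rootFun k (chainMin U E x ω) * rootFun k (chainMin U E y ω)
      = ∫⁻ x, {q : (Ω × ℝ) × ℝ | q.2 ∈ Ioo 0 q.1.2}.indicator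
      (fun q => rootFun k (chainMin U E q.2 q.1.1) * rootFun k (chainMin U E q.1.2 q.1.1))
        ((ω, y), x) := by
    intro ω y
    rw [← lintegral_indicator measurableSet_Ioo]
    rfl
  have hm4 : Measurable fun q : Ω × ℝ => ∫⁻ x in Ioo 0 q.2,
      rootFun k (chainMin U E x q.1) * rootFun k (chainMin U E q.2 q.1) := by
    simp_rw [e2]
    exact hm3.lintegral_prod_right'
  rw [lintegral_const_mul' _ _ (by simp), lintegral_lintegral_swap (f := fun ω y =>
    ∫⁻ x in Ioo 0 y, rootFun k (chainMin U E x ω) * rootFun k (chainMin U E y ω))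
      hm4.aemeasurable]
  set c := ENNReal.ofReal (Real.Gamma (2 / k) / k)
  have e3 : ∀ y ∈ Ioo (0 : ℝ) 1, ∫⁻ ω, (∫⁻ x in Ioo 0 y,
        rootFun k (chainMin U E x ω) * rootFun k (chainMin U E y ω)) ∂Q
      = ENNReal.ofReal ((k.factorial : ℝ) ^ (2 / (k : ℝ)))
        * (c * (1 + secondMomentIntegral k)) * ENNReal.ofReal (y ^ (-(2 / (k : ℝ) - 1))) := by
    intro y hy
    have hy0 := hy.1
    -- Chosen with `σ ^ k = k! / y`, which cancels both `k!` and `y` in the exponent.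
    set σ : ℝ := (k.factorial / y) ^ (1 / (k : ℝ)) with hσ_def
    have hσ : 0 < σ := by positivity
    have hσk : σ ^ k = k.factorial / y := by
      rw [hσ_def, one_div, Real.rpow_inv_natCast_pow (by positivity) hk0.ne']
    rw [lintegral_lintegral_swap (f := fun ω x =>
      rootFun k (chainMin U E x ω) * rootFun k (chainMin U E y ω)) (by
        exact ((hM.comp measurable_swap).mul ((hM.comp measurable_prodMk_left).comp
          measurable_fst)).aemeasurable)]
    rw [setLIntegral_congr_fun measurableSet_Ioo fun x hx =>
      h.lintegral_mul_rootFun hk0.ne' hx.1 hx.2 hy.2, lintegral_Ioo_zero_eq_mul hy0]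
    have e4 : ∀ t ∈ Ioo (0 : ℝ) 1, ∫⁻ a in Ioi (0 : ℝ), ∫⁻ b in Ioi (0 : ℝ),
        ENNReal.ofReal (Real.exp (-(t * y * ((max a b) ^ k / k.factorial)
          + (y - t * y) * (b ^ k / k.factorial))))
        = ENNReal.ofReal (σ ^ 2) * (c * (1 + ∫⁻ s in Ioo (0 : ℝ) 1,
          ENNReal.ofReal ((t + (1 - t) * s ^ k) ^ (-(2 / (k : ℝ)))))) := by
      intro t ht
      rw [← lintegral_triangle_eq hk0 ht, lintegral_Ioi_zero_eq_mul hσ, sq,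
        ENNReal.ofReal_mul hσ.le, mul_assoc]
      congr 1
      rw [← lintegral_const_mul' _ _ ENNReal.ofReal_ne_top]
      refine lintegral_congr fun a => ?_
      rw [lintegral_Ioi_zero_eq_mul hσ]
      congr 1
      refine lintegral_congr fun b => ?_
      congr 3
      have hmax : max (σ * a) (σ * b) = σ * max a b := (mul_max_of_nonneg _ _ hσ.le).symm
      rw [hmax, mul_pow, mul_pow, hσk]
      field_simp
    have hDm : Measurable fun q : ℝ × ℝ =>
        ENNReal.ofReal ((q.1 + (1 - q.1) * q.2 ^ k) ^ (-(2 / (k : ℝ)))) := by fun_prop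
    rw [setLIntegral_congr_fun measurableSet_Ioo e4, lintegral_const_mul' _ _ ENNReal.ofReal_ne_top,
      lintegral_const_mul' _ _ ENNReal.ofReal_ne_top, lintegral_add_left measurable_const,
      lintegral_lintegral_swap hDm.aemeasurable]
    have hone : ∫⁻ _ in Ioo (0 : ℝ) 1, (1 : ℝ≥0∞) = 1 := by simp
    rw [hone]
    change _ * (_ * (c * (1 + secondMomentIntegral k))) = _
    have hσ2 : σ ^ 2 = (k.factorial : ℝ) ^ (2 / (k : ℝ)) * y ^ (-(2 / (k : ℝ))) := by
      rw [hσ_def, ← Real.rpow_natCast, ← Real.rpow_mul (by positivity),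
        Real.div_rpow (by positivity) hy0.le, Real.rpow_neg hy0.le]
      push_cast
      rw [show 1 / (k : ℝ) * 2 = 2 / k by ring]
      field_simp
    rw [hσ2, show -(2 / (k : ℝ) - 1) = -(2 / k) + 1 by ring, Real.rpow_add hy0, Real.rpow_one,
      ENNReal.ofReal_mul (by positivity), ENNReal.ofReal_mul (by positivity)]
    ring
  have h2k : 2 / (k : ℝ) - 1 < 1 := by
    have : 2 / (k : ℝ) ≤ 1 := (div_le_one (by linarith)).2 hk'
    linarith
  rw [setLIntegral_congr_fun measurableSet_Ioo e3, lintegral_const_mul _ (by fun_prop),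
    lintegral_Ioo_rpow_neg h2k]
  have h1k : (k : ℝ) - 1 ≠ 0 := by linarith
  have hfin : ENNReal.ofReal (Real.Gamma (2 / k) * (k.factorial : ℝ) ^ (2 / (k : ℝ)) / (k - 1))
      = 2 * ENNReal.ofReal ((k.factorial : ℝ) ^ (2 / (k : ℝ))) * c
        * ENNReal.ofReal (1 / (1 - (2 / (k : ℝ) - 1))) := by
    have h3 : (0 : ℝ) < 1 - (2 / (k : ℝ) - 1) := by linarith
    rw [← ENNReal.ofReal_ofNat 2, ← ENNReal.ofReal_mul (by positivity),
      ← ENNReal.ofReal_mul (by positivity), ← ENNReal.ofReal_mul (by positivity)]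
    congr 1
    have h4 : 1 - (2 / (k : ℝ) - 1) = 2 * (k - 1) / k := by field_simp; ring
    rw [h4]
    field_simp
  rw [hfin]
  ring

end SecondMoment

/-! ### Evaluation of the integral in the second moment -/

section SecondMomentValue

open Set
open scoped ENNReal

/-- For a nonnegative derivative integrability is automatic, and at the endpoints mere continuity of
`F` is enough, as needed for integrands with a logarithm. -/
lemma lintegral_Ioo_deriv {F f : ℝ → ℝ} {a b : ℝ} (hab : a ≤ b) (hF : ContinuousOn F (Icc a b))
    (hd : ∀ x ∈ Ioo a b, HasDerivAt F (f x) x) (hf : ∀ x ∈ Ioo a b, 0 ≤ f x) :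
    ∫⁻ x in Ioo a b, ENNReal.ofReal (f x) = ENNReal.ofReal (F b - F a) := by
  have hint := intervalIntegral.integrableOn_deriv_of_nonneg hF hd hf
  have h := intervalIntegral.integral_eq_sub_of_hasDerivAt_of_le hab hF hd
    ((intervalIntegrable_iff_integrableOn_Ioc_of_le hab).2 hint)
  rw [← h, intervalIntegral.integral_of_le hab, integral_Ioc_eq_integral_Ioo,
    ofReal_integral_eq_lintegral_ofReal (hint.mono_set Ioo_subset_Ioc_self)]
  exact (ae_restrict_iff' measurableSet_Ioo).2 (ae_of_all _ hf)

lemma tsum_ofReal_pow_mul {q c : ℝ} (hq0 : 0 ≤ q) (hq1 : q < 1) (hc : 0 ≤ c) :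
    ∑' j : ℕ, ENNReal.ofReal (c * q ^ j) = ENNReal.ofReal (c / (1 - q)) := by
  have h := (hasSum_geometric_of_lt_one hq0 hq1).mul_left c
  rw [← ENNReal.ofReal_tsum_of_nonneg (fun j => by positivity) h.summable, h.tsum_eq, div_eq_mul_inv]

lemma lintegral_Ioo_affine_inv {c : ℝ} (hc : c ∈ Ioo (0 : ℝ) 1) :
    ∫⁻ t in Ioo (0 : ℝ) 1, ENNReal.ofReal ((t + (1 - t) * c) ^ (-1 : ℝ))
      = ENNReal.ofReal (-Real.log c / (1 - c)) := by
  have hc1 : 0 < 1 - c := by linarith [hc.2]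
  have hpos : ∀ t ∈ Icc (0 : ℝ) 1, 0 < t + (1 - t) * c := fun t ht => by
    nlinarith [ht.1, ht.2, hc.1, mul_nonneg ht.1 hc1.le]
  rw [lintegral_Ioo_deriv (F := fun t => Real.log (t + (1 - t) * c) / (1 - c)) zero_le_one]
  · simp [neg_div]
  · exact (ContinuousOn.log (by fun_prop) fun t ht => (hpos t ht).ne').div_const _
  · intro t ht
    have hp := hpos t (Ioo_subset_Icc_self ht)
    have h1 : HasDerivAt (fun t => t + (1 - t) * c) (1 - c) t := by
      have := (hasDerivAt_id t).add (((hasDerivAt_id t).const_sub 1).mul_const c)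
      convert! this using 1
      ring
    convert! (h1.log hp.ne').div_const (1 - c) using 1
    rw [Real.rpow_neg_one]
    field_simp
  · intro t ht
    exact Real.rpow_nonneg (hpos t (Ioo_subset_Icc_self ht)).le _

lemma lintegral_Ioo_affine_rpow {c β : ℝ} (hc : c ∈ Ioo (0 : ℝ) 1) (hβ : β < 1) :
    ∫⁻ t in Ioo (0 : ℝ) 1, ENNReal.ofReal ((t + (1 - t) * c) ^ (-β))
      = ENNReal.ofReal ((1 - c ^ (1 - β)) / ((1 - β) * (1 - c))) := by
  have hc1 : 0 < 1 - c := by linarith [hc.2]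
  have hb : 1 - β ≠ 0 := by linarith
  have hpos : ∀ t ∈ Icc (0 : ℝ) 1, 0 < t + (1 - t) * c := fun t ht => by
    nlinarith [ht.1, ht.2, hc.1, mul_nonneg ht.1 hc1.le]
  rw [lintegral_Ioo_deriv
    (F := fun t => (t + (1 - t) * c) ^ (1 - β) / ((1 - β) * (1 - c))) zero_le_one]
  · simp [sub_div]
  · exact (ContinuousOn.rpow_const (by fun_prop) fun t ht => Or.inl (hpos t ht).ne').div_const _
  · intro t ht
    have hp := hpos t (Ioo_subset_Icc_self ht)
    have h1 : HasDerivAt (fun t => t + (1 - t) * c) (1 - c) t := by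
      have := (hasDerivAt_id t).add (((hasDerivAt_id t).const_sub 1).mul_const c)
      convert! this using 1
      ring
    convert! (h1.rpow_const (p := 1 - β) (Or.inl hp.ne')).div_const ((1 - β) * (1 - c)) using 1
    rw [show 1 - β - 1 = -β by ring]
    field_simp
  · intro t ht
    exact Real.rpow_nonneg (hpos t (Ioo_subset_Icc_self ht)).le _

lemma lintegral_Ioo_neg_log_mul_pow (m : ℕ) :
    ∫⁻ s in Ioo (0 : ℝ) 1, ENNReal.ofReal (-Real.log s * s ^ m)
      = ENNReal.ofReal (1 / ((m : ℝ) + 1) ^ 2) := by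
  -- The logarithm is kept in the product `s * log s`, which is continuous at `0`.
  rw [lintegral_Ioo_deriv (F := fun s => -(s ^ m * (s * Real.log s)) / (m + 1)
    + s ^ (m + 1) / ((m : ℝ) + 1) ^ 2) zero_le_one]
  · simp
  · exact Continuous.continuousOn (by
      have := Real.continuous_mul_log
      fun_prop)
  · intro s hs
    have hs0 : s ≠ 0 := hs.1.ne'
    have h2 : HasDerivAt (fun s : ℝ => s ^ (m + 1)) (((m : ℝ) + 1) * s ^ m) s := by
      simpa using hasDerivAt_pow (m + 1) s
    have h1 : HasDerivAt (fun s : ℝ => s ^ m * (s * Real.log s))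
        (((m : ℝ) + 1) * s ^ m * Real.log s + s ^ (m + 1) * s⁻¹) s := by
      refine (h2.mul (Real.hasDerivAt_log hs0)).congr_of_eventuallyEq (Eventually.of_forall ?_)
      intro y; simp only [Pi.mul_apply]; ring
    convert! (h1.neg.div_const ((m : ℝ) + 1)).add (h2.div_const (((m : ℝ) + 1) ^ 2)) using 1
    have : (m : ℝ) + 1 ≠ 0 := by positivity
    field_simp
    ring
  · intro s hs
    exact mul_nonneg (neg_nonneg.2 (Real.log_nonpos hs.1.le hs.2.le)) (pow_nonneg hs.1.le _)

lemma hasSum_odd_of_hasSum_even {f : ℕ → ℝ} {a b : ℝ} (hf : HasSum f a)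
    (he : HasSum (fun n => f (2 * n)) b) : HasSum (fun n => f (2 * n + 1)) (a - b) := by
  have ho : Summable fun n => f (2 * n + 1) :=
    hf.summable.comp_injective (i := fun n : ℕ => 2 * n + 1) fun m n hmn => by
      simpa using hmn
  have h := (he.even_add_odd ho.hasSum).unique hf
  rw [← h, add_sub_cancel_left]
  exact ho.hasSum

lemma hasSum_one_div_odd_sq :
    HasSum (fun n : ℕ => 1 / (((2 * n : ℕ) : ℝ) + 1) ^ 2) (Real.pi ^ 2 / 8) := by
  have he : HasSum (fun n : ℕ => (1 : ℝ) / ((2 * n : ℕ) : ℝ) ^ 2) (1 / 4 * (Real.pi ^ 2 / 6)) := by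
    refine (hasSum_zeta_two.mul_left (1 / 4)).congr_fun fun n => ?_
    rw [Nat.cast_mul, mul_pow, one_div_mul_one_div]
    norm_num
  have h := hasSum_odd_of_hasSum_even hasSum_zeta_two he
  rw [show Real.pi ^ 2 / 6 - 1 / 4 * (Real.pi ^ 2 / 6) = Real.pi ^ 2 / 8 by ring] at h
  refine h.congr_fun fun n => ?_
  rw [Nat.cast_succ]

/-- The exponent `2/k` is `1`, so the `t`-integral is `-2 log s / (1 - s ^ 2)`. Its geometric
expansion integrates termwise to `2 ∑ 1 / (2j + 1)^2`. -/
lemma secondMomentIntegral_two : secondMomentIntegral 2 = ENNReal.ofReal (Real.pi ^ 2 / 4) := by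
  have e1 : ∀ s ∈ Ioo (0 : ℝ) 1, ∫⁻ t in Ioo (0 : ℝ) 1,
      ENNReal.ofReal ((t + (1 - t) * s ^ 2) ^ (-(2 / ((2 : ℕ) : ℝ))))
      = 2 * ∑' j : ℕ, ENNReal.ofReal (-Real.log s * s ^ (2 * j)) := by
    intro s hs
    have hs2 : s ^ 2 ∈ Ioo (0 : ℝ) 1 :=
      ⟨pow_pos hs.1 2, pow_lt_one₀ hs.1.le hs.2 two_ne_zero⟩
    have hl : 0 ≤ -Real.log s := neg_nonneg.2 (Real.log_nonpos hs.1.le hs.2.le)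
    have h2 : -(2 / ((2 : ℕ) : ℝ)) = -1 := by norm_num
    simp_rw [h2, pow_mul]
    rw [lintegral_Ioo_affine_inv hs2, tsum_ofReal_pow_mul hs2.1.le hs2.2 hl,
      ← ENNReal.ofReal_ofNat 2, ← ENNReal.ofReal_mul (by norm_num), Real.log_pow]
    congr 1
    push_cast
    ring
  rw [secondMomentIntegral, setLIntegral_congr_fun measurableSet_Ioo e1,
    lintegral_const_mul' _ _ (by simp), lintegral_tsum (fun j => by fun_prop)]
  simp_rw [lintegral_Ioo_neg_log_mul_pow]
  rw [← ENNReal.ofReal_tsum_of_nonneg (fun j => by positivity) hasSum_one_div_odd_sq.summable,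
    hasSum_one_div_odd_sq.tsum_eq, ← ENNReal.ofReal_ofNat 2, ← ENNReal.ofReal_mul (by norm_num)]
  congr 1
  ring

/-- Euler's partial fractions of the cotangent, regrouped: the positive poles are shifted by one
index, which absorbs `1/x` and leaves an error `1 / (N + x)`. -/
lemma tendsto_sum_one_div_sub {x : ℝ} (hx : x ∈ Ioo (0 : ℝ) 1) :
    Tendsto (fun N : ℕ => ∑ j ∈ Finset.range N, (1 / ((j : ℝ) + x) - 1 / ((j : ℝ) + 1 - x)))
      atTop (𝓝 (Real.pi * Real.cot (Real.pi * x))) := by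
  have hxc : (x : ℂ) ∈ Complex.integerComplement := by
    rintro ⟨n, hn⟩
    have h : (n : ℝ) = x := by exact_mod_cast hn
    rw [← h] at hx
    have h1 : 0 < n := by exact_mod_cast hx.1
    have h2 : n < 1 := by exact_mod_cast hx.2
    lia
  have hc := tendsto_logDeriv_euler_cot_sub hxc
  have hr : Tendsto (fun N : ℕ => ∑ j ∈ Finset.range N,
      (1 / (x - ((j : ℝ) + 1)) + 1 / (x + ((j : ℝ) + 1)))) atTop
      (𝓝 (Real.pi * Real.cot (Real.pi * x) - 1 / x)) := by
    refine (Complex.continuous_re.tendsto _).comp hc |>.congr' ?_ |>.trans (le_of_eq ?_)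
    · filter_upwards with N
      simp only [Function.comp_apply]
      rw [← Complex.ofReal_re (∑ j ∈ Finset.range N,
        (1 / (x - ((j : ℝ) + 1)) + 1 / (x + ((j : ℝ) + 1))))]
      push_cast
      rfl
    · congr 1
      rw [← Complex.ofReal_re (Real.pi * Real.cot (Real.pi * x) - 1 / x)]
      push_cast
      rfl
  have hz : Tendsto (fun N : ℕ => 1 / ((N : ℝ) + x)) atTop (𝓝 0) :=
    tendsto_const_nhds.div_atTop (tendsto_natCast_atTop_atTop.atTop_add tendsto_const_nhds)
  have h := (hr.add_const (1 / x)).sub hz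
  rw [sub_add_cancel, sub_zero] at h
  refine h.congr fun N => ?_
  induction N with
  | zero => simp
  | succ N ih =>
    rw [Finset.sum_range_succ, Finset.sum_range_succ, ← ih]
    have h1 : x - ((N : ℝ) + 1) = -((N : ℝ) + 1 - x) := by ring
    rw [h1, one_div_neg_eq_neg_one_div]
    push_cast
    rw [add_comm x]
    ring

/-- The case `x = 1/k`, divided by `k`; these are the integrals of `s ^ (k j) - s ^ (k j + k - 2)`.
-/
lemma hasSum_one_div_sub_one_div {k : ℕ} (hk : 2 ≤ k) :
    HasSum (fun j : ℕ => 1 / (((k * j : ℕ) : ℝ) + 1) - 1 / (((k * j + (k - 2) : ℕ) : ℝ) + 1))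
      (Real.pi * Real.cot (Real.pi / k) / k) := by
  have hk' : (2 : ℝ) ≤ k := by exact_mod_cast hk
  have hx : 1 / (k : ℝ) ∈ Ioo (0 : ℝ) 1 :=
    ⟨by positivity, (div_lt_one (by linarith)).2 (by linarith)⟩
  have h := (tendsto_sum_one_div_sub hx).div_const (k : ℝ)
  rw [mul_one_div] at h
  refine (hasSum_iff_tendsto_nat_of_nonneg (fun j => ?_) _).2 (h.congr fun N => ?_)
  · rw [sub_nonneg]
    gcongr
    lia
  · rw [Finset.sum_div]
    refine Finset.sum_congr rfl fun j _ => ?_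
    rw [sub_div, Nat.cast_add, Nat.cast_sub hk, Nat.cast_mul]
    congr 1
    · rw [div_div]
      congr 1
      field_simp
    · rw [div_div]
      congr 1
      field_simp
      push_cast
      ring

lemma lintegral_Ioo_pow_sub_pow {m n : ℕ} (hmn : m ≤ n) :
    ∫⁻ s in Ioo (0 : ℝ) 1, ENNReal.ofReal (s ^ m - s ^ n)
      = ENNReal.ofReal (1 / ((m : ℝ) + 1) - 1 / ((n : ℝ) + 1)) := by
  rw [lintegral_Ioo_deriv (F := fun s => s ^ (m + 1) / ((m : ℝ) + 1) - s ^ (n + 1) / ((n : ℝ) + 1))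
    zero_le_one]
  · simp
  · exact Continuous.continuousOn (by fun_prop)
  · intro s _
    have h2 : ∀ m : ℕ, HasDerivAt (fun s : ℝ => s ^ (m + 1) / ((m : ℝ) + 1)) (s ^ m) s := fun m => by
      have := (hasDerivAt_pow (m + 1) s).div_const ((m : ℝ) + 1)
      have h0 : (m : ℝ) + 1 ≠ 0 := by positivity
      simpa [mul_div_cancel_left₀ _ h0] using this
    exact (h2 m).sub (h2 n)
  · intro s hs
    exact sub_nonneg.2 (pow_le_pow_of_le_one hs.1.le hs.2.le hmn)

/-- Now `2/k < 1`, and the `t`-integral is `k / (k - 2)` times `(1 - s ^ (k-2)) / (1 - s ^ k)`,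
which a geometric series in `s ^ k` resolves into differences of powers. -/
lemma secondMomentIntegral_of_two_lt {k : ℕ} (hk : 2 < k) :
    secondMomentIntegral k = ENNReal.ofReal (Real.pi * Real.cot (Real.pi / k) / (k - 2)) := by
  have hk' : (2 : ℝ) < k := by exact_mod_cast hk
  have hβ : 2 / (k : ℝ) < 1 := (div_lt_one (by linarith)).2 hk'
  have e1 : ∀ s ∈ Ioo (0 : ℝ) 1, ∫⁻ t in Ioo (0 : ℝ) 1,
      ENNReal.ofReal ((t + (1 - t) * s ^ k) ^ (-(2 / (k : ℝ))))
      = ENNReal.ofReal (k / (k - 2))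
        * ∑' j : ℕ, ENNReal.ofReal (s ^ (k * j) - s ^ (k * j + (k - 2))) := by
    intro s hs
    have hsk : s ^ k ∈ Ioo (0 : ℝ) 1 :=
      ⟨pow_pos hs.1 k, pow_lt_one₀ hs.1.le hs.2 (by lia)⟩
    have hl : 0 ≤ 1 - s ^ (k - 2) := sub_nonneg.2 (pow_le_one₀ hs.1.le hs.2.le)
    have h2 : ∀ j, s ^ (k * j) - s ^ (k * j + (k - 2)) = (1 - s ^ (k - 2)) * (s ^ k) ^ j := by
      intro j; rw [pow_add, pow_mul]; ring
    have h3 : (s ^ k) ^ (1 - 2 / (k : ℝ)) = s ^ (k - 2) := by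
      rw [← Real.rpow_natCast, ← Real.rpow_mul hs.1.le, ← Real.rpow_natCast, Nat.cast_sub hk.le]
      congr 1
      field_simp
      push_cast
      ring
    simp_rw [h2]
    rw [lintegral_Ioo_affine_rpow hsk hβ, tsum_ofReal_pow_mul hsk.1.le hsk.2 hl, h3,
      ← ENNReal.ofReal_mul (div_nonneg (by linarith) (by linarith))]
    congr 1
    have h4 : (k : ℝ) - 2 ≠ 0 := by linarith
    have h5 : 1 - s ^ k ≠ 0 := by linarith [hsk.2]
    rw [show 1 - 2 / (k : ℝ) = (k - 2) / k by field_simp]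
    field_simp
  have hsum := hasSum_one_div_sub_one_div hk.le
  rw [secondMomentIntegral, setLIntegral_congr_fun measurableSet_Ioo e1,
    lintegral_const_mul' _ _ (by simp), lintegral_tsum (fun j => by fun_prop)]
  simp_rw [lintegral_Ioo_pow_sub_pow (Nat.le_add_right _ _)]
  rw [← ENNReal.ofReal_tsum_of_nonneg (fun j => ?_) hsum.summable, hsum.tsum_eq,
    ← ENNReal.ofReal_mul (div_nonneg (by linarith) (by linarith))]
  · congr 1
    have h4 : (k : ℝ) - 2 ≠ 0 := by linarith
    field_simp
  · rw [sub_nonneg]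
    gcongr
    lia

variable {Ω : Type*} [MeasurableSpace Ω] {Q : Measure Ω} {U E : ℕ → Ω → ℝ} {k : ℕ}

lemma cot_pi_div_nonneg (hk : 2 < k) : 0 ≤ Real.cot (Real.pi / k) := by
  have hk' : (2 : ℝ) < k := by exact_mod_cast hk
  have h1 : 0 < Real.pi / k := div_pos Real.pi_pos (by linarith)
  have h2 : Real.pi / k ≤ Real.pi / 2 := div_le_div_of_nonneg_left Real.pi_pos.le (by norm_num) hk'.le
  rw [Real.cot_eq_cos_div_sin]
  exact div_nonneg (Real.cos_nonneg_of_mem_Icc ⟨by linarith [Real.pi_pos], h2⟩)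
    (Real.sin_nonneg_of_nonneg_of_le_pi h1.le (by linarith [Real.pi_pos]))

lemma IsChain.lintegral_pathIntegral_sq_eq_gam (h : IsChain U E Q) [IsProbabilityMeasure Q]
    (hk : 2 ≤ k) : ∫⁻ ω, pathIntegral k U E ω ^ 2 ∂Q = ENNReal.ofReal (gam k) := by
  have hk' : (2 : ℝ) ≤ k := by exact_mod_cast hk
  have hG := Real.Gamma_pos_of_pos (s := 2 / (k : ℝ)) (by positivity)
  have h1k : (0 : ℝ) < k - 1 := by linarith
  rw [h.lintegral_pathIntegral_sq hk]
  rcases hk.eq_or_lt with rfl | hk2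
  · rw [secondMomentIntegral_two, ← ENNReal.ofReal_one, ← ENNReal.ofReal_add (by simp) (by positivity),
      ← ENNReal.ofReal_mul (by positivity), gam, lam, if_pos rfl]
    congr 1
    norm_num
    ring
  · have hk2' : (0 : ℝ) < k - 2 := by
      have : (2 : ℝ) < k := by exact_mod_cast hk2
      linarith
    have hcot := cot_pi_div_nonneg hk2
    rw [secondMomentIntegral_of_two_lt hk2, ← ENNReal.ofReal_one,
      ← ENNReal.ofReal_add (by simp) (by positivity), ← ENNReal.ofReal_mul (by positivity), gam, lam,
      if_neg (by lia)]
    congr 1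
    field_simp

end SecondMomentValue

/-! ### The cumulative hazard of the ringing times -/

section Hazard

open Set

/-- The Taylor polynomial `∑_{i < k} t ^ i / i!` of the exponential function. -/
def expSum (k : ℕ) (t : ℝ) : ℝ := ∑ i ∈ Finset.range k, t ^ i / i.factorial

/-- The cumulative hazard of the Gamma law with parameter `k`: minus the logarithm of the
survival function `exp (-t) * expSum k t`. -/
def hazard (k : ℕ) (t : ℝ) : ℝ := t - Real.log (expSum k t)

lemma expSum_succ (k : ℕ) (t : ℝ) : expSum (k + 1) t = expSum k t + t ^ k / k.factorial :=
  Finset.sum_range_succ _ _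

lemma expSum_zero (t : ℝ) : expSum 0 t = 0 := by simp [expSum]

lemma expSum_apply_zero (k : ℕ) : expSum (k + 1) 0 = 1 := by
  rw [expSum, Finset.sum_range_succ']
  simp

lemma expSum_nonneg (k : ℕ) {t : ℝ} (ht : 0 ≤ t) : 0 ≤ expSum k t :=
  Finset.sum_nonneg fun _ _ => by positivity

lemma one_le_expSum {k : ℕ} (hk : k ≠ 0) {t : ℝ} (ht : 0 ≤ t) : 1 ≤ expSum k t := by
  obtain ⟨j, rfl⟩ := Nat.exists_eq_succ_of_ne_zero hk
  have h : ∀ i ∈ Finset.range j.succ, 0 ≤ t ^ i / (i.factorial : ℝ) := fun _ _ => by positivity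
  have := Finset.single_le_sum h (Finset.mem_range.2 j.succ_pos)
  simpa [expSum] using this

lemma continuous_expSum (k : ℕ) : Continuous (expSum k) := by
  unfold expSum
  fun_prop

lemma hasDerivAt_expSum (k : ℕ) (t : ℝ) : HasDerivAt (expSum (k + 1)) (expSum k t) t := by
  induction k with
  | zero =>
    have : expSum (0 + 1) = fun _ => 1 := by ext; simp [expSum]
    rw [this, expSum_zero]
    exact hasDerivAt_const _ _
  | succ k ih =>
    have h : expSum (k + 1 + 1) = fun t => expSum (k + 1) t + t ^ (k + 1) / (k + 1).factorial := by
      ext; exact expSum_succ _ _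
    rw [h, expSum_succ k]
    refine ih.add ?_
    have := (hasDerivAt_pow (k + 1) t).div_const ((k + 1).factorial : ℝ)
    convert! this using 1
    rw [Nat.factorial_succ]
    push_cast
    field_simp

variable {k : ℕ}

lemma exp_neg_hazard (hk : k ≠ 0) {t : ℝ} (ht : 0 ≤ t) :
    Real.exp (-hazard k t) = Real.exp (-t) * expSum k t := by
  have := one_le_expSum hk ht
  rw [hazard, neg_sub, sub_eq_add_neg, Real.exp_add, Real.exp_log (by linarith), mul_comm]

lemma hazard_zero (hk : k ≠ 0) : hazard k 0 = 0 := by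
  obtain ⟨j, rfl⟩ := Nat.exists_eq_succ_of_ne_zero hk
  simp [hazard, expSum_apply_zero]

lemma measurable_hazard (k : ℕ) : Measurable (hazard k) :=
  measurable_id.sub (continuous_expSum k).measurable.log

/-- Differentiation removes the top term of the Taylor polynomial, so that only this term survives
in `1 - expSum k t / expSum (k + 1) t`. -/
lemma hasDerivAt_hazard (k : ℕ) {t : ℝ} (ht : 0 ≤ t) :
    HasDerivAt (hazard (k + 1)) (t ^ k / k.factorial / expSum (k + 1) t) t := by
  have h1 := one_le_expSum k.succ_ne_zero ht
  have h := (hasDerivAt_id t).sub ((hasDerivAt_expSum k t).log (by linarith : expSum (k + 1) t ≠ 0))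
  convert! h using 1
  have h0 : expSum (k + 1) t ≠ 0 := by linarith
  rw [eq_sub_iff_add_eq, ← add_div, div_eq_one_iff_eq h0, expSum_succ, add_comm]

lemma continuousOn_hazard (hk : k ≠ 0) : ContinuousOn (hazard k) (Ici 0) := by
  obtain ⟨j, rfl⟩ := Nat.exists_eq_succ_of_ne_zero hk
  exact fun t ht => (hasDerivAt_hazard j ht).continuousAt.continuousWithinAt

lemma strictMonoOn_hazard (hk : k ≠ 0) : StrictMonoOn (hazard k) (Ici 0) := by
  obtain ⟨j, rfl⟩ := Nat.exists_eq_succ_of_ne_zero hk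
  refine strictMonoOn_of_deriv_pos (convex_Ici 0) (continuousOn_hazard hk) fun t ht => ?_
  rw [interior_Ici] at ht
  have ht' : 0 < t := ht
  rw [(hasDerivAt_hazard j ht'.le).deriv]
  have := one_le_expSum j.succ_ne_zero ht'.le
  positivity

lemma hazard_nonneg (hk : k ≠ 0) {t : ℝ} (ht : 0 ≤ t) : 0 ≤ hazard k t := by
  rw [← hazard_zero hk]
  exact (strictMonoOn_hazard hk).monotoneOn self_mem_Ici ht ht

/-- Both sides vanish at `0`, and the derivatives differ by the factor `1 / expSum k t ≤ 1`. -/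
lemma hazard_le (hk : k ≠ 0) {t : ℝ} (ht : 0 ≤ t) : hazard k t ≤ t ^ k / k.factorial := by
  obtain ⟨j, rfl⟩ := Nat.exists_eq_succ_of_ne_zero hk
  have hd : ∀ s : ℝ, 0 ≤ s → HasDerivAt (fun s => s ^ (j + 1) / (j + 1).factorial - hazard (j + 1) s)
      (s ^ j / j.factorial - s ^ j / j.factorial / expSum (j + 1) s) s := by
    intro s hs
    refine HasDerivAt.sub ?_ (hasDerivAt_hazard j hs)
    have := (hasDerivAt_pow (j + 1) s).div_const ((j + 1).factorial : ℝ)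
    convert! this using 1
    rw [Nat.factorial_succ]
    push_cast
    field_simp
  have hmono : MonotoneOn (fun s => s ^ (j + 1) / (j + 1).factorial - hazard (j + 1) s) (Ici 0) := by
    refine monotoneOn_of_deriv_nonneg (convex_Ici 0)
      (fun s hs => (hd s hs).continuousAt.continuousWithinAt) (fun s hs => ?_) fun s hs => ?_
    · rw [interior_Ici] at hs
      exact (hd s (le_of_lt hs)).differentiableAt.differentiableWithinAt
    · rw [interior_Ici] at hs
      have hs' : 0 < s := hs
      rw [(hd s hs'.le).deriv, sub_nonneg]
      exact div_le_self (by positivity) (one_le_expSum j.succ_ne_zero hs'.le)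
  have := hmono self_mem_Ici ht ht
  simp only [hazard_zero hk] at this
  have h0 : (0 : ℝ) ^ (j + 1) / (j + 1).factorial - 0 = 0 := by simp
  rw [h0] at this
  exact sub_nonneg.1 this

/-- The hazard dominates `1 - exp (-hazard)`, which is `exp (-t)` times the tail of the exponential
series; only the term of degree `k` is kept. -/
lemma le_hazard (hk : k ≠ 0) {t : ℝ} (ht : 0 ≤ t) :
    Real.exp (-t) * (t ^ k / k.factorial) ≤ hazard k t := by
  have h1 : Real.exp (-t) * expSum k t - 1 ≥ -hazard k t := by
    have := Real.add_one_le_exp (-hazard k t)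
    rw [exp_neg_hazard hk ht] at this
    linarith
  have h2 : expSum (k + 1) t ≤ Real.exp t := Real.sum_le_exp_of_nonneg ht _
  rw [expSum_succ] at h2
  have h3 := mul_le_mul_of_nonneg_left h2 (Real.exp_pos (-t)).le
  rw [← Real.exp_add, neg_add_cancel, Real.exp_zero, mul_add] at h3
  linarith

/-- Linear growth for large `t`: each `t ^ i` with `i < k` is at most `2 ^ k (t/2) ^ i`, so `expSum
k t ≤ 2 ^ k exp (t/2)`. -/
lemma half_sub_le_hazard (hk : k ≠ 0) {t : ℝ} (ht : 0 ≤ t) :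
    t / 2 - k * Real.log 2 ≤ hazard k t := by
  have h1 : expSum k t ≤ 2 ^ k * Real.exp (t / 2) := by
    calc expSum k t ≤ ∑ i ∈ Finset.range k, 2 ^ k * ((t / 2) ^ i / i.factorial) := by
          refine Finset.sum_le_sum fun i hi => ?_
          rw [div_pow, div_right_comm, ← mul_div_assoc, le_div_iff₀ (by positivity), mul_comm]
          gcongr
          · norm_num
          · exact (Finset.mem_range.1 hi).le
      _ = 2 ^ k * expSum k (t / 2) := (Finset.mul_sum _ _ _).symm
      _ ≤ _ := by
          gcongr
          exact Real.sum_le_exp_of_nonneg (by positivity) _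
  have h2 := Real.log_le_log (by linarith [one_le_expSum hk ht]) h1
  rw [Real.log_mul (by positivity) (by positivity), Real.log_pow, Real.log_exp] at h2
  rw [hazard]
  linarith

/-- The `k`-th root of the normalized hazard is close to the identity near zero. -/
lemma root_hazard_le (hk : k ≠ 0) {t : ℝ} (ht : 0 ≤ t) :
    (k.factorial * hazard k t) ^ (1 / (k : ℝ)) ≤ t := by
  have h := hazard_le hk ht
  rw [le_div_iff₀' (by positivity)] at h
  calc (k.factorial * hazard k t) ^ (1 / (k : ℝ)) ≤ (t ^ k) ^ (1 / (k : ℝ)) :=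
        Real.rpow_le_rpow (mul_nonneg (by positivity) (hazard_nonneg hk ht)) h (by positivity)
    _ = t := by rw [one_div, Real.pow_rpow_inv_natCast ht hk]

/-- Under the `k`-th root the factor `exp (-t)` of `le_hazard` becomes `exp (-t/k) ≥ 1 - t`. With
`root_hazard_le`, the root is within `t ^ 2` of `t`. -/
lemma sub_sq_le_root_hazard (hk : k ≠ 0) {t : ℝ} (ht : 0 ≤ t) :
    t - t ^ 2 ≤ (k.factorial * hazard k t) ^ (1 / (k : ℝ)) := by
  have hk1 : (1 : ℝ) ≤ k := by exact_mod_cast Nat.one_le_iff_ne_zero.2 hk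
  have h := le_hazard hk ht
  rw [← mul_div_assoc, div_le_iff₀' (by positivity)] at h
  have h2 : (Real.exp (-t) * t ^ k) ^ (1 / (k : ℝ)) = Real.exp (-t / k) * t := by
    rw [Real.mul_rpow (by positivity) (by positivity), one_div, Real.pow_rpow_inv_natCast ht hk,
      ← Real.exp_mul, div_eq_mul_inv]
  calc t - t ^ 2 = (1 - t) * t := by ring
    _ ≤ Real.exp (-t / k) * t := by
        gcongr
        have h3 := Real.add_one_le_exp (-t / k)
        have h4 : t / k ≤ t := div_le_self ht hk1
        rw [neg_div] at h3 ⊢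
        linarith
    _ = _ := h2.symm
    _ ≤ _ := Real.rpow_le_rpow (by positivity) h (by positivity)

/-- Controls moments of ringing times by moments of exponential variables: up to `1` the `k`-th root
of the hazard dominates, beyond `1` its linear growth. -/
lemma exists_le_mul_hazard (hk : k ≠ 0) :
    ∃ C : ℝ, 0 < C ∧ ∀ t, 0 ≤ t → t ≤ C * ((hazard k t) ^ (1 / (k : ℝ)) + hazard k t) := by
  set A : ℝ := Real.exp 1 * k.factorial with hA
  have hA1 : 1 ≤ A := by
    have h1 : (1 : ℝ) ≤ k.factorial := by exact_mod_cast Nat.succ_le_of_lt k.factorial_pos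
    have h2 : (1 : ℝ) ≤ Real.exp 1 := Real.one_le_exp zero_le_one
    nlinarith
  have hlog : 0 < Real.log 2 := Real.log_pos (by norm_num)
  -- `A` gives `t ^ k ≤ A * hazard k t` on `[0, 1]`, hence `1 ≤ A * hazard k t` for `t ≥ 1`. The
  -- latter absorbs the additive constant in `t ≤ 2 * hazard k t + 2 k log 2`.
  refine ⟨A + (2 + 2 * k * Real.log 2 * A), by positivity, fun t ht => ?_⟩
  have h0 := hazard_nonneg hk ht
  have hr : 0 ≤ (hazard k t) ^ (1 / (k : ℝ)) := Real.rpow_nonneg h0 _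
  have hD : 0 ≤ 2 + 2 * k * Real.log 2 * A := by positivity
  rcases le_total t 1 with h1 | h1
  · have h2 : t ^ k ≤ A * hazard k t := by
      have h := le_hazard hk ht
      rw [← mul_div_assoc, div_le_iff₀' (by positivity), Real.exp_neg, inv_mul_le_iff₀ (by positivity)]
        at h
      refine h.trans ?_
      rw [← mul_assoc, hA]
      gcongr
    calc t = (t ^ k) ^ (1 / (k : ℝ)) := by rw [one_div, Real.pow_rpow_inv_natCast ht hk]
      _ ≤ (A * hazard k t) ^ (1 / (k : ℝ)) :=
          Real.rpow_le_rpow (by positivity) h2 (by positivity)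
      _ = A ^ (1 / (k : ℝ)) * (hazard k t) ^ (1 / (k : ℝ)) :=
          Real.mul_rpow (by positivity) h0
      _ ≤ A * (hazard k t) ^ (1 / (k : ℝ)) := by
          gcongr
          refine Real.rpow_le_self_of_one_le hA1 ?_
          exact (div_le_one (by positivity)).2 (by exact_mod_cast Nat.one_le_iff_ne_zero.2 hk)
      _ ≤ _ := by nlinarith [mul_nonneg hD hr, mul_nonneg hD h0, mul_nonneg (by positivity : 0 ≤ A) h0]
  · have h2 : 1 ≤ A * hazard k t := by
      have h := le_hazard hk zero_le_one
      rw [one_pow, ← mul_div_assoc, div_le_iff₀' (by positivity), Real.exp_neg,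
        inv_mul_le_iff₀ (by positivity), ← mul_assoc] at h
      refine h.trans ?_
      rw [hA]
      gcongr
      exact (strictMonoOn_hazard hk).monotoneOn (mem_Ici.2 zero_le_one) (mem_Ici.2 ht) h1
    have h3 := half_sub_le_hazard hk ht
    have h4 : t ≤ (2 + 2 * k * Real.log 2 * A) * hazard k t := by
      have : 2 * k * Real.log 2 * 1 ≤ 2 * k * Real.log 2 * (A * hazard k t) := by gcongr
      nlinarith
    nlinarith [mul_nonneg hD hr, mul_nonneg (by positivity : 0 ≤ A) hr,
      mul_nonneg (by positivity : 0 ≤ A) h0]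

lemma surjOn_hazard (hk : k ≠ 0) : SurjOn (hazard k) (Ici 0) (Ici 0) := by
  intro w hw
  -- The point where the lower bound of `half_sub_le_hazard` equals `w`.
  set b : ℝ := 2 * (w + k * Real.log 2)
  have hlog : 0 < Real.log 2 := Real.log_pos (by norm_num)
  have hb : 0 ≤ b := by have : 0 ≤ w := hw; positivity
  have h1 := half_sub_le_hazard hk hb
  have h2 : w ≤ hazard k b := by simp only [b] at h1 ⊢; linarith
  obtain ⟨t, ht, rfl⟩ := intermediate_value_Icc hb
    ((continuousOn_hazard hk).mono Icc_subset_Ici_self) ⟨(hazard_zero hk).trans_le hw, h2⟩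
  exact ⟨t, ht.1, rfl⟩

end Hazard

/-! ### The alarm clocks -/

section Clock

open Set
open scoped ENNReal

variable {Ω : Type*} [MeasurableSpace Ω] {P : Measure Ω}

/-- The holding times of the alarm clocks are measurable, independent and `Exp(1)`. -/
structure IsClock (T : ℕ → ℕ → Ω → ℝ) (P : Measure Ω) : Prop where
  measurable : ∀ i v, Measurable (T i v)
  law : ∀ i v, HasLaw (T i v) (expMeasure 1) P
  indep : iIndepFun (fun iv : ℕ × ℕ => T iv.1 iv.2) P

/-- Functions of the members of disjoint groups of independent variables are independent. -/
lemma iIndepFun_of_groups [IsProbabilityMeasure P] {ι : Type*} {f : ι → Ω → ℝ}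
    (hf : iIndepFun f P) (hm : ∀ i, Measurable (f i)) (node : ι → ℕ) {Z : ℕ → Ω → ℝ}
    (hZ : ∀ v, Measurable[⨆ i ∈ {i | node i = v}, MeasurableSpace.comap (f i) inferInstance] (Z v)) :
    iIndepFun Z P := by
  rw [iIndepFun_iff_measure_inter_preimage_eq_mul]
  intro S
  induction S using Finset.induction_on with
  | empty => intro _ _; simp
  | insert a S ha ih =>
    intro sets hs
    rw [Finset.set_biInter_insert, Finset.prod_insert ha,
      ← ih fun i hi => hs i (Finset.mem_insert_of_mem hi)]
    have hdis : Disjoint {i | node i = a} {i | node i ∈ S} := by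
      rw [Set.disjoint_left]
      rintro i rfl hi
      exact ha hi
    have hY : Measurable[⨆ i ∈ {i | node i ∈ S}, MeasurableSpace.comap (f i) inferInstance]
        (fun ω (v : S) => Z v ω) := by
      refine @measurable_pi_lambda _ _ _ (_) _ _ fun v => ?_
      refine (hZ v).mono (iSup₂_mono' fun i hi => ⟨i, ?_, le_rfl⟩) le_rfl
      have : node i = v := hi
      simp [this]
    have hind := indepFun_of_disjoint hf hm hdis (hZ a) hY
    have hset : ⋂ i ∈ S, Z i ⁻¹' sets i
        = (fun ω (v : S) => Z v ω) ⁻¹' (Set.univ.pi fun v : S => sets v) := by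
      ext ω; simp
    rw [hset]
    exact hind.measure_inter_preimage_eq_mul _ _ (hs a (Finset.mem_insert_self _ _))
      (MeasurableSet.univ_pi fun v => hs v (Finset.mem_insert_of_mem v.2))

variable {T : ℕ → ℕ → Ω → ℝ}

lemma measurable_ringTime_group {Ω : Type*} (T : ℕ → ℕ → Ω → ℝ) (r v : ℕ) {S : Set (ℕ × ℕ)}
    (hS : ∀ i < r, (i, v) ∈ S) :
    Measurable[⨆ iv ∈ S, MeasurableSpace.comap (T iv.1 iv.2) inferInstance] (ringTime T r v) := by
  unfold ringTime
  refine Finset.measurable_fun_sum _ fun i hi => ?_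
  exact measurable_iSup_comap (fun iv : ℕ × ℕ => T iv.1 iv.2) (hS i (Finset.mem_range.1 hi))

lemma IsClock.measurable_ringTime (h : IsClock T P) (r v : ℕ) : Measurable (ringTime T r v) := by
  unfold ringTime
  exact Finset.measurable_fun_sum _ fun i _ => h.measurable i v

lemma IsClock.ae_pos (h : IsClock T P) : ∀ᵐ ω ∂P, ∀ i v, 0 < T i v ω := by
  rw [ae_all_iff]; intro i; rw [ae_all_iff]; intro v
  have := ae_expMeasure_pos one_pos
  rw [← (h.law i v).map_eq, ae_map_iff (h.measurable i v).aemeasurable measurableSet_Ioi] at this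
  exact this

lemma ringTime_succ {Ω : Type*} (T : ℕ → ℕ → Ω → ℝ) (r v : ℕ) (ω : Ω) :
    ringTime T (r + 1) v ω = ringTime T r v ω + T r v ω :=
  Finset.sum_range_succ _ _

lemma ringTime_pos {Ω : Type*} {T : ℕ → ℕ → Ω → ℝ} {ω : Ω} (hω : ∀ i v, 0 < T i v ω) {r : ℕ} (hr : r ≠ 0) (v : ℕ) :
    0 < ringTime T r v ω :=
  Finset.sum_pos (fun i _ => hω i v) (by simpa using hr)

/-- The survival function of the ringing times. -/
lemma IsClock.measure_ringTime_gt [IsProbabilityMeasure P] (h : IsClock T P) (v r : ℕ) :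
    ∀ {t : ℝ}, 0 ≤ t →
      P.map (ringTime T r v) (Ioi t) = ENNReal.ofReal (Real.exp (-t) * expSum r t) := by
  induction r with
  | zero =>
    intro t ht
    rw [Measure.map_apply (h.measurable_ringTime 0 v) measurableSet_Ioi, expSum_zero, mul_zero,
      ENNReal.ofReal_zero]
    have : ringTime T 0 v ⁻¹' Ioi t = ∅ := by
      ext ω; simp [ringTime, ht]
    rw [this, measure_empty]
  | succ r ih =>
    intro t ht
    set ν := P.map (ringTime T r v) with hν
    have : IsProbabilityMeasure ν := Measure.isProbabilityMeasure_map
      (h.measurable_ringTime r v).aemeasurable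
    have hlaw : HasLaw (ringTime T r v) ν P := ⟨(h.measurable_ringTime r v).aemeasurable, rfl⟩
    have hind : IndepFun (T r v) (ringTime T r v) P := by
      refine indepFun_of_disjoint h.indep (fun iv => h.measurable _ _)
        (S := {(r, v)}) (T := {iv | iv.1 < r}) (by simp) ?_ ?_
      · exact measurable_iSup_comap (fun iv : ℕ × ℕ => T iv.1 iv.2) (i := (r, v)) (mem_singleton _)
      · exact measurable_ringTime_group T r v fun i hi => hi
    have hgm : Measurable fun q : ℝ × ℝ => (if t < q.2 + q.1 then 1 else 0 : ℝ≥0∞) :=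
      Measurable.ite (measurableSet_lt measurable_const (by fun_prop)) measurable_const
        measurable_const
    have e1 : P.map (ringTime T (r + 1) v) (Ioi t)
        = ∫⁻ ω, (if t < ringTime T r v ω + T r v ω then 1 else 0 : ℝ≥0∞) ∂P := by
      rw [Measure.map_apply (h.measurable_ringTime _ v) measurableSet_Ioi,
        ← lintegral_indicator_one (h.measurable_ringTime _ v measurableSet_Ioi)]
      refine lintegral_congr fun ω => ?_
      simp [indicator, ringTime_succ]
    have e2 : ∀ x : ℝ, ∫⁻ y, (if t < y + x then 1 else 0 : ℝ≥0∞) ∂ν = ν (Ioi (t - x)) := by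
      intro x
      rw [← lintegral_indicator_one measurableSet_Ioi]
      refine lintegral_congr fun y => ?_
      simp [indicator, sub_lt_iff_lt_add]
    have hνneg : ∀ s < 0, ν (Ioi s) = 1 := by
      intro s hs
      rw [hν, Measure.map_apply (h.measurable_ringTime _ v) measurableSet_Ioi, ← measure_univ (μ := P)]
      refine measure_congr ?_
      filter_upwards [h.ae_pos] with ω hω
      refine propext ⟨fun _ => trivial, fun _ => hs.trans_le ?_⟩
      exact Finset.sum_nonneg fun i _ => (hω i v).le
    have hm : Measurable fun x => ν (Ioi (t - x)) := by
      simp_rw [← e2]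
      exact hgm.lintegral_prod_right'
    rw [e1, lintegral_indepFun hind (h.measurable r v) hlaw
      (g := fun q => if t < q.2 + q.1 then 1 else 0) hgm]
    simp only [e2]
    rw [(h.law r v).lintegral_comp (f := fun x => ν (Ioi (t - x))) hm.aemeasurable,
      lintegral_expMeasure 1 hm, ← Ioc_union_Ioi_eq_Ioi ht, lintegral_union measurableSet_Ioi
        (by rw [Set.disjoint_left]; intro w h1 h2; exact absurd h1.2 (not_le.2 h2))]
    -- If the last holding time alone exceeds `t`, the remaining condition holds with probability
    -- one.
    have e3 : ∫⁻ x in Ioi t, ENNReal.ofReal (1 * Real.exp (-(1 * x))) * ν (Ioi (t - x))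
        = ENNReal.ofReal (Real.exp (-t)) := by
      have h1 := expMeasure_Ioi one_pos ht
      rw [one_mul, ← lintegral_indicator_one measurableSet_Ioi,
        lintegral_expMeasure 1 (measurable_one.indicator measurableSet_Ioi)] at h1
      rw [← h1, ← lintegral_indicator measurableSet_Ioi, ← lintegral_indicator measurableSet_Ioi]
      refine lintegral_congr fun x => ?_
      simp only [indicator, mem_Ioi]
      by_cases hx : t < x
      · simp [hx, ht.trans_lt hx, hνneg _ (sub_neg.2 hx)]
      · simp [hx]
    -- For a last holding time `x < t` the exponentials combine to `exp (-t)`, and `-expSum (r + 1)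
    -- (t - x)` is an antiderivative of `expSum r (t - x)`.
    have e4 : ∫⁻ x in Ioc 0 t, ENNReal.ofReal (1 * Real.exp (-(1 * x))) * ν (Ioi (t - x))
        = ENNReal.ofReal (Real.exp (-t) * (expSum (r + 1) t - 1)) := by
      rw [setLIntegral_congr Ioo_ae_eq_Ioc.symm, setLIntegral_congr_fun
        (g := fun x => ENNReal.ofReal (Real.exp (-t) * expSum r (t - x))) measurableSet_Ioo]
      · rw [lintegral_Ioo_deriv (F := fun x => -(Real.exp (-t) * expSum (r + 1) (t - x))) ht]
        · congr 1
          simp only [sub_self, sub_zero, expSum_apply_zero]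
          ring
        · have := continuous_expSum (r + 1)
          exact Continuous.continuousOn (by fun_prop)
        · intro x _
          have := (((hasDerivAt_expSum r (t - x)).comp x ((hasDerivAt_id x).const_sub t)).const_mul
            (Real.exp (-t))).neg
          convert! this using 1
          ring
        · intro x hx
          exact mul_nonneg (Real.exp_pos _).le (expSum_nonneg _ (by linarith [hx.2]))
      · intro x hx
        simp only
        rw [ih (by linarith [hx.2] : 0 ≤ t - x), ← ENNReal.ofReal_mul (by positivity), ← mul_assoc,
          one_mul, one_mul, ← Real.exp_add]
        ring_nf
    rw [e3, e4, ← ENNReal.ofReal_add _ (Real.exp_pos _).le]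
    · congr 1; ring
    · have := one_le_expSum r.succ_ne_zero ht
      exact mul_nonneg (Real.exp_pos _).le (by linarith)

variable {k : ℕ}

/-- Every level `w ≥ 0` is the hazard of some `t`, and by strict monotonicity exceeding `w` means
ringing after `t`, which has probability `exp (-hazard k t)`. -/
lemma IsClock.hasLaw_hazard [IsProbabilityMeasure P] (h : IsClock T P) (hk : k ≠ 0) (v : ℕ) :
    HasLaw (fun ω => hazard k (ringTime T k v ω)) (expMeasure 1) P := by
  have hm : Measurable fun ω => hazard k (ringTime T k v ω) :=
    (measurable_hazard k).comp (h.measurable_ringTime k v)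
  have : IsProbabilityMeasure (P.map fun ω => hazard k (ringTime T k v ω)) :=
    Measure.isProbabilityMeasure_map hm.aemeasurable
  refine ⟨hm.aemeasurable, expMeasure_unique one_pos fun w hw => ?_⟩
  obtain ⟨t, ht, rfl⟩ := surjOn_hazard hk hw
  have ht' : 0 ≤ t := ht
  rw [one_mul, exp_neg_hazard hk ht', ← h.measure_ringTime_gt v k ht',
    Measure.map_apply hm measurableSet_Ioi,
    Measure.map_apply (h.measurable_ringTime k v) measurableSet_Ioi]
  refine measure_congr ?_
  filter_upwards [h.ae_pos] with ω hω
  exact propext ((strictMonoOn_hazard hk).lt_iff_lt ht (ringTime_pos hω hk v).le)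

lemma IsClock.iIndepFun_hazard [IsProbabilityMeasure P] (h : IsClock T P) (k : ℕ) :
    iIndepFun (fun v ω => hazard k (ringTime T k v ω)) P := by
  refine iIndepFun_of_groups h.indep (fun iv => h.measurable _ _) Prod.snd fun v => ?_
  exact (measurable_hazard k).comp (measurable_ringTime_group T k v fun i _ => rfl)

end Clock

/-! ### Minima of ringing times -/

section MinRing

open Set
open scoped ENNReal

lemma runMin_map {f : ℝ → ℝ} (hf : MonotoneOn f (Ici 0)) {z : ℕ → ℝ} (hz : ∀ j, 0 < z j) (i : ℕ) :
    f (runMin z i) = runMin (fun j => f (z j)) i := by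
  induction i with
  | zero => rfl
  | succ i ih =>
    change f (min (runMin z i) (z (i + 1))) = min (runMin (fun j => f (z j)) i) (f (z (i + 1)))
    rw [← ih]
    exact hf.map_min (runMin_pos hz).le (hz _).le

lemma expMeasure_Ici {a t : ℝ} (ha : 0 < a) (ht : 0 ≤ t) :
    expMeasure a (Ici t) = ENNReal.ofReal (Real.exp (-(a * t))) := by
  have : NullSingletonClass (expMeasure a) := by
    unfold expMeasure gammaMeasure
    infer_instance
  rw [← expMeasure_Ioi ha ht, measure_congr Ioi_ae_eq_Ici]

lemma expMeasure_Iio {a t : ℝ} (ha : 0 < a) (ht : 0 ≤ t) :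
    expMeasure a (Iio t) = ENNReal.ofReal (1 - Real.exp (-(a * t))) := by
  have := isProbabilityMeasure_expMeasure ha
  rw [← compl_Ici, measure_compl measurableSet_Ici (measure_ne_top _ _), expMeasure_Ici ha ht,
    measure_univ, ENNReal.ofReal_sub _ (Real.exp_pos _).le, ENNReal.ofReal_one]

lemma lintegral_ite_lt_expMeasure {t : ℝ} (ht : 0 ≤ t) (a b : ℝ≥0∞) :
    ∫⁻ y, (if y < t then a else b) ∂expMeasure 1
      = a * ENNReal.ofReal (1 - Real.exp (-t)) + b * ENNReal.ofReal (Real.exp (-t)) := by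
  have e : ∀ y : ℝ, (if y < t then a else b)
      = (Iio t).indicator (fun _ => a) y + (Ici t).indicator (fun _ => b) y := by
    intro y
    by_cases h : y < t <;> simp [indicator, h, not_le.2, not_lt.1]
  simp_rw [e]
  rw [lintegral_add_left (measurable_const.indicator measurableSet_Iio),
    lintegral_indicator_const measurableSet_Iio, lintegral_indicator_const measurableSet_Ici,
    expMeasure_Iio one_pos ht, expMeasure_Ici one_pos ht, one_mul]

lemma exists_sum_rpow_le {β : ℝ} (h0 : 0 ≤ β) (h1 : β < 1) :
    ∃ C : ℝ, 0 < C ∧ ∀ m : ℕ, ∑ i ∈ Finset.range m, ((i + 1 : ℕ) : ℝ) ^ (-β) ≤ C * (m : ℝ) ^ (1 - β) := by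
  have hG1 := Real.Gamma_pos_of_pos (s := 1 - β) (by linarith)
  have hG2 := Real.Gamma_pos_of_pos (s := ((1 : ℕ) : ℝ) * (1 - β) + 1) (by push_cast; linarith)
  refine ⟨(1 * Real.Gamma (1 - β)) ^ 1 / Real.Gamma (((1 : ℕ) : ℝ) * (1 - β) + 1), by positivity,
    fun m => ?_⟩
  have h := convSum_le (e := fun w => ((w + 1 : ℕ) : ℝ) ^ (-β)) (c := 1) (fun w => by positivity)
    zero_le_one h0 h1 (fun w => by rw [one_mul]) 1 m
  refine le_trans (le_of_eq ?_) (h.trans (le_of_eq ?_))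
  · simp [convSum]
  · simp

variable {Ω : Type*} {k : ℕ}

/-- The time at which the first of the clocks of the nodes `s, …, s + w` rings for the `k`-th
time. -/
def minRing (k : ℕ) (T : ℕ → ℕ → Ω → ℝ) (s w : ℕ) (ω : Ω) : ℝ :=
  runMin (fun j => ringTime T k (s + j) ω) w

lemma measurable_minRing_group (T : ℕ → ℕ → Ω → ℝ) (k s w : ℕ) {S : Set (ℕ × ℕ)}
    (hS : ∀ i, ∀ j ≤ w, (i, s + j) ∈ S) :
    Measurable[⨆ iv ∈ S, MeasurableSpace.comap (T iv.1 iv.2) inferInstance] (minRing k T s w) :=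
  measurable_runMin fun j hj => measurable_ringTime_group T k (s + j) fun i _ => hS i j hj

lemma minRing_pos {T : ℕ → ℕ → Ω → ℝ} {ω : Ω} (hω : ∀ i v, 0 < T i v ω) (hk : k ≠ 0) (s w : ℕ) :
    0 < minRing k T s w ω :=
  runMin_pos fun _ => ringTime_pos hω hk _

variable [MeasurableSpace Ω] {P : Measure Ω} {T : ℕ → ℕ → Ω → ℝ}

lemma IsClock.measurable_minRing (h : IsClock T P) (k s w : ℕ) : Measurable (minRing k T s w) :=
  measurable_runMin fun _ _ => h.measurable_ringTime k _

/-- The hazard is increasing, so it commutes with minima; the minimum of `w + 1` independent Exp(1)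
variables has rate `w + 1`. -/
lemma IsClock.hasLaw_hazard_minRing [IsProbabilityMeasure P] (h : IsClock T P) (hk : k ≠ 0)
    (s w : ℕ) : HasLaw (fun ω => hazard k (minRing k T s w ω)) (expMeasure ((w + 1 : ℕ) : ℝ)) P := by
  have h1 := hasLaw_runMin (P := P) (d := fun _ => 1)
    (Z := fun j ω => hazard k (ringTime T k (s + j) ω)) (fun j => h.hasLaw_hazard hk (s + j))
    (fun j => (measurable_hazard k).comp (h.measurable_ringTime k _)) (fun _ => one_pos)
    ((h.iIndepFun_hazard k).precomp (add_right_injective s)) w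
  rw [point_const, mul_one] at h1
  refine h1.congr ?_
  filter_upwards [h.ae_pos] with ω hω
  exact runMin_map (strictMonoOn_hazard hk).monotoneOn (fun j => ringTime_pos hω hk _) w

/-- By `exists_le_mul_hazard` the `q`-th power is bounded by the powers `q/k` and `q` of an Exp(w +
1) variable, and the power `q` has the faster decay. -/
lemma IsClock.exists_lintegral_minRing_pow_le [IsProbabilityMeasure P] (h : IsClock T P)
    (hk : k ≠ 0) (q : ℕ) :
    ∃ C : ℝ, 0 < C ∧ ∀ s w, ∫⁻ ω, ENNReal.ofReal (minRing k T s w ω ^ q) ∂P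
      ≤ ENNReal.ofReal (C * ((w + 1 : ℕ) : ℝ) ^ (-((q : ℝ) / k))) := by
  obtain ⟨C, hC, hCt⟩ := exists_le_mul_hazard hk
  have hk1 : (1 : ℝ) ≤ k := by exact_mod_cast Nat.one_le_iff_ne_zero.2 hk
  have hG1 := Real.Gamma_pos_of_pos (s := 1 + (q : ℝ) / k) (by positivity)
  have hG2 := Real.Gamma_pos_of_pos (s := 1 + (q : ℝ)) (by positivity)
  refine ⟨(2 * C) ^ q * (Real.Gamma (1 + (q : ℝ) / k) + Real.Gamma (1 + (q : ℝ))), by positivity,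
    fun s w => ?_⟩
  have hpt : ∀ᵐ ω ∂P, ENNReal.ofReal (minRing k T s w ω ^ q)
      ≤ ENNReal.ofReal ((2 * C) ^ q) * (ENNReal.ofReal (hazard k (minRing k T s w ω) ^ ((q : ℝ) / k))
        + ENNReal.ofReal (hazard k (minRing k T s w ω) ^ (q : ℝ))) := by
    filter_upwards [h.ae_pos] with ω hω
    have hm := (minRing_pos hω hk s w).le
    set t := minRing k T s w ω
    set x := hazard k t with hx
    have hx0 : 0 ≤ x := hazard_nonneg hk hm
    have hle : t ≤ 2 * C * max (x ^ (1 / (k : ℝ))) x := by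
      refine (hCt t hm).trans ?_
      rw [mul_comm 2 C, mul_assoc]
      gcongr
      rw [two_mul]
      exact add_le_add (le_max_left _ _) (le_max_right _ _)
    rw [← ENNReal.ofReal_add (by positivity) (by positivity), ← ENNReal.ofReal_mul (by positivity)]
    refine ENNReal.ofReal_le_ofReal ((pow_le_pow_left₀ hm hle q).trans ?_)
    rw [mul_pow]
    gcongr
    have e1 : x ^ ((q : ℝ) / k) = (x ^ (1 / (k : ℝ))) ^ q := by
      rw [← Real.rpow_natCast, ← Real.rpow_mul hx0]
      congr 1; ring
    rw [e1, Real.rpow_natCast]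
    have p1 : 0 ≤ (x ^ (1 / (k : ℝ))) ^ q := by positivity
    have p2 : 0 ≤ x ^ q := by positivity
    rcases le_total (x ^ (1 / (k : ℝ))) x with hh | hh
    · rw [max_eq_right hh]; linarith
    · rw [max_eq_left hh]; linarith
  have hlaw := h.hasLaw_hazard_minRing hk s w
  have hw : (0 : ℝ) < ((w + 1 : ℕ) : ℝ) := by positivity
  have hmom : ∀ r : ℝ, 0 ≤ r → ∫⁻ ω, ENNReal.ofReal (hazard k (minRing k T s w ω) ^ r) ∂P
      = ENNReal.ofReal (Real.Gamma (1 + r) * ((w + 1 : ℕ) : ℝ) ^ (-r)) := fun r hr => by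
    rw [hlaw.lintegral_comp (f := fun x => ENNReal.ofReal (x ^ r))
      (by fun_prop : Measurable fun x : ℝ => ENNReal.ofReal (x ^ r)).aemeasurable,
      lintegral_rpow_expMeasure hw (by linarith)]
  have hmeas : Measurable fun ω => ENNReal.ofReal (hazard k (minRing k T s w ω) ^ ((q : ℝ) / k)) :=
    (((measurable_hazard k).comp (h.measurable_minRing k s w)).pow_const _).ennreal_ofReal
  calc _ ≤ _ := lintegral_mono_ae hpt
    _ = ENNReal.ofReal ((2 * C) ^ q * (Real.Gamma (1 + (q : ℝ) / k) * ((w + 1 : ℕ) : ℝ) ^ (-((q : ℝ) / k))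
          + Real.Gamma (1 + (q : ℝ)) * ((w + 1 : ℕ) : ℝ) ^ (-(q : ℝ)))) := by
        rw [lintegral_const_mul' _ _ ENNReal.ofReal_ne_top, lintegral_add_left hmeas,
          hmom _ (by positivity), hmom _ (by positivity), ← ENNReal.ofReal_add (by positivity) (by positivity),
          ← ENNReal.ofReal_mul (by positivity)]
    _ ≤ _ := by
        refine ENNReal.ofReal_le_ofReal ?_
        rw [mul_assoc]
        gcongr
        rw [add_mul]
        gcongr
        · push_cast; linarith
        · exact div_le_self (by positivity) hk1

/-- One step of the compensation of record indicators. -/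
lemma lintegral_sq_add_compensated [IsProbabilityMeasure P] {A M Y : Ω → ℝ}
    (hind : IndepFun (fun ω => (A ω, M ω)) Y P) (hA : Measurable A) (hM : Measurable M)
    (hY : HasLaw Y (expMeasure 1) P) (hM0 : ∀ᵐ ω ∂P, 0 ≤ M ω) :
    ∫⁻ ω, ENNReal.ofReal ((A ω + ((if Y ω < M ω then 1 else 0) - (1 - Real.exp (-M ω)))) ^ 2) ∂P
      ≤ ∫⁻ ω, ENNReal.ofReal (A ω ^ 2) ∂P + ∫⁻ ω, ENNReal.ofReal (M ω) ∂P := by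
  have := isProbabilityMeasure_expMeasure one_pos
  have hgm : Measurable fun q : (ℝ × ℝ) × ℝ =>
      ENNReal.ofReal ((q.1.1 + ((if q.2 < q.1.2 then 1 else 0) - (1 - Real.exp (-q.1.2)))) ^ 2) := by
    have : Measurable fun q : (ℝ × ℝ) × ℝ => (if q.2 < q.1.2 then 1 else 0 : ℝ) :=
      Measurable.ite (measurableSet_lt (by fun_prop) (by fun_prop)) measurable_const measurable_const
    fun_prop
  rw [lintegral_indepFun hind (hA.prodMk hM) hY (g := fun q : (ℝ × ℝ) × ℝ =>
      ENNReal.ofReal ((q.1.1 + ((if q.2 < q.1.2 then 1 else 0) - (1 - Real.exp (-q.1.2)))) ^ 2)) hgm,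
    ← lintegral_add_left (by fun_prop)]
  refine lintegral_mono_ae ?_
  filter_upwards [hM0] with ω hω
  set a := A ω
  set p := Real.exp (-M ω) with hp
  have hp0 : 0 < p := Real.exp_pos _
  have hp1 : p ≤ 1 := Real.exp_le_one_iff.2 (by linarith)
  have hpm : 1 - p ≤ M ω := by linarith [Real.add_one_le_exp (-M ω)]
  have e : ∀ y, ENNReal.ofReal ((a + ((if y < M ω then 1 else 0) - (1 - p))) ^ 2)
      = if y < M ω then ENNReal.ofReal ((a + p) ^ 2) else ENNReal.ofReal ((a - (1 - p)) ^ 2) := by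
    intro y
    split_ifs <;> congr 2 <;> ring
  simp_rw [e]
  rw [lintegral_ite_lt_expMeasure hω, ← hp, ← ENNReal.ofReal_mul (by positivity),
    ← ENNReal.ofReal_mul (by positivity),
    ← ENNReal.ofReal_add (mul_nonneg (by positivity) (by linarith)) (by positivity),
    ← ENNReal.ofReal_add (by positivity) hω]
  refine ENNReal.ofReal_le_ofReal ?_
  -- The cross terms cancel: the conditional mean square is `a ^ 2 + p (1 - p)`, and `p (1 - p) ≤ 1
  -- - p ≤ M`.
  nlinarith [mul_nonneg hp0.le (sub_nonneg.2 hp1)]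

/-- Given `f` and `M`, the event has probability `1 - exp (-M) ≤ M`. -/
lemma lintegral_mul_ite_lt_le [IsProbabilityMeasure P] {f : Ω → ℝ≥0∞} {M Y : Ω → ℝ}
    (hind : IndepFun (fun ω => (f ω, M ω)) Y P) (hf : Measurable f) (hM : Measurable M)
    (hY : HasLaw Y (expMeasure 1) P) (hM0 : ∀ᵐ ω ∂P, 0 ≤ M ω) :
    ∫⁻ ω, f ω * (if Y ω < M ω then 1 else 0) ∂P ≤ ∫⁻ ω, f ω * ENNReal.ofReal (M ω) ∂P := by
  have := isProbabilityMeasure_expMeasure one_pos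
  have hi : Measurable fun q : (ℝ≥0∞ × ℝ) × ℝ => (if q.2 < q.1.2 then 1 else 0 : ℝ≥0∞) :=
    Measurable.ite (measurableSet_lt (by fun_prop) (by fun_prop)) measurable_const measurable_const
  rw [lintegral_indepFun hind (hf.prodMk hM) hY
    (g := fun q : (ℝ≥0∞ × ℝ) × ℝ => q.1.1 * (if q.2 < q.1.2 then 1 else 0))
    (measurable_fst.fst.mul hi)]
  refine lintegral_mono_ae ?_
  filter_upwards [hM0] with ω hω
  rw [lintegral_const_mul _ (Measurable.ite measurableSet_Iio measurable_const measurable_const),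
    lintegral_ite_lt_expMeasure hω]
  gcongr
  rw [zero_mul, add_zero, one_mul]
  exact ENNReal.ofReal_le_ofReal (by linarith [Real.add_one_le_exp (-M ω)])

end MinRing

/-! ### Approximation of the cut number by a sum of minima -/

section Approximation

open Set
open scoped ENNReal

variable {Ω : Type*} {k : ℕ} {T : ℕ → ℕ → Ω → ℝ}

lemma isRecord_zero (k : ℕ) (T : ℕ → ℕ → Ω → ℝ) (r : ℕ) (ω : Ω) : IsRecord k T r 0 ω :=
  fun _ hu => absurd hu (Nat.not_lt_zero _)

lemma isRecord_succ_iff {r i : ℕ} {ω : Ω} :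
    IsRecord k T r (i + 1) ω ↔ ringTime T r (i + 1) ω < minRing k T 0 i ω := by
  rw [minRing, lt_runMin_iff]
  simp [IsRecord]

lemma ringTime_one (T : ℕ → ℕ → Ω → ℝ) (v : ℕ) (ω : Ω) : ringTime T 1 v ω = T 0 v ω := by
  simp [ringTime]

lemma le_ringTime {ω : Ω} (hω : ∀ i v, 0 < T i v ω) {i r : ℕ} (hi : i < r) (v : ℕ) :
    T i v ω ≤ ringTime T r v ω :=
  Finset.single_le_sum (f := fun i => T i v ω) (fun j _ => (hω j v).le) (Finset.mem_range.2 hi)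

open Classical in
lemma cutNumber_succ (k : ℕ) (T : ℕ → ℕ → Ω → ℝ) (m : ℕ) (ω : Ω) :
    (cutNumber k T (m + 1) ω : ℝ) = k + ∑ i ∈ Finset.range m, ∑ r ∈ Finset.Icc 1 k,
      (if ringTime T r (i + 1) ω < minRing k T 0 i ω then 1 else 0 : ℝ) := by
  unfold cutNumber recordCount
  push_cast
  rw [Finset.sum_comm, Finset.sum_range_succ', add_comm]
  congr 1
  · simp [isRecord_zero]
  · simp_rw [isRecord_succ_iff]

lemma abs_one_sub_exp_neg_sub_le {m : ℝ} (hm : 0 ≤ m) : |(1 - Real.exp (-m)) - m| ≤ m ^ 2 := by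
  have h1 := Real.add_one_le_exp (-m)
  have h2 : Real.exp (-m) ≤ 1 - m + m ^ 2 := by
    have h3 := Real.add_one_le_exp m
    have h4 : Real.exp (-m) * Real.exp m = 1 := by rw [← Real.exp_add]; simp
    have h5 : 0 < Real.exp (-m) := Real.exp_pos _
    have h6 : Real.exp (-m) * (m + 1) ≤ 1 := by nlinarith
    have h7 : 1 ≤ (1 - m + m ^ 2) * (m + 1) := by nlinarith [pow_nonneg hm 3]
    by_contra hlt
    push Not at hlt
    nlinarith
  rw [abs_le]
  constructor <;> nlinarith [sq_nonneg m]

/-- The sum of the compensated indicators of one-records. -/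
def compensated (k : ℕ) (T : ℕ → ℕ → Ω → ℝ) (m : ℕ) (ω : Ω) : ℝ :=
  ∑ i ∈ Finset.range m, ((if T 0 (i + 1) ω < minRing k T 0 i ω then 1 else 0)
    - (1 - Real.exp (-minRing k T 0 i ω)))

/-- The sum of minima that approximates the cut number. -/
def minSum (k : ℕ) (T : ℕ → ℕ → Ω → ℝ) (m : ℕ) (ω : Ω) : ℝ :=
  ∑ i ∈ Finset.range m, (k.factorial * hazard k (minRing k T 0 i ω)) ^ (1 / (k : ℝ))

/-- The root accounts for `k`. At any other node an `r`-record with `r ≥ 2` forces the first two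
holding times below the minimum `M`. Passing from `1 - exp (-M)` to `M`, and from `M` to the root of
the hazard, costs `M ^ 2` each. What remains of the one-record indicators is `compensated`. -/
lemma abs_cutNumber_sub_minSum_le (hk : 1 ≤ k) {ω : Ω} (hω : ∀ i v, 0 < T i v ω) (m : ℕ) :
    |(cutNumber k T (m + 1) ω : ℝ) - minSum k T m ω| ≤ k + |compensated k T m ω|
      + ∑ i ∈ Finset.range m, (k * ((if T 0 (i + 1) ω < minRing k T 0 i ω then 1 else 0)
        * (if T 1 (i + 1) ω < minRing k T 0 i ω then 1 else 0)) + 2 * minRing k T 0 i ω ^ 2) := by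
  have hk0 : k ≠ 0 := by lia
  have key : ∀ i, |∑ r ∈ Finset.Icc 1 k,
        (if ringTime T r (i + 1) ω < minRing k T 0 i ω then 1 else 0 : ℝ)
        - ((if T 0 (i + 1) ω < minRing k T 0 i ω then 1 else 0)
            - (1 - Real.exp (-minRing k T 0 i ω)))
        - (k.factorial * hazard k (minRing k T 0 i ω)) ^ (1 / (k : ℝ))|
      ≤ k * ((if T 0 (i + 1) ω < minRing k T 0 i ω then 1 else 0)
        * (if T 1 (i + 1) ω < minRing k T 0 i ω then 1 else 0)) + 2 * minRing k T 0 i ω ^ 2 := by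
    intro i
    have hm := (minRing_pos hω hk0 0 i).le
    set M := minRing k T 0 i ω
    set K : ℝ := (if T 0 (i + 1) ω < M then 1 else 0) * (if T 1 (i + 1) ω < M then 1 else 0) with hK
    have hK0 : 0 ≤ K := by rw [hK]; split_ifs <;> simp
    have h1 : (1 : ℕ) ∈ Finset.Icc 1 k := Finset.mem_Icc.2 ⟨le_rfl, hk⟩
    rw [← Finset.add_sum_erase _ _ h1, ringTime_one]
    have h2 : ∀ r ∈ (Finset.Icc 1 k).erase 1,
        (if ringTime T r (i + 1) ω < M then 1 else 0 : ℝ) ≤ K := by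
      intro r hr
      rw [Finset.mem_erase, Finset.mem_Icc] at hr
      split_ifs with hlt
      · rw [hK, if_pos ((le_ringTime hω (by lia) _).trans_lt hlt),
          if_pos ((le_ringTime hω (by lia) _).trans_lt hlt), one_mul]
      · exact hK0
    have h3 : ∑ r ∈ (Finset.Icc 1 k).erase 1,
        (if ringTime T r (i + 1) ω < M then 1 else 0 : ℝ) ≤ k * K := by
      refine (Finset.sum_le_sum h2).trans ?_
      rw [Finset.sum_const, nsmul_eq_mul]
      gcongr
      refine (Finset.card_erase_le).trans ?_
      simp
    have h4 : 0 ≤ ∑ r ∈ (Finset.Icc 1 k).erase 1,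
        (if ringTime T r (i + 1) ω < M then 1 else 0 : ℝ) :=
      Finset.sum_nonneg fun r _ => by split_ifs <;> simp
    have h5 := abs_le.1 (abs_one_sub_exp_neg_sub_le hm)
    have h6 := root_hazard_le hk0 hm
    have h7 := sub_sq_le_root_hazard hk0 hm
    rw [abs_le]
    constructor <;> linarith [h5.1, h5.2]
  have e : (cutNumber k T (m + 1) ω : ℝ) - minSum k T m ω = k + compensated k T m ω
      + ∑ i ∈ Finset.range m, (∑ r ∈ Finset.Icc 1 k,
        (if ringTime T r (i + 1) ω < minRing k T 0 i ω then 1 else 0 : ℝ)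
        - ((if T 0 (i + 1) ω < minRing k T 0 i ω then 1 else 0)
            - (1 - Real.exp (-minRing k T 0 i ω)))
        - (k.factorial * hazard k (minRing k T 0 i ω)) ^ (1 / (k : ℝ))) := by
    rw [cutNumber_succ, minSum, compensated, add_sub_assoc, ← Finset.sum_sub_distrib, add_assoc,
      ← Finset.sum_add_distrib]
    congr 1
    exact Finset.sum_congr rfl fun i _ => by ring
  rw [e]
  refine (abs_add_le _ _).trans (add_le_add ((abs_add_le _ _).trans_eq ?_)
    ((Finset.abs_sum_le_sum_abs _ _).trans (Finset.sum_le_sum fun i _ => key i)))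
  rw [abs_of_nonneg (by positivity : (0 : ℝ) ≤ k)]

variable [MeasurableSpace Ω] {P : Measure Ω}

lemma IsClock.measurable_cutNumber (h : IsClock T P) (k n : ℕ) :
    Measurable fun ω => (cutNumber k T n ω : ℝ) := by
  classical
  unfold cutNumber recordCount
  push_cast
  refine Finset.measurable_fun_sum _ fun r _ => Finset.measurable_fun_sum _ fun v _ => ?_
  refine Measurable.ite ?_ measurable_const measurable_const
  simp only [IsRecord, ofPred_forall]
  exact MeasurableSet.iInter fun u => MeasurableSet.iInter fun _ =>
    measurableSet_lt (h.measurable_ringTime r v) (h.measurable_ringTime k u)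

lemma IsClock.measurable_minSum (h : IsClock T P) (k m : ℕ) : Measurable (minSum k T m) := by
  unfold minSum
  refine Finset.measurable_fun_sum _ fun i _ => ?_
  exact (((measurable_hazard k).comp (h.measurable_minRing k 0 i)).const_mul _).pow_const _

lemma measurable_ite_lt {α : Type*} [MeasurableSpace α] {R : Type*} [MeasurableSpace R] [Zero R]
    [One R] {f g : α → ℝ} (hf : Measurable f) (hg : Measurable g) :
    Measurable fun x => (if f x < g x then 1 else 0 : R) :=
  Measurable.ite (measurableSet_lt hf hg) measurable_const measurable_const

lemma IsClock.measurable_compensated (h : IsClock T P) (k m : ℕ) :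
    Measurable (compensated k T m) := by
  unfold compensated
  refine Finset.measurable_fun_sum _ fun i _ => ?_
  have := h.measurable_minRing k 0 i
  have := measurable_ite_lt (R := ℝ) (h.measurable 0 (i + 1)) this
  fun_prop

lemma measurable_compensated_group {Ω : Type*} (T : ℕ → ℕ → Ω → ℝ) (k m : ℕ) :
    Measurable[⨆ iv ∈ {iv : ℕ × ℕ | iv.2 ≤ m}, MeasurableSpace.comap (T iv.1 iv.2) inferInstance]
      (compensated k T m) := by
  unfold compensated
  refine Finset.measurable_fun_sum _ fun i hi => ?_
  have him := Finset.mem_range.1 hi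
  let _ : MeasurableSpace Ω := ⨆ iv ∈ {iv : ℕ × ℕ | iv.2 ≤ m},
    MeasurableSpace.comap (T iv.1 iv.2) inferInstance
  have h1 : Measurable (minRing k T 0 i) := measurable_minRing_group T k 0 i fun l j hj => by
    simp only [zero_add, mem_ofPred_eq]; lia
  have h2 : Measurable (T 0 (i + 1)) :=
    measurable_iSup_comap (fun iv : ℕ × ℕ => T iv.1 iv.2) (i := (0, i + 1)) (by
      simp only [mem_ofPred_eq]; lia)
  have := measurable_ite_lt (R := ℝ) h2 h1
  fun_prop

/-- Orthogonality of martingale increments: given the nodes up to `m`, the next indicator is centred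
and has variance at most the current minimum. -/
lemma IsClock.lintegral_compensated_sq_le [IsProbabilityMeasure P] (h : IsClock T P) (hk : k ≠ 0)
    (m : ℕ) : ∫⁻ ω, ENNReal.ofReal (compensated k T m ω ^ 2) ∂P
      ≤ ∑ i ∈ Finset.range m, ∫⁻ ω, ENNReal.ofReal (minRing k T 0 i ω) ∂P := by
  induction m with
  | zero => simp [compensated]
  | succ m ih =>
    rw [Finset.sum_range_succ]
    refine le_trans ?_ (add_le_add_left ih _)
    simp only [compensated, Finset.sum_range_succ]
    refine lintegral_sq_add_compensated (A := compensated k T m) ?_ (h.measurable_compensated k m)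
      (h.measurable_minRing k 0 m) (h.law 0 (m + 1)) ?_
    · refine indepFun_of_disjoint h.indep (fun iv => h.measurable _ _)
        (S := {iv | iv.2 ≤ m}) (T := {(0, m + 1)}) (by simp) ?_ ?_
      · refine Measurable.prodMk (measurable_compensated_group T k m) ?_
        exact measurable_minRing_group T k 0 m fun i j hj => by simpa using hj
      · exact measurable_iSup_comap (fun iv : ℕ × ℕ => T iv.1 iv.2) (mem_singleton (0, m + 1))
    · filter_upwards [h.ae_pos] with ω hω using (minRing_pos hω hk 0 m).le

/-- The two holding times of node `i + 1` are integrated out one after the other; each contributes a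
factor at most the minimum. -/
lemma IsClock.lintegral_ite_mul_ite_le [IsProbabilityMeasure P] (h : IsClock T P) (hk : k ≠ 0)
    (i : ℕ) : ∫⁻ ω, (if T 0 (i + 1) ω < minRing k T 0 i ω then 1 else 0)
        * (if T 1 (i + 1) ω < minRing k T 0 i ω then 1 else 0) ∂P
      ≤ ∫⁻ ω, ENNReal.ofReal (minRing k T 0 i ω ^ 2) ∂P := by
  have hM0 : ∀ᵐ ω ∂P, 0 ≤ minRing k T 0 i ω := by
    filter_upwards [h.ae_pos] with ω hω using (minRing_pos hω hk 0 i).le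
  have hM := h.measurable_minRing k 0 i
  have hg : ∀ S : Set (ℕ × ℕ), {iv | iv.2 ≤ i} ⊆ S → Measurable[⨆ iv ∈ S,
      MeasurableSpace.comap (T iv.1 iv.2) inferInstance] (minRing k T 0 i) := fun S hS =>
    measurable_minRing_group T k 0 i fun l j hj => hS (by simpa using hj)
  have hc : ∀ l, ∀ S : Set (ℕ × ℕ), (l, i + 1) ∈ S → Measurable[⨆ iv ∈ S,
      MeasurableSpace.comap (T iv.1 iv.2) inferInstance] (T l (i + 1)) := fun l S hS =>
    measurable_iSup_comap (fun iv : ℕ × ℕ => T iv.1 iv.2) hS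
  refine (lintegral_mul_ite_lt_le ?_ (measurable_ite_lt (h.measurable 0 (i + 1)) hM) hM
    (h.law 1 (i + 1)) hM0).trans ?_
  · refine indepFun_of_disjoint h.indep (fun iv => h.measurable _ _)
      (S := {iv | iv.2 ≤ i} ∪ {(0, i + 1)}) (T := {(1, i + 1)}) (by simp) ?_
      (hc 1 _ (mem_singleton _))
    let _ : MeasurableSpace Ω := ⨆ iv ∈ ({iv | iv.2 ≤ i} ∪ {(0, i + 1)} : Set (ℕ × ℕ)),
      MeasurableSpace.comap (T iv.1 iv.2) inferInstance
    have h1 := hg _ (subset_union_left (t := {(0, i + 1)}))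
    exact (measurable_ite_lt (hc 0 _ (by simp)) h1).prodMk h1
  · simp_rw [mul_comm _ (ENNReal.ofReal _)]
    refine (lintegral_mul_ite_lt_le ?_ hM.ennreal_ofReal hM (h.law 0 (i + 1)) hM0).trans_eq ?_
    · refine indepFun_of_disjoint h.indep (fun iv => h.measurable _ _)
        (S := {iv | iv.2 ≤ i}) (T := {(0, i + 1)}) (by simp) ?_ (hc 0 _ (mem_singleton _))
      have h1 := hg _ subset_rfl
      exact (@Measurable.ennreal_ofReal _ (_) _ h1).prodMk h1
    · refine lintegral_congr_ae ?_
      filter_upwards [hM0] with ω hω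
      rw [← ENNReal.ofReal_mul hω, sq]

/-- The compensated sum `D` is controlled only in mean square; `|D| ≤ l + D ^ 2 / l` avoids a square
root and leaves `l` free to be optimised. -/
lemma IsClock.lintegral_abs_cutNumber_sub_le [IsProbabilityMeasure P] (h : IsClock T P)
    (hk : k ≠ 0) : ∃ C : ℝ, 0 < C ∧ ∀ (m : ℕ) (l : ℝ), 0 < l →
      ∫⁻ ω, ENNReal.ofReal |(cutNumber k T (m + 1) ω : ℝ) - minSum k T m ω| ∂P
      ≤ ENNReal.ofReal (C * (1 + l + (∑ i ∈ Finset.range m, ((i + 1 : ℕ) : ℝ) ^ (-(1 / (k : ℝ)))) / l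
        + ∑ i ∈ Finset.range m, ((i + 1 : ℕ) : ℝ) ^ (-(2 / (k : ℝ))))) := by
  obtain ⟨C₁, hC₁, h₁⟩ := h.exists_lintegral_minRing_pow_le hk 1
  obtain ⟨C₂, hC₂, h₂⟩ := h.exists_lintegral_minRing_pow_le hk 2
  simp only [pow_one, Nat.cast_one] at h₁
  simp only [Nat.cast_ofNat] at h₂
  refine ⟨k + 1 + C₁ + (k + 2) * C₂, by positivity, fun m l hl => ?_⟩
  set s₁ := ∑ i ∈ Finset.range m, ((i + 1 : ℕ) : ℝ) ^ (-(1 / (k : ℝ))) with hs₁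
  set s₂ := ∑ i ∈ Finset.range m, ((i + 1 : ℕ) : ℝ) ^ (-(2 / (k : ℝ))) with hs₂
  have hs₁0 : 0 ≤ s₁ := Finset.sum_nonneg fun i _ => by positivity
  have hs₂0 : 0 ≤ s₂ := Finset.sum_nonneg fun i _ => by positivity
  have hM := fun i => h.measurable_minRing k 0 i
  have hD := h.measurable_compensated k m
  have hi := fun j i => measurable_ite_lt (R := ℝ≥0∞) (h.measurable j (i + 1)) (hM i)
  have hpt : ∀ᵐ ω ∂P, ENNReal.ofReal |(cutNumber k T (m + 1) ω : ℝ) - minSum k T m ω|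
      ≤ ENNReal.ofReal (k + l) + ENNReal.ofReal (1 / l) * ENNReal.ofReal (compensated k T m ω ^ 2)
        + ∑ i ∈ Finset.range m, (k * ((if T 0 (i + 1) ω < minRing k T 0 i ω then 1 else 0)
        * (if T 1 (i + 1) ω < minRing k T 0 i ω then 1 else 0))
        + 2 * ENNReal.ofReal (minRing k T 0 i ω ^ 2)) := by
    filter_upwards [h.ae_pos] with ω hω
    refine (ENNReal.ofReal_le_ofReal (abs_cutNumber_sub_minSum_le (by lia) hω m)).trans ?_
    have hamgm : |compensated k T m ω| ≤ l + 1 / l * compensated k T m ω ^ 2 := by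
      set D := compensated k T m ω
      rw [← sq_abs D]
      have h3 : 0 ≤ (l - |D|) ^ 2 / l := by positivity
      have h4 : (l - |D|) ^ 2 / l = l - 2 * |D| + 1 / l * |D| ^ 2 := by
        field_simp
        ring
      linarith [abs_nonneg D]
    rw [← ENNReal.ofReal_mul (by positivity), ← ENNReal.ofReal_add (by positivity) (by positivity)]
    refine (ENNReal.ofReal_add_le).trans (add_le_add (ENNReal.ofReal_le_ofReal (by linarith)) ?_)
    rw [ENNReal.ofReal_sum_of_nonneg fun i _ => by positivity]
    refine Finset.sum_le_sum fun i _ => ?_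
    refine ENNReal.ofReal_add_le.trans (add_le_add (le_of_eq ?_) (le_of_eq ?_))
    · rw [ENNReal.ofReal_mul (by positivity), ENNReal.ofReal_natCast]
      congr 1
      split_ifs <;> simp
    · rw [ENNReal.ofReal_mul (by norm_num), ENNReal.ofReal_ofNat]
  have hms : ∀ i, Measurable fun ω => (k * ((if T 0 (i + 1) ω < minRing k T 0 i ω then 1 else 0)
        * (if T 1 (i + 1) ω < minRing k T 0 i ω then 1 else 0)) : ℝ≥0∞) := fun i =>
    ((hi 0 i).mul (hi 1 i)).const_mul _
  refine (lintegral_mono_ae hpt).trans ?_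
  rw [lintegral_add_left (by fun_prop), lintegral_add_left (by fun_prop),
    lintegral_const_mul' _ _ ENNReal.ofReal_ne_top, lintegral_finsetSum _ (fun i _ => by
      have := hms i
      have := hM i
      fun_prop)]
  have b1 : ∫⁻ ω, ENNReal.ofReal (compensated k T m ω ^ 2) ∂P ≤ ENNReal.ofReal (C₁ * s₁) := by
    refine (h.lintegral_compensated_sq_le hk m).trans ?_
    rw [hs₁, Finset.mul_sum, ENNReal.ofReal_sum_of_nonneg fun i _ => by positivity]
    exact Finset.sum_le_sum fun i _ => h₁ 0 i
  have b2 : ∀ i, ∫⁻ ω, (k * ((if T 0 (i + 1) ω < minRing k T 0 i ω then 1 else 0)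
        * (if T 1 (i + 1) ω < minRing k T 0 i ω then 1 else 0))
        + 2 * ENNReal.ofReal (minRing k T 0 i ω ^ 2)) ∂P
      ≤ ENNReal.ofReal ((k + 2) * C₂ * ((i + 1 : ℕ) : ℝ) ^ (-(2 / (k : ℝ)))) := by
    intro i
    rw [lintegral_add_left (hms i), lintegral_const_mul' _ _ (by simp),
      lintegral_const_mul' _ _ (by simp)]
    calc _ ≤ (k : ℝ≥0∞) * ENNReal.ofReal (C₂ * ((i + 1 : ℕ) : ℝ) ^ (-(2 / (k : ℝ))))
          + 2 * ENNReal.ofReal (C₂ * ((i + 1 : ℕ) : ℝ) ^ (-(2 / (k : ℝ)))) := by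
          gcongr
          · exact (h.lintegral_ite_mul_ite_le hk i).trans (h₂ 0 i)
          · exact h₂ 0 i
      _ = _ := by
          rw [← add_mul, ← ENNReal.ofReal_natCast, ← ENNReal.ofReal_ofNat,
            ← ENNReal.ofReal_add (by positivity) (by norm_num), ← ENNReal.ofReal_mul (by positivity),
            mul_assoc]
  calc _ ≤ ENNReal.ofReal (k + l) + ENNReal.ofReal (1 / l) * ENNReal.ofReal (C₁ * s₁)
        + ∑ i ∈ Finset.range m, ENNReal.ofReal ((k + 2) * C₂ * ((i + 1 : ℕ) : ℝ) ^ (-(2 / (k : ℝ)))) := by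
        gcongr with i
        · simp
        · exact b2 i
    _ = ENNReal.ofReal (k + l + 1 / l * (C₁ * s₁) + (k + 2) * C₂ * s₂) := by
        rw [← ENNReal.ofReal_sum_of_nonneg fun i _ => by positivity, ← Finset.mul_sum,
          ← ENNReal.ofReal_mul (by positivity), ← ENNReal.ofReal_add (by positivity) (by positivity),
          ← ENNReal.ofReal_add (by positivity) (by positivity)]
    _ ≤ _ := by
        refine ENNReal.ofReal_le_ofReal ?_
        have e1 : 1 / l * (C₁ * s₁) = C₁ * (s₁ / l) := by ring
        rw [e1]
        have p1 : 0 ≤ s₁ / l := by positivity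
        have hk0 : (0 : ℝ) ≤ k := by positivity
        have q : ∀ c x : ℝ, 0 ≤ c → 0 ≤ x → 0 ≤ c * x := fun _ _ => mul_nonneg
        nlinarith [q _ _ hk0 hl.le, q _ _ hk0 p1, q _ _ hk0 hs₂0, q _ _ hC₁.le hl.le,
          q _ _ hC₁.le hs₂0, q _ _ hC₂.le hl.le, q _ _ hC₂.le p1, q _ _ (q _ _ hk0 hC₂.le) hl.le,
          q _ _ (q _ _ hk0 hC₂.le) p1, q _ _ hk0 hC₂.le]

/-- With `a = 1 - 1/k` the sum of the first moments is of order `n ^ a`, so `l = n ^ (a/2)` makes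
both `l` and that sum over `l` of order `n ^ (a/2)`, which is negligible. -/
lemma IsClock.tendsto_lintegral_scaledCutNumber_sub [IsProbabilityMeasure P] (h : IsClock T P)
    (hk : 2 ≤ k) :
    Tendsto (fun n : ℕ => ∫⁻ ω, ENNReal.ofReal |scaledCutNumber k T n ω
      - minSum k T (n - 1) ω / (n : ℝ) ^ (1 - 1 / (k : ℝ))| ∂P) atTop (𝓝 0) := by
  have hk' : (2 : ℝ) ≤ k := by exact_mod_cast hk
  have hk0 : (0 : ℝ) < k := by linarith
  obtain ⟨C, hC, hCm⟩ := h.lintegral_abs_cutNumber_sub_le (k := k) (by lia)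
  have hβ₁ : 1 / (k : ℝ) < 1 := one_div_cast_lt_one hk
  -- The exponent `2/k` is weakened to `3/(2k)`, which stays below `1` even for `k = 2`, where the
  -- harmonic sum would bring in a logarithm, and is still larger than `1/k`.
  have hβ₂ : 3 / (2 * (k : ℝ)) < 1 := by rw [div_lt_one (by positivity)]; linarith
  obtain ⟨D₁, hD₁, h₁⟩ := exists_sum_rpow_le (by positivity) hβ₁
  obtain ⟨D₂, hD₂, h₂⟩ := exists_sum_rpow_le (by positivity) hβ₂
  set a : ℝ := 1 - 1 / (k : ℝ) with ha
  have ha0 : 0 < a := by rw [ha]; linarith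
  have hlim : Tendsto (fun n : ℕ => ENNReal.ofReal (C * ((n : ℝ) ^ (-a) + (1 + D₁) * (n : ℝ) ^ (-(a / 2))
      + D₂ * (n : ℝ) ^ (-(1 / (2 * (k : ℝ))))))) atTop (𝓝 0) := by
    have hz : ∀ b : ℝ, 0 < b → Tendsto (fun n : ℕ => (n : ℝ) ^ (-b)) atTop (𝓝 0) := fun b hb =>
      (tendsto_rpow_neg_atTop hb).comp tendsto_natCast_atTop_atTop
    have := (((hz a ha0).add ((hz (a / 2) (by positivity)).const_mul (1 + D₁))).add
      ((hz (1 / (2 * (k : ℝ))) (by positivity)).const_mul D₂)).const_mul C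
    have := ENNReal.tendsto_ofReal this
    simpa using this
  refine tendsto_of_tendsto_of_tendsto_of_le_of_le' tendsto_const_nhds hlim
    (Eventually.of_forall fun _ => zero_le) ?_
  filter_upwards [eventually_gt_atTop 0] with n hn
  obtain ⟨m, rfl⟩ := Nat.exists_eq_succ_of_ne_zero hn.ne'
  rw [Nat.succ_sub_one]
  set x : ℝ := ((m + 1 : ℕ) : ℝ) with hx
  have hx0 : 0 < x := by positivity
  have hmx : (m : ℝ) ≤ x := by rw [hx]; push_cast; linarith
  have e1 : ∀ ω, ENNReal.ofReal |scaledCutNumber k T (m + 1) ω - minSum k T m ω / x ^ a|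
      = ENNReal.ofReal (x ^ (-a))
        * ENNReal.ofReal |(cutNumber k T (m + 1) ω : ℝ) - minSum k T m ω| := by
    intro ω
    rw [scaledCutNumber, ← ha, ← hx, ← sub_div, abs_div, abs_of_pos (by positivity : 0 < x ^ a),
      ← ENNReal.ofReal_mul (by positivity), Real.rpow_neg hx0.le]
    congr 1
    rw [div_eq_inv_mul]
  simp_rw [e1]
  rw [lintegral_const_mul' _ _ ENNReal.ofReal_ne_top]
  refine (mul_le_mul' le_rfl (hCm m (x ^ (a / 2)) (by positivity))).trans ?_
  rw [← ENNReal.ofReal_mul (by positivity)]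
  refine ENNReal.ofReal_le_ofReal ?_
  have s1 : ∑ i ∈ Finset.range m, ((i + 1 : ℕ) : ℝ) ^ (-(1 / (k : ℝ))) ≤ D₁ * x ^ a :=
    (h₁ m).trans (by gcongr)
  have s2 : ∑ i ∈ Finset.range m, ((i + 1 : ℕ) : ℝ) ^ (-(2 / (k : ℝ)))
      ≤ D₂ * x ^ (1 - 3 / (2 * (k : ℝ))) := by
    refine le_trans (Finset.sum_le_sum fun i _ => ?_) ((h₂ m).trans ?_)
    · refine Real.rpow_le_rpow_of_exponent_le (by push_cast; linarith) ?_
      rw [neg_le_neg_iff, div_le_div_iff₀ (by positivity) (by positivity)]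
      linarith
    · gcongr
  have r1 : x ^ (-a) * x ^ (a / 2) = x ^ (-(a / 2)) := by
    rw [← Real.rpow_add hx0]; ring_nf
  have r2 : x ^ (-a) * (x ^ a / x ^ (a / 2)) = x ^ (-(a / 2)) := by
    rw [← Real.rpow_sub hx0, ← Real.rpow_add hx0]; ring_nf
  have r3 : x ^ (-a) * x ^ (1 - 3 / (2 * (k : ℝ))) = x ^ (-(1 / (2 * (k : ℝ)))) := by
    rw [← Real.rpow_add hx0, ha]
    congr 1
    field_simp
    ring
  calc x ^ (-a) * (C * (1 + x ^ (a / 2)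
        + (∑ i ∈ Finset.range m, ((i + 1 : ℕ) : ℝ) ^ (-(1 / (k : ℝ)))) / x ^ (a / 2)
        + ∑ i ∈ Finset.range m, ((i + 1 : ℕ) : ℝ) ^ (-(2 / (k : ℝ)))))
      ≤ x ^ (-a) * (C * (1 + x ^ (a / 2) + D₁ * x ^ a / x ^ (a / 2)
        + D₂ * x ^ (1 - 3 / (2 * (k : ℝ))))) := by gcongr
    _ = C * (x ^ (-a) + (x ^ (-a) * x ^ (a / 2) + D₁ * (x ^ (-a) * (x ^ a / x ^ (a / 2))))
        + D₂ * (x ^ (-a) * x ^ (1 - 3 / (2 * (k : ℝ))))) := by ring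
    _ = _ := by rw [r1, r2, r3]; ring

end Approximation

/-! ### Uniform bounds for the moments of the cut number -/

section UniformMoments

open Set
open scoped ENNReal

variable {Ω : Type*} {k : ℕ} {T : ℕ → ℕ → Ω → ℝ}

/-- The indicator that `v` is a one-record of the path that starts at the node `s`. -/
def recordFrom (k : ℕ) (T : ℕ → ℕ → Ω → ℝ) (s v : ℕ) (ω : Ω) : ℝ≥0∞ :=
  if v ≤ s then 1 else if T 0 v ω < minRing k T s (v - s - 1) ω then 1 else 0

open Classical in
-- Forgetting the ancestors before `s` only makes records easier, and leaves an indicator that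
-- depends on the nodes from `s` to `v` alone.
lemma ite_isRecord_le_recordFrom (k : ℕ) (T : ℕ → ℕ → Ω → ℝ) (s v : ℕ) (ω : Ω) :
    (if IsRecord k T 1 v ω then 1 else 0 : ℝ≥0∞) ≤ recordFrom k T s v ω := by
  unfold recordFrom
  by_cases hv : v ≤ s
  · rw [if_pos hv]; split_ifs <;> simp
  rw [if_neg hv]
  by_cases hr : IsRecord k T 1 v ω
  · rw [if_pos hr, if_pos]
    rw [minRing, lt_runMin_iff]
    intro j hj
    have := hr (s + j) (by lia)
    rwa [ringTime_one] at this
  · simp [hr]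

lemma measurable_recordFrom_group (T : ℕ → ℕ → Ω → ℝ) {k s v : ℕ} (hsv : s ≤ v) :
    Measurable[⨆ iv ∈ {iv : ℕ × ℕ | iv.2 ∈ Icc s v},
      MeasurableSpace.comap (T iv.1 iv.2) inferInstance] (recordFrom k T s v) := by
  let _ : MeasurableSpace Ω := ⨆ iv ∈ {iv : ℕ × ℕ | iv.2 ∈ Icc s v},
    MeasurableSpace.comap (T iv.1 iv.2) inferInstance
  unfold recordFrom
  by_cases hv : v ≤ s
  · simp only [if_pos hv]; exact measurable_const
  simp only [if_neg hv]
  refine measurable_ite_lt (measurable_iSup_comap (fun iv : ℕ × ℕ => T iv.1 iv.2) (i := (0, v)) ?_)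
    (measurable_minRing_group T k s _ fun i j hj => ?_)
  · exact ⟨hsv, le_rfl⟩
  · exact ⟨Nat.le_add_right _ _, by lia⟩

open Classical in
-- An `r`-record is also a one-record, since the first ring comes no later than the `r`-th.
lemma cutNumber_le {ω : Ω} (hω : ∀ i v, 0 < T i v ω) (k n : ℕ) :
    cutNumber k T n ω ≤ k * ∑ v ∈ Finset.range n, if IsRecord k T 1 v ω then 1 else 0 := by
  unfold cutNumber
  calc ∑ r ∈ Finset.Icc 1 k, recordCount k T n r ω
      ≤ ∑ r ∈ Finset.Icc 1 k, ∑ v ∈ Finset.range n, (if IsRecord k T 1 v ω then 1 else 0) := by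
        refine Finset.sum_le_sum fun r hr => Finset.sum_le_sum fun v _ => ?_
        by_cases hrec : IsRecord k T r v ω
        · have h1 : IsRecord k T 1 v ω := fun u hu => by
            rw [ringTime_one]
            exact (le_ringTime hω (by have := (Finset.mem_Icc.1 hr).1; lia) v).trans_lt (hrec u hu)
          simp [h1, hrec]
        · simp [hrec]
    _ = _ := by simp

lemma ennreal_add_pow_le (a b : ℝ≥0∞) (p : ℕ) : (a + b) ^ p ≤ 2 ^ p * (a ^ p + b ^ p) := by
  rcases le_total a b with h | h
  · calc (a + b) ^ p ≤ (2 * b) ^ p := by gcongr; rw [two_mul]; gcongr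
      _ ≤ _ := by rw [mul_pow]; gcongr; exact le_add_self
  · calc (a + b) ^ p ≤ (2 * a) ^ p := by gcongr; rw [two_mul]; gcongr
      _ ≤ _ := by rw [mul_pow]; gcongr; exact le_self_add

variable [MeasurableSpace Ω] {P : Measure Ω}

lemma IsClock.exists_lintegral_recordFrom_le [IsProbabilityMeasure P] (h : IsClock T P)
    (hk : k ≠ 0) : ∃ c : ℝ, 0 < c ∧ ∀ s v, s ≤ v → ∫⁻ ω, recordFrom k T s v ω ∂P
      ≤ ENNReal.ofReal (c * ((v - s + 1 : ℕ) : ℝ) ^ (-(1 / (k : ℝ)))) := by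
  obtain ⟨C, hC, hCm⟩ := h.exists_lintegral_minRing_pow_le hk 1
  simp only [pow_one, Nat.cast_one] at hCm
  have hk1 : 1 / (k : ℝ) ≤ 1 :=
    (div_le_one (by positivity)).2 (by exact_mod_cast Nat.one_le_iff_ne_zero.2 hk)
  refine ⟨1 + 2 * C, by positivity, fun s v hsv => ?_⟩
  obtain ⟨w, rfl⟩ := Nat.exists_eq_add_of_le hsv
  cases w with
  | zero =>
    simp only [recordFrom, add_zero, le_refl, if_true, lintegral_const, measure_univ, mul_one,
      Nat.sub_self, zero_add, Nat.cast_one, Real.one_rpow]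
    rw [← ENNReal.ofReal_one]
    exact ENNReal.ofReal_le_ofReal (by linarith)
  | succ w =>
    have e : ∀ ω, recordFrom k T s (s + (w + 1)) ω
        = 1 * (if T 0 (s + (w + 1)) ω < minRing k T s w ω then 1 else 0) := by
      intro ω
      rw [recordFrom, if_neg (by lia), one_mul, show s + (w + 1) - s - 1 = w by lia]
    simp_rw [e]
    refine (lintegral_mul_ite_lt_le (f := fun _ => 1) ?_ measurable_const
      (h.measurable_minRing k s w) (h.law 0 _) ?_).trans ?_
    · refine indepFun_of_disjoint h.indep (fun iv => h.measurable _ _)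
        (S := {iv | iv.2 ≤ s + w}) (T := {(0, s + (w + 1))}) (by simp) ?_ ?_
      · exact measurable_const.prodMk (measurable_minRing_group T k s w fun i j hj => by
          simpa using hj)
      · exact measurable_iSup_comap (fun iv : ℕ × ℕ => T iv.1 iv.2) (mem_singleton _)
    · filter_upwards [h.ae_pos] with ω hω using (minRing_pos hω hk s w).le
    · simp_rw [one_mul]
      refine (hCm s w).trans (ENNReal.ofReal_le_ofReal ?_)
      rw [show s + (w + 1) - s + 1 = w + 2 by lia]
      have hw : (0 : ℝ) < ((w + 1 : ℕ) : ℝ) := by positivity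
      have hw2 : (0 : ℝ) < ((w + 2 : ℕ) : ℝ) := by positivity
      have h2 : ((w + 2 : ℕ) : ℝ) ≤ 2 * ((w + 1 : ℕ) : ℝ) := by push_cast; linarith
      -- The window before `v` has `w + 1` nodes, while the claim is stated with `w + 2`; a factor
      -- `2` makes up for this.
      have h3 : ((w + 1 : ℕ) : ℝ) ^ (-(1 / (k : ℝ))) ≤ 2 * ((w + 2 : ℕ) : ℝ) ^ (-(1 / (k : ℝ))) := by
        have h4 : (2 * ((w + 1 : ℕ) : ℝ)) ^ (-(1 / (k : ℝ))) ≤ ((w + 2 : ℕ) : ℝ) ^ (-(1 / (k : ℝ))) :=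
          Real.rpow_le_rpow_of_nonpos hw2 h2 (by simp)
        rw [Real.mul_rpow (by norm_num) hw.le] at h4
        have h5 : (2 : ℝ)⁻¹ ≤ 2 ^ (-(1 / (k : ℝ))) := by
          rw [← Real.rpow_neg_one]
          exact Real.rpow_le_rpow_of_exponent_le (by norm_num) (by linarith)
        have h6 : 0 < ((w + 1 : ℕ) : ℝ) ^ (-(1 / (k : ℝ))) := by positivity
        nlinarith
      have h7 : 0 < ((w + 2 : ℕ) : ℝ) ^ (-(1 / (k : ℝ))) := by positivity
      nlinarith

open Classical in
-- The ordered-sum device again, now for indicators, so that `δ = 1` and exactly `p` is subtracted.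
lemma IsClock.exists_lintegral_sub_pow_le [IsProbabilityMeasure P] (h : IsClock T P)
    (hk : 2 ≤ k) (p : ℕ) : ∃ C : ℝ, 0 < C ∧ ∀ n : ℕ,
      ∫⁻ ω, (∑ v ∈ Finset.range n, (if IsRecord k T 1 v ω then 1 else 0 : ℝ≥0∞) - p) ^ p ∂P
        ≤ ENNReal.ofReal (C * (n : ℝ) ^ ((p : ℝ) * (1 - 1 / (k : ℝ)))) := by
  obtain ⟨c, hc, hcm⟩ := h.exists_lintegral_recordFrom_le (k := k) (by lia)
  have hβ := one_div_cast_lt_one hk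
  have hG1 := Real.Gamma_pos_of_pos (s := 1 - 1 / (k : ℝ)) (by linarith)
  have hG2 := Real.Gamma_pos_of_pos (s := (p : ℝ) * (1 - 1 / (k : ℝ)) + 1)
    (by have := mul_nonneg p.cast_nonneg (sub_nonneg.2 hβ.le); linarith)
  set e : ℕ → ℝ := fun w => c * ((w + 1 : ℕ) : ℝ) ^ (-(1 / (k : ℝ)))
  have he : ∀ w, 0 ≤ e w := fun w => by positivity
  refine ⟨p.factorial * ((c * Real.Gamma (1 - 1 / (k : ℝ))) ^ p
    / Real.Gamma (p * (1 - 1 / (k : ℝ)) + 1)), by positivity, fun n => ?_⟩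
  calc ∫⁻ ω, (∑ v ∈ Finset.range n, (if IsRecord k T 1 v ω then 1 else 0 : ℝ≥0∞) - p) ^ p ∂P
      ≤ ∫⁻ ω, p.factorial * gapSum (fun s v => recordFrom k T s v ω) n p 0 ∂P := by
        refine lintegral_mono fun ω => ?_
        refine le_trans ?_ (mul_le_mul' le_rfl (gapSum_mono
          (fun s v _ => ite_isRecord_le_recordFrom k T s v ω) n p 0))
        have := pow_le_factorial_mul_gapSum_ennreal (n := n) (δ := 1)
          (A := fun v => if IsRecord k T 1 v ω then 1 else 0)
          (fun v => by split_ifs <;> simp) (fun v _ => by split_ifs <;> simp) (by simp) p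
        rwa [mul_one] at this
    _ ≤ p.factorial * ENNReal.ofReal (convSum e p (n - 0)) := by
        rw [lintegral_const_mul' _ _ (by simp)]
        gcongr
        exact lintegral_gapSum_le h.indep (fun iv => h.measurable _ _) Prod.snd
          (fun s v hsv => measurable_recordFrom_group T hsv) he hcm n p 0
    _ ≤ _ := by
        rw [← ENNReal.ofReal_natCast, ← ENNReal.ofReal_mul (by positivity), mul_assoc]
        refine ENNReal.ofReal_le_ofReal ?_
        gcongr
        exact convSum_le he hc.le (by positivity) hβ (fun w => le_rfl) p n

lemma scaledCutNumber_nonneg {Ω : Type*} (k : ℕ) (T : ℕ → ℕ → Ω → ℝ) (n : ℕ) (ω : Ω) :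
    0 ≤ scaledCutNumber k T n ω := by
  unfold scaledCutNumber
  positivity

lemma scaledCutNumber_zero {Ω : Type*} (k : ℕ) (T : ℕ → ℕ → Ω → ℝ) (ω : Ω) :
    scaledCutNumber k T 0 ω = 0 := by
  simp [scaledCutNumber, cutNumber, recordCount]

lemma IsClock.measurable_scaledCutNumber (h : IsClock T P) (k n : ℕ) :
    Measurable (scaledCutNumber k T n) :=
  (h.measurable_cutNumber k n).div_const _

lemma IsClock.exists_lintegral_scaledCutNumber_pow_le [IsProbabilityMeasure P] (h : IsClock T P)
    (hk : 2 ≤ k) (p : ℕ) : ∃ C : ℝ, ∀ n : ℕ,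
      ∫⁻ ω, ENNReal.ofReal (scaledCutNumber k T n ω) ^ p ∂P ≤ ENNReal.ofReal C := by
  classical
  obtain ⟨C, hC, hCm⟩ := h.exists_lintegral_sub_pow_le hk p
  refine ⟨1 + k ^ p * (2 ^ p * (C + p ^ p)), fun n => ?_⟩
  -- For `n = 0` the rescaled number is `0` and its `p`-th power at most `1` (it is `1` when `p =
  -- 0`), hence the summand `1` in the constant.
  rcases Nat.eq_zero_or_pos n with rfl | hn
  · simp only [scaledCutNumber_zero, ENNReal.ofReal_zero, lintegral_const, measure_univ, mul_one]
    refine (pow_le_one₀ zero_le zero_le_one).trans ?_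
    rw [← ENNReal.ofReal_one]
    refine ENNReal.ofReal_le_ofReal (le_add_of_nonneg_right (by positivity))
  have hn1 : (1 : ℝ) ≤ n := by exact_mod_cast hn
  have hn0 : (0 : ℝ) < n := by linarith
  have hβ := one_div_cast_lt_one hk
  set a : ℝ := 1 - 1 / (k : ℝ) with ha
  set x : ℝ := (n : ℝ) ^ ((p : ℝ) * a) with hx
  have hx1 : 1 ≤ x := Real.one_le_rpow hn1 (mul_nonneg p.cast_nonneg (by linarith))
  have hx0 : 0 < x := by linarith
  set N : Ω → ℝ≥0∞ := fun ω => ∑ v ∈ Finset.range n, (if IsRecord k T 1 v ω then 1 else 0 : ℝ≥0∞)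
  have hpt : ∀ᵐ ω ∂P, ENNReal.ofReal (scaledCutNumber k T n ω) ^ p
      ≤ ENNReal.ofReal (x⁻¹ * (k ^ p * 2 ^ p)) * ((N ω - p) ^ p + ENNReal.ofReal (p ^ p)) := by
    filter_upwards [h.ae_pos] with ω hω
    have hle : ENNReal.ofReal (cutNumber k T n ω : ℝ) ≤ k * N ω := by
      rw [ENNReal.ofReal_natCast]
      have := cutNumber_le hω k n
      calc ((cutNumber k T n ω : ℕ) : ℝ≥0∞)
          ≤ ((k * ∑ v ∈ Finset.range n, if IsRecord k T 1 v ω then 1 else 0 : ℕ) : ℝ≥0∞) := by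
            exact_mod_cast this
        _ = k * N ω := by push_cast; rfl
    have hNle : N ω ≤ N ω - p + p := le_tsub_add
    calc ENNReal.ofReal (scaledCutNumber k T n ω) ^ p
        = ENNReal.ofReal x⁻¹ * ENNReal.ofReal (cutNumber k T n ω : ℝ) ^ p := by
          rw [scaledCutNumber, ← ha, ← ENNReal.ofReal_pow (by positivity),
            ← ENNReal.ofReal_pow (by positivity), ← ENNReal.ofReal_mul (by positivity), div_pow, hx,
            mul_comm (p : ℝ) a, Real.rpow_mul hn0.le, Real.rpow_natCast, inv_mul_eq_div]
      _ ≤ ENNReal.ofReal x⁻¹ * (k * (N ω - p + p)) ^ p := by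
          gcongr
          exact hle.trans (by gcongr)
      _ ≤ ENNReal.ofReal x⁻¹ * (k ^ p * (2 ^ p * ((N ω - p) ^ p + (p : ℝ≥0∞) ^ p))) := by
          rw [mul_pow]
          gcongr
          exact ennreal_add_pow_le _ _ _
      _ = _ := by
          rw [ENNReal.ofReal_mul (by positivity), ENNReal.ofReal_mul (by positivity),
            ENNReal.ofReal_pow (by positivity), ENNReal.ofReal_pow (by positivity),
            ENNReal.ofReal_pow (by positivity), ENNReal.ofReal_natCast, ENNReal.ofReal_natCast,
            ENNReal.ofReal_ofNat]
          ring
  refine (lintegral_mono_ae hpt).trans ?_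
  rw [lintegral_const_mul' _ _ ENNReal.ofReal_ne_top, lintegral_add_right _ measurable_const,
    lintegral_const, measure_univ, mul_one]
  refine (mul_le_mul' le_rfl (add_le_add_left (hCm n) _)).trans ?_
  rw [← ENNReal.ofReal_add (by positivity) (by positivity), ← ENNReal.ofReal_mul (by positivity)]
  refine ENNReal.ofReal_le_ofReal ?_
  have hle : C * x + (p : ℝ) ^ p ≤ x * (C + (p : ℝ) ^ p) := by
    have : 0 ≤ (x - 1) * (p : ℝ) ^ p := mul_nonneg (by linarith) (by positivity)
    linarith
  calc x⁻¹ * (k ^ p * 2 ^ p) * (C * x + (p : ℝ) ^ p)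
      ≤ x⁻¹ * (k ^ p * 2 ^ p) * (x * (C + (p : ℝ) ^ p)) := by gcongr
    _ = (x⁻¹ * x) * (k ^ p * (2 ^ p * (C + (p : ℝ) ^ p))) := by ring
    _ ≤ _ := by rw [inv_mul_cancel₀ hx0.ne', one_mul]; linarith

end UniformMoments

/-! ### Convergence in distribution -/

section Distribution

open Set
open scoped ENNReal

variable {Ω Ω' : Type*} [MeasurableSpace Ω] [MeasurableSpace Ω'] {P : Measure Ω} {Q : Measure Ω'}
  {T : ℕ → ℕ → Ω → ℝ} {U E : ℕ → Ω' → ℝ} {k : ℕ}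

lemma IsChain.measurable_gridSum (h : IsChain U E Q) (k n : ℕ) : Measurable (gridSum k U E n) :=
  Finset.measurable_fun_sum _ fun _ _ => (measurable_gridTerm k n).comp
    (measurable_chainMin h.measurable_U h.measurable_E _)

/-- Dividing by `n ^ (1 - 1/k)` means the mesh `1/n` times `n ^ (1/k)`, which enters the root as a
factor `n` and turns Exp(1) into Exp(1/n) variables. -/
lemma IsClock.ae_minSum_eq (h : IsClock T P) (hk : k ≠ 0) {n : ℕ} (hn : 0 < n) :
    ∀ᵐ ω ∂P, minSum k T (n - 1) ω / (n : ℝ) ^ (1 - 1 / (k : ℝ))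
      = (∑ i ∈ Finset.range (n - 1), gridTerm k n (ENNReal.ofReal
        (runMin (fun j => hazard k (ringTime T k j ω) / (1 / (n : ℝ))) i))).toReal := by
  filter_upwards [h.ae_pos] with ω hω
  have hn0 : (0 : ℝ) < n := by exact_mod_cast hn
  have hne : ∀ y : ℝ, gridTerm k n (ENNReal.ofReal y) ≠ ∞ := fun y =>
    ENNReal.mul_ne_top ENNReal.ofReal_ne_top (rootFun_ne_top ENNReal.ofReal_ne_top k)
  rw [minSum, Finset.sum_div, ENNReal.toReal_sum fun i _ => hne _]
  refine Finset.sum_congr rfl fun i _ => ?_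
  have hpos : ∀ j, 0 < hazard k (ringTime T k j ω) := fun j => by
    rw [← hazard_zero hk]
    exact strictMonoOn_hazard hk self_mem_Ici (ringTime_pos hω hk j).le (ringTime_pos hω hk j)
  have e1 : runMin (fun j => hazard k (ringTime T k j ω) / (1 / (n : ℝ))) i
      = hazard k (minRing k T 0 i ω) * n := by
    rw [← runMin_map (f := fun x => x / (1 / (n : ℝ))) (fun x _ y _ hxy => by
      simp only; gcongr) hpos, minRing, runMin_map (strictMonoOn_hazard hk).monotoneOn
        (fun j => ringTime_pos hω hk _)]
    simp
  have hz := hazard_nonneg hk (minRing_pos hω hk 0 i).le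
  rw [e1, gridTerm, rootFun_ofReal k (by positivity), ENNReal.toReal_mul,
    ENNReal.toReal_ofReal (by positivity), ENNReal.toReal_ofReal (by positivity), ← mul_assoc,
    Real.mul_rpow (by positivity) hn0.le, Real.rpow_sub hn0, Real.rpow_one]
  field_simp

/-- The two laws coincide for every `n`: both are the same function of running minima of Exp(1/n)
variables at the points `1/n, …, (n-1)/n`. -/
lemma IsClock.identDistrib_minSum_gridSum [IsProbabilityMeasure P] [IsProbabilityMeasure Q]
    (hT : IsClock T P) (h : IsChain U E Q) (hk : k ≠ 0) (n : ℕ) :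
    IdentDistrib (fun ω => minSum k T (n - 1) ω / (n : ℝ) ^ (1 - 1 / (k : ℝ)))
      (fun ω => (gridSum k U E n ω).toReal) P Q := by
  have hm1 : Measurable fun ω => minSum k T (n - 1) ω / (n : ℝ) ^ (1 - 1 / (k : ℝ)) :=
    (hT.measurable_minSum k _).div_const _
  have hm2 : Measurable fun ω => (gridSum k U E n ω).toReal := (h.measurable_gridSum k n).ennreal_toReal
  refine ⟨hm1.aemeasurable, hm2.aemeasurable, ?_⟩
  rcases Nat.eq_zero_or_pos n with rfl | hn
  · simp [minSum, gridSum, Measure.map_const]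
  have hn0 : (0 : ℝ) < n := by exact_mod_cast hn
  have hW : ∀ j, Measurable fun ω => hazard k (ringTime T k j ω) := fun j =>
    (measurable_hazard k).comp (hT.measurable_ringTime k j)
  set Z : ℕ → Ω → ℝ := fun j ω => hazard k (ringTime T k j ω) / (1 / (n : ℝ)) with hZ
  have hZm : ∀ j, Measurable (Z j) := fun j => (hW j).div_const _
  have hZlaw : ∀ j, HasLaw (Z j) (expMeasure (1 / (n : ℝ))) P := fun j => by
    refine ⟨(hZm j).aemeasurable, ?_⟩
    have h1 := map_div_expMeasure one_pos (one_div_pos.2 hn0)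
    rw [one_mul, ← (hT.hasLaw_hazard hk j).map_eq, Measure.map_map (by fun_prop) (hW j)] at h1
    exact h1
  have hZind : iIndepFun Z P := (hT.iIndepFun_hazard k).comp (fun _ x => x / (1 / (n : ℝ)))
    (fun _ => by fun_prop)
  have hlaw := h.map_chainMin_eq_map_runMin (d := fun _ => 1 / (n : ℝ)) (fun _ => by positivity)
    (n := n - 1) (fun i hi => by
      rw [point_const, mul_one_div, div_lt_one hn0]
      exact_mod_cast (by lia : i + 1 < n)) hZlaw hZm hZind
  let Φ : (ℕ → ℝ≥0∞) → ℝ := fun y => (∑ i ∈ Finset.range (n - 1), gridTerm k n (y i)).toReal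
  have hΦ : Measurable Φ := (Finset.measurable_fun_sum _ fun i _ =>
    (measurable_gridTerm k n).comp (measurable_pi_apply i)).ennreal_toReal
  have hlaw2 := congrArg (Measure.map Φ) hlaw
  have hms : ∀ {α : Type _} [MeasurableSpace α] {f : ℕ → α → ℝ≥0∞}, (∀ i, Measurable (f i)) →
      Measurable fun ω i => if i < n - 1 then f i ω else 0 := fun hf =>
    measurable_pi_lambda _ fun i => by split_ifs; exacts [hf i, measurable_const]
  rw [Measure.map_map hΦ (hms fun i => measurable_chainMin h.measurable_U h.measurable_E _),
    Measure.map_map hΦ (measurable_pi_lambda _ fun i => by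
      split_ifs
      exacts [(measurable_runMin fun j _ => hZm j).ennreal_ofReal, measurable_const])] at hlaw2
  have e1 : (fun ω => (gridSum k U E n ω).toReal)
      = Φ ∘ fun ω i => if i < n - 1 then chainMin U E (point (fun _ => 1 / (n : ℝ)) i) ω else 0 := by
    ext ω
    simp only [gridSum, Function.comp_apply, Φ]
    congr 1
    refine Finset.sum_congr rfl fun i hi => ?_
    rw [if_pos (Finset.mem_range.1 hi), point_const, mul_one_div]
  rw [e1, hlaw2]
  refine Measure.map_congr ?_
  filter_upwards [hT.ae_minSum_eq hk hn] with ω hω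
  rw [hω]
  simp only [Function.comp_apply, Φ]
  congr 1
  refine Finset.sum_congr rfl fun i hi => ?_
  rw [if_pos (Finset.mem_range.1 hi)]

lemma IsChain.aemeasurable_limitVar [IsProbabilityMeasure Q] (h : IsChain U E Q) (hk : 2 ≤ k) :
    AEMeasurable (limitVar k U E) Q := by
  refine ⟨fun ω => (pathIntegral k U E ω).toReal,
    (measurable_pathIntegral h.measurable_U h.measurable_E).ennreal_toReal, ?_⟩
  filter_upwards [h.ae_limitVar hk] with ω ⟨_, _, h0, he⟩
  rw [← he, ENNReal.toReal_ofReal h0]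

lemma IsChain.tendstoInDistribution_gridSum [IsProbabilityMeasure Q] (h : IsChain U E Q)
    (hk : 2 ≤ k) :
    TendstoInDistribution (fun n ω => (gridSum k U E n ω).toReal) atTop (limitVar k U E)
      (fun _ => Q) Q := by
  refine tendstoInDistribution_of_ae_tendsto
    (fun n => (h.measurable_gridSum k n).ennreal_toReal.aemeasurable)
    (h.aemeasurable_limitVar hk) ?_
  filter_upwards [h.ae_limitVar hk] with ω ⟨hg, _, h0, he⟩
  have h1 := hg.tendsto_gridSum k
  rw [← he] at h1
  have h2 := (ENNReal.tendsto_toReal ENNReal.ofReal_ne_top).comp h1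
  rwa [ENNReal.toReal_ofReal h0] at h2

lemma tendstoInDistribution_of_forall_identDistrib {α β γ : Type*} [MeasurableSpace α]
    [MeasurableSpace β] [MeasurableSpace γ] {μ : Measure α} {ν : Measure β} {κ : Measure γ}
    [IsProbabilityMeasure μ] [IsProbabilityMeasure ν] [IsProbabilityMeasure κ] {X : ℕ → α → ℝ}
    {Y : ℕ → β → ℝ} {Z : γ → ℝ} (hX : TendstoInDistribution X atTop Z (fun _ => μ) κ)
    (hXY : ∀ n, IdentDistrib (Y n) (X n) ν μ) :
    TendstoInDistribution Y atTop Z (fun _ => ν) κ where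
  forall_aemeasurable n := (hXY n).aemeasurable_fst
  aemeasurable_limit := hX.aemeasurable_limit
  tendsto := by
    refine hX.tendsto.congr fun n => ?_
    exact Subtype.ext (hXY n).map_eq.symm

/-- Slutsky: the sums of minima have the laws of almost surely convergent Riemann sums, and the cut
number differs from them by a term that vanishes in `L^1`. -/
lemma IsClock.tendstoInDistribution_scaledCutNumber [IsProbabilityMeasure P]
    [IsProbabilityMeasure Q] (hT : IsClock T P) (h : IsChain U E Q) (hk : 2 ≤ k) :
    TendstoInDistribution (fun n => scaledCutNumber k T n) atTop (limitVar k U E)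
      (fun _ => P) Q := by
  refine tendstoInDistribution_of_tendstoInMeasure_sub _ _
    (tendstoInDistribution_of_forall_identDistrib (h.tendstoInDistribution_gridSum hk)
      fun n => hT.identDistrib_minSum_gridSum h (by lia) n) ?_
    fun n => (hT.measurable_scaledCutNumber k n).aemeasurable
  have hm := fun n => (hT.measurable_minSum k (n - 1)).div_const ((n : ℝ) ^ (1 - 1 / (k : ℝ)))
  refine tendstoInMeasure_of_tendsto_eLpNorm (p := 1) one_ne_zero
    (fun n => ((hT.measurable_scaledCutNumber k n).sub (hm n)).aestronglyMeasurable)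
    aestronglyMeasurable_const ?_
  refine (hT.tendsto_lintegral_scaledCutNumber_sub hk).congr fun n => ?_
  rw [sub_zero, eLpNorm_one_eq_lintegral_enorm]
  refine lintegral_congr fun ω => ?_
  rw [Real.enorm_eq_ofReal_abs]
  rfl

end Distribution

/-! ### The quantile coupling -/

section Quantile

open Set
open scoped ENNReal

/-- The quantile function of a measure on the line. -/
def quantile (μ : Measure ℝ) (u : ℝ) : ℝ := sInf {x | u ≤ cdf μ x}

variable {μ : Measure ℝ}

/-- Right continuity of the distribution function makes the infimum attained, which yields the
Galois connection. -/
lemma quantile_le_iff {u x : ℝ} (hu : u ∈ Ioo (0 : ℝ) 1) : quantile μ u ≤ x ↔ u ≤ cdf μ x := by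
  have hne : {x | u ≤ cdf μ x}.Nonempty := by
    obtain ⟨y, hy⟩ := ((tendsto_cdf_atTop μ).eventually (lt_mem_nhds hu.2)).exists
    exact ⟨y, le_of_lt hy⟩
  have hbdd : BddBelow {x | u ≤ cdf μ x} := by
    obtain ⟨y, hy⟩ := ((tendsto_cdf_atBot μ).eventually (gt_mem_nhds hu.1)).exists
    refine ⟨y, fun z hz => ?_⟩
    by_contra hlt
    exact absurd (hz.trans (monotone_cdf μ (not_le.1 hlt).le)) (not_le.2 hy)
  constructor
  · intro h
    have hq : u ≤ cdf μ (quantile μ u) := by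
      have hc := ((cdf μ).right_continuous (quantile μ u)).mono Ioi_subset_Ici_self
      refine ge_of_tendsto hc ?_
      filter_upwards [self_mem_nhdsWithin] with y hy
      obtain ⟨a, ha, hay⟩ := exists_lt_of_csInf_lt hne hy
      exact le_trans ha (monotone_cdf μ hay.le)
    exact hq.trans (monotone_cdf μ h)
  · exact fun h => csInf_le hbdd h

lemma lt_quantile_iff {u x : ℝ} (hu : u ∈ Ioo (0 : ℝ) 1) : x < quantile μ u ↔ cdf μ x < u := by
  rw [← not_le, quantile_le_iff hu, not_le]

lemma monotoneOn_quantile (μ : Measure ℝ) : MonotoneOn (quantile μ) (Ioo 0 1) := fun _ hu _ hv huv =>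
  (quantile_le_iff hu).2 (huv.trans ((quantile_le_iff hv).1 le_rfl))

lemma aemeasurable_quantile (μ : Measure ℝ) :
    AEMeasurable (quantile μ) (volume.restrict (Ioo (0 : ℝ) 1)) :=
  aemeasurable_restrict_of_monotoneOn measurableSet_Ioo (monotoneOn_quantile μ)

lemma map_quantile (μ : Measure ℝ) [IsProbabilityMeasure μ] :
    (volume.restrict (Ioo (0 : ℝ) 1)).map (quantile μ) = μ := by
  have : IsProbabilityMeasure (volume.restrict (Ioo (0 : ℝ) 1)) := ⟨by simp⟩
  have : IsProbabilityMeasure ((volume.restrict (Ioo (0 : ℝ) 1)).map (quantile μ)) :=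
    Measure.isProbabilityMeasure_map (aemeasurable_quantile μ)
  refine Measure.ext_of_Iic _ _ fun x => ?_
  rw [Measure.map_apply_of_aemeasurable (aemeasurable_quantile μ) measurableSet_Iic, ← ofReal_cdf]
  have h0 := cdf_nonneg μ x
  have h1 := cdf_le_one μ x
  have e : quantile μ ⁻¹' Iic x =ᵐ[volume.restrict (Ioo (0 : ℝ) 1)] Iic (cdf μ x) := by
    refine (ae_restrict_iff' measurableSet_Ioo).2 (ae_of_all _ fun u hu => ?_)
    exact propext (quantile_le_iff hu)
  rw [measure_congr e, Measure.restrict_apply measurableSet_Iic]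
  rcases h1.lt_or_eq with h1 | h1
  · have : Iic (cdf μ x) ∩ Ioo 0 1 = Ioc 0 (cdf μ x) := by
      ext u
      simp only [mem_inter_iff, mem_Iic, mem_Ioo, mem_Ioc]
      constructor
      · rintro ⟨a, b, _⟩; exact ⟨b, a⟩
      · rintro ⟨a, b⟩; exact ⟨b, a, b.trans_lt h1⟩
    rw [this, Real.volume_Ioc, sub_zero]
  · have : Iic (cdf μ x) ∩ Ioo 0 1 = Ioo 0 1 := by
      rw [h1]; exact inter_eq_right.2 fun u hu => hu.2.le
    rw [this, Real.volume_Ioo, h1, sub_zero]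

/-- Convergence holds wherever the limiting quantile function is continuous, hence off a countable
set by monotonicity. The portmanteau theorem for closed half-lines bounds the quantiles from below,
and for open half-lines from above. -/
lemma ae_tendsto_quantile {μs : ℕ → ProbabilityMeasure ℝ} {μ : ProbabilityMeasure ℝ}
    (h : Tendsto μs atTop (𝓝 μ)) :
    ∀ᵐ u ∂volume.restrict (Ioo (0 : ℝ) 1),
      Tendsto (fun n => quantile (μs n) u) atTop (𝓝 (quantile μ u)) := by
  have hcount := (monotoneOn_quantile (μ : Measure ℝ)).countable_not_continuousWithinAt
  rw [ae_restrict_iff' measurableSet_Ioo]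
  filter_upwards [measure_eq_zero_iff_ae_notMem.1 (hcount.measure_zero volume)] with u hu1 hu
  have hcont : ContinuousWithinAt (quantile μ) (Ioo 0 1) u := by
    by_contra hc
    exact hu1 ⟨hu, hc⟩
  rw [tendsto_order]
  constructor
  · intro b hb
    rw [lt_quantile_iff hu] at hb
    have h1 := ProbabilityMeasure.limsup_measure_closed_le_of_tendsto h (isClosed_Iic (a := b))
    rw [← ofReal_cdf] at h1
    have h2 := h1.trans_lt ((ENNReal.ofReal_lt_ofReal_iff hu.1).2 hb)
    filter_upwards [eventually_lt_of_limsup_lt h2] with n hn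
    rw [lt_quantile_iff hu]
    rw [← ofReal_cdf] at hn
    exact (ENNReal.ofReal_lt_ofReal_iff hu.1).1 hn
  · intro b hb
    obtain ⟨b', hb1, hb2⟩ := exists_between hb
    -- The distribution function may equal `u` exactly at the quantile of `u`; continuity supplies a
    -- `v > u` whose quantile is still below `b'`, which gives a strict inequality.
    have hev : ∀ᶠ v in 𝓝[>] u, v ∈ Ioo u 1 ∧ quantile μ v < b' := by
      have hc2 : Tendsto (quantile μ) (𝓝[>] u) (𝓝 (quantile μ u)) := by
        have h3 := (hcont.continuousAt (Ioo_mem_nhds hu.1 hu.2)).tendsto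
        exact h3.mono_left nhdsWithin_le_nhds
      have h3 : ∀ᶠ v in 𝓝[>] u, v ∈ Ioo u 1 := Ioo_mem_nhdsGT hu.2
      exact h3.and (hc2.eventually (gt_mem_nhds hb1))
    obtain ⟨v, hv, hvb⟩ := hev.exists
    have hv' : v ∈ Ioo (0 : ℝ) 1 := ⟨hu.1.trans hv.1, hv.2⟩
    have h1 := ProbabilityMeasure.le_liminf_measure_open_of_tendsto h (isOpen_Iio (a := b'))
    have h2 : ENNReal.ofReal u < (μ : Measure ℝ) (Iio b') := by
      calc ENNReal.ofReal u < ENNReal.ofReal v := (ENNReal.ofReal_lt_ofReal_iff hv'.1).2 hv.1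
        _ ≤ ENNReal.ofReal (cdf μ (quantile μ v)) :=
            ENNReal.ofReal_le_ofReal ((quantile_le_iff hv').1 le_rfl)
        _ = (μ : Measure ℝ) (Iic (quantile μ v)) := ofReal_cdf _ _
        _ ≤ _ := measure_mono (Iic_subset_Iio.2 hvb)
    filter_upwards [eventually_lt_of_lt_liminf (h2.trans_le h1)] with n hn
    refine lt_of_le_of_lt ((quantile_le_iff hu).2 ?_) hb2
    have h3 := hn.trans_le (measure_mono (Iio_subset_Iic_self (a := b')))
    rw [← ofReal_cdf] at h3
    exact ((ENNReal.ofReal_lt_ofReal_iff' ).1 h3).1.le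

/-- Sequences that converge in distribution have almost surely convergent copies. -/
lemma exists_ae_tendsto_of_tendstoInDistribution {Ω Ω' : Type*} [MeasurableSpace Ω]
    [MeasurableSpace Ω'] {P : Measure Ω} {Q : Measure Ω'} [IsProbabilityMeasure P]
    [IsProbabilityMeasure Q] {X : ℕ → Ω → ℝ} {B : Ω' → ℝ}
    (h : TendstoInDistribution X atTop B (fun _ => P) Q) :
    ∃ (P₀ : Measure ℝ) (_ : IsProbabilityMeasure P₀) (Y : ℕ → ℝ → ℝ) (Z : ℝ → ℝ),
      (∀ n, IdentDistrib (Y n) (X n) P₀ P) ∧ IdentDistrib Z B P₀ Q ∧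
      ∀ᵐ u ∂P₀, Tendsto (fun n => Y n u) atTop (𝓝 (Z u)) := by
  have hX := h.forall_aemeasurable
  have hB := h.aemeasurable_limit
  have h1 := fun n => Measure.isProbabilityMeasure_map (hX n)
  have h2 := Measure.isProbabilityMeasure_map hB
  have h3 : IsProbabilityMeasure (volume.restrict (Ioo (0 : ℝ) 1)) := ⟨by simp⟩
  have h4 : ∀ n, IdentDistrib (quantile (P.map (X n))) (X n) (volume.restrict (Ioo (0 : ℝ) 1)) P :=
    fun n => ⟨aemeasurable_quantile _, hX n, map_quantile _⟩
  have h5 : IdentDistrib (quantile (Q.map B)) B (volume.restrict (Ioo (0 : ℝ) 1)) Q :=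
    ⟨aemeasurable_quantile _, hB, map_quantile _⟩
  have h6 := ae_tendsto_quantile h.tendsto
  exact ⟨_, h3, _, _, h4, h5, h6⟩

end Quantile

/-! ### Convergence of moments -/

section Moments

open Set
open scoped ENNReal

variable {α : Type*} [MeasurableSpace α] {μ : Measure α} [IsProbabilityMeasure μ]

/-- Truncate by `y ≤ min y K + y ^ 2 / K`: dominated convergence handles the bounded part, and the
rest is at most `C / K`. -/
lemma tendsto_lintegral_of_sq_le {g : ℕ → α → ℝ≥0∞} (hg : ∀ n, AEMeasurable (g n) μ)
    (hlim : ∀ᵐ x ∂μ, Tendsto (fun n => g n x) atTop (𝓝 0)) {C : ℝ≥0∞} (hC : C ≠ ∞)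
    (hb : ∀ n, ∫⁻ x, g n x ^ 2 ∂μ ≤ C) : Tendsto (fun n => ∫⁻ x, g n x ∂μ) atTop (𝓝 0) := by
  have hpt : ∀ K : ℝ≥0∞, K ≠ 0 → K ≠ ∞ → ∀ y : ℝ≥0∞, y ≤ min y K + K⁻¹ * y ^ 2 := by
    intro K hK0 hK y
    rcases le_total y K with h | h
    · rw [min_eq_left h]; exact le_self_add
    · refine le_trans ?_ le_add_self
      calc y = K⁻¹ * K * y := by rw [ENNReal.inv_mul_cancel hK0 hK, one_mul]
        _ ≤ K⁻¹ * y * y := by gcongr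
        _ = _ := by ring
  have hmin : ∀ K : ℝ≥0∞, K ≠ ∞ → Tendsto (fun n => ∫⁻ x, min (g n x) K ∂μ) atTop (𝓝 0) := by
    intro K hK
    have := tendsto_lintegral_of_dominated_convergence' (μ := μ) (F := fun n x => min (g n x) K)
      (f := fun _ => 0) (fun _ => K) (fun n => (hg n).min aemeasurable_const)
      (fun n => ae_of_all _ fun x => min_le_right _ _) (by simpa using hK) (by
        filter_upwards [hlim] with x hx
        simpa using hx.min (tendsto_const_nhds (x := K)))
    simpa using this
  rw [ENNReal.tendsto_nhds_zero]
  intro ε hε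
  rcases eq_or_ne ε ∞ with rfl | hε'
  · simp
  -- The `+ 1` keeps `K` nonzero when `C = 0`.
  set K : ℝ≥0∞ := (C + 1) / (ε / 2) with hK
  have hε2 : ε / 2 ≠ 0 := by simp [hε.ne']
  have hε2' : ε / 2 ≠ ∞ := (ENNReal.half_lt_self hε.ne' hε').ne_top
  have hK0 : K ≠ 0 := by simp [hK, hε2']
  have hKt : K ≠ ∞ := ENNReal.div_ne_top (by simp [hC]) hε2
  have hKC : K⁻¹ * C ≤ ε / 2 := by
    rw [hK, ENNReal.inv_div (Or.inl hε2') (Or.inl hε2)]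
    calc ε / 2 / (C + 1) * C ≤ ε / 2 / (C + 1) * (C + 1) := by gcongr; exact le_self_add
      _ = ε / 2 := ENNReal.div_mul_cancel (by simp) (by simp [hC])
  filter_upwards [ENNReal.tendsto_nhds_zero.1 (hmin K hKt) (ε / 2) (pos_iff_ne_zero.2 hε2)] with n hn
  calc ∫⁻ x, g n x ∂μ ≤ ∫⁻ x, (min (g n x) K + K⁻¹ * g n x ^ 2) ∂μ :=
        lintegral_mono fun x => hpt K hK0 hKt _
    _ = ∫⁻ x, min (g n x) K ∂μ + K⁻¹ * ∫⁻ x, g n x ^ 2 ∂μ := by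
        rw [lintegral_add_left' ((hg n).min aemeasurable_const),
          lintegral_const_mul' _ _ (ENNReal.inv_ne_top.2 hK0)]
    _ ≤ ε / 2 + ε / 2 := add_le_add hn ((mul_le_mul' le_rfl (hb n)).trans hKC)
    _ = ε := ENNReal.add_halves ε

lemma rpow_le_one_add_pow (y : ℝ≥0∞) {s : ℝ} (hs : 0 ≤ s) : y ^ s ≤ 1 + y ^ ⌈s⌉₊ := by
  rcases le_total y 1 with h | h
  · exact (ENNReal.rpow_le_one h hs).trans le_self_add
  · refine le_trans ?_ le_add_self
    rw [← ENNReal.rpow_natCast]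
    exact ENNReal.rpow_le_rpow_of_exponent_le h (Nat.le_ceil s)

lemma lintegral_rpow_le_one_add (f : α → ℝ≥0∞) {s : ℝ} (hs : 0 ≤ s) :
    ∫⁻ x, f x ^ s ∂μ ≤ 1 + ∫⁻ x, f x ^ ⌈s⌉₊ ∂μ := by
  calc ∫⁻ x, f x ^ s ∂μ ≤ ∫⁻ x, (1 + f x ^ ⌈s⌉₊) ∂μ :=
        lintegral_mono fun x => rpow_le_one_add_pow _ hs
    _ = _ := by rw [lintegral_add_left measurable_const]; simp

/-- Almost sure convergence and bounded moments of all orders imply convergence in `L^p`. -/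
lemma tendsto_eLpNorm_sub {Y : ℕ → α → ℝ} {Z : α → ℝ} (hY : ∀ n, AEMeasurable (Y n) μ)
    (hZ : AEMeasurable Z μ) (hlim : ∀ᵐ x ∂μ, Tendsto (fun n => Y n x) atTop (𝓝 (Z x)))
    (hYb : ∀ r : ℕ, ∃ C : ℝ≥0∞, C ≠ ∞ ∧ ∀ n, ∫⁻ x, ‖Y n x‖ₑ ^ r ∂μ ≤ C)
    (hZb : ∀ r : ℕ, ∫⁻ x, ‖Z x‖ₑ ^ r ∂μ ≠ ∞) {p : ℝ} (hp : 0 < p) :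
    Tendsto (fun n => eLpNorm (Y n - Z) (ENNReal.ofReal p) μ) atTop (𝓝 0) := by
  have hp0 : ENNReal.ofReal p ≠ 0 := by simpa using hp
  have key : Tendsto (fun n => ∫⁻ x, ‖Y n x - Z x‖ₑ ^ p ∂μ) atTop (𝓝 0) := by
    -- The square of the `p`-th power needs a moment of order `2p`, rounded up to an integer.
    set r := ⌈p * 2⌉₊
    obtain ⟨C, hC, hCn⟩ := hYb r
    refine tendsto_lintegral_of_sq_le (C := 1 + 2 ^ r * (C + ∫⁻ x, ‖Z x‖ₑ ^ r ∂μ))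
      (fun n => ((hY n).sub hZ).enorm.pow_const p) ?_ ?_ fun n => ?_
    · filter_upwards [hlim] with x hx
      have h1 : Tendsto (fun n => ‖Y n x - Z x‖ₑ) atTop (𝓝 0) := by
        have := (tendsto_sub_nhds_zero_iff.2 hx).enorm
        simpa using this
      have := h1.ennrpow_const p
      rwa [ENNReal.zero_rpow_of_pos hp] at this
    · exact ENNReal.add_ne_top.2 ⟨by simp, ENNReal.mul_ne_top (by simp)
        (ENNReal.add_ne_top.2 ⟨hC, hZb r⟩)⟩
    · have e : ∀ x, (‖Y n x - Z x‖ₑ ^ p) ^ 2 = ‖Y n x - Z x‖ₑ ^ (p * 2) := fun x => by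
        rw [ENNReal.rpow_mul]; norm_cast
      simp_rw [e]
      refine (lintegral_rpow_le_one_add _ (by positivity)).trans ?_
      gcongr
      calc ∫⁻ x, ‖Y n x - Z x‖ₑ ^ r ∂μ ≤ ∫⁻ x, 2 ^ r * (‖Y n x‖ₑ ^ r + ‖Z x‖ₑ ^ r) ∂μ := by
            refine lintegral_mono fun x => ?_
            exact (pow_le_pow_left₀ zero_le (enorm_sub_le) r).trans (ennreal_add_pow_le _ _ _)
        _ = 2 ^ r * (∫⁻ x, ‖Y n x‖ₑ ^ r ∂μ + ∫⁻ x, ‖Z x‖ₑ ^ r ∂μ) := by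
            rw [lintegral_const_mul' _ _ (by simp), lintegral_add_left' ((hY n).enorm.pow_const r)]
        _ ≤ _ := by gcongr; exact hCn n
  simp_rw [eLpNorm_eq_lintegral_rpow_enorm_toReal hp0 ENNReal.ofReal_ne_top,
    ENNReal.toReal_ofReal hp.le]
  have := key.ennrpow_const (1 / p)
  rwa [ENNReal.zero_rpow_of_pos (by positivity)] at this

/-- The powers converge almost surely, and the squared difference of nonnegative powers is at most
`Y ^ (2p) + Z ^ (2p)`. So `tendsto_lintegral_of_sq_le` covers all `p > 0` alike. -/
lemma tendsto_integral_rpow {Y : ℕ → α → ℝ} {Z : α → ℝ} (hY : ∀ n, AEMeasurable (Y n) μ)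
    (hZ : AEMeasurable Z μ) (hlim : ∀ᵐ x ∂μ, Tendsto (fun n => Y n x) atTop (𝓝 (Z x)))
    (hY0 : ∀ n, ∀ᵐ x ∂μ, 0 ≤ Y n x) (hZ0 : ∀ᵐ x ∂μ, 0 ≤ Z x)
    (hYb : ∀ r : ℕ, ∃ C : ℝ≥0∞, C ≠ ∞ ∧ ∀ n, ∫⁻ x, ‖Y n x‖ₑ ^ r ∂μ ≤ C)
    (hZb : ∀ r : ℕ, ∫⁻ x, ‖Z x‖ₑ ^ r ∂μ ≠ ∞) {p : ℝ} (hp : 0 < p) :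
    Tendsto (fun n => ∫ x, Y n x ^ p ∂μ) atTop (𝓝 (∫ x, Z x ^ p ∂μ)) := by
  have hrp : ∀ {a : ℝ}, 0 ≤ a → ‖a ^ p‖ₑ = ‖a‖ₑ ^ p := fun ha => by
    rw [Real.enorm_eq_ofReal (by positivity), Real.enorm_eq_ofReal ha,
      ENNReal.ofReal_rpow_of_nonneg ha hp.le]
  have hint : ∀ {f : α → ℝ}, AEMeasurable f μ → (∀ᵐ x ∂μ, 0 ≤ f x) →
      ∫⁻ x, ‖f x‖ₑ ^ ⌈p⌉₊ ∂μ ≠ ∞ → Integrable (fun x => f x ^ p) μ := by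
    intro f hf hf0 hfin
    refine ⟨(hf.pow_const p).aestronglyMeasurable, ?_⟩
    rw [hasFiniteIntegral_iff_enorm]
    calc ∫⁻ x, ‖f x ^ p‖ₑ ∂μ = ∫⁻ x, ‖f x‖ₑ ^ p ∂μ :=
          lintegral_congr_ae (by filter_upwards [hf0] with x hx using hrp hx)
      _ ≤ 1 + ∫⁻ x, ‖f x‖ₑ ^ ⌈p⌉₊ ∂μ := lintegral_rpow_le_one_add _ hp.le
      _ < ∞ := ENNReal.add_lt_top.2 ⟨by simp, hfin.lt_top⟩
  refine tendsto_integral_of_L1 _ (hint hZ hZ0 (hZb _)).aestronglyMeasurable (Eventually.of_forall fun n => ?_) ?_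
  · obtain ⟨C, hC, hCn⟩ := hYb ⌈p⌉₊
    exact hint (hY n) (hY0 n) (ne_top_of_le_ne_top hC (hCn n))
  · set r := ⌈p * 2⌉₊
    obtain ⟨C, hC, hCn⟩ := hYb r
    refine tendsto_lintegral_of_sq_le (C := (1 + C) + (1 + ∫⁻ x, ‖Z x‖ₑ ^ r ∂μ))
      (fun n => (((hY n).pow_const p).sub (hZ.pow_const p)).enorm) ?_ ?_ fun n => ?_
    · filter_upwards [hlim] with x hx
      have := (tendsto_sub_nhds_zero_iff.2 (hx.rpow_const (p := p) (Or.inr hp.le))).enorm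
      simpa using this
    · simp [hC, hZb r]
    · calc ∫⁻ x, ‖Y n x ^ p - Z x ^ p‖ₑ ^ 2 ∂μ
          ≤ ∫⁻ x, (‖Y n x‖ₑ ^ (p * 2) + ‖Z x‖ₑ ^ (p * 2)) ∂μ := by
            refine lintegral_mono_ae ?_
            filter_upwards [hY0 n, hZ0] with x h1 h2
            rw [ENNReal.rpow_mul, ENNReal.rpow_mul, ← hrp h1, ← hrp h2]
            have ha : 0 ≤ Y n x ^ p := by positivity
            have hb : 0 ≤ Z x ^ p := by positivity
            rw [Real.enorm_eq_ofReal ha, Real.enorm_eq_ofReal hb, Real.enorm_eq_ofReal_abs]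
            norm_cast
            rw [← ENNReal.ofReal_pow (abs_nonneg _), ← ENNReal.ofReal_pow ha,
              ← ENNReal.ofReal_pow hb, ← ENNReal.ofReal_add (by positivity) (by positivity)]
            refine ENNReal.ofReal_le_ofReal ?_
            rw [sq_abs]
            nlinarith [mul_nonneg ha hb]
        _ = ∫⁻ x, ‖Y n x‖ₑ ^ (p * 2) ∂μ + ∫⁻ x, ‖Z x‖ₑ ^ (p * 2) ∂μ :=
            lintegral_add_left' ((hY n).enorm.pow_const _) _
        _ ≤ _ := by
            gcongr
            · refine (lintegral_rpow_le_one_add _ (by positivity)).trans ?_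
              gcongr
              exact hCn n
            · exact lintegral_rpow_le_one_add _ (by positivity)

end Moments

/-! ### The main theorem -/

section Main

open Set
open scoped ENNReal

variable {Ω Ω' : Type*} [MeasurableSpace Ω] [MeasurableSpace Ω'] {P : Measure Ω} {Q : Measure Ω'}
  {k : ℕ}

/-- `HasLaw` only gives almost everywhere measurability; countably many measurable versions change
neither laws nor, almost surely, the cut numbers. -/
lemma exists_isClock {T : ℕ → ℕ → Ω → ℝ} (hT : ∀ i v, HasLaw (T i v) (expMeasure 1) P)
    (hind : iIndepFun (fun iv : ℕ × ℕ => T iv.1 iv.2) P) :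
    ∃ T', IsClock T' P ∧ ∀ n, scaledCutNumber k T' n =ᵐ[P] scaledCutNumber k T n := by
  set T' : ℕ → ℕ → Ω → ℝ := fun i v => (hT i v).aemeasurable.mk (T i v)
  have hae : ∀ i v, T i v =ᵐ[P] T' i v := fun i v => (hT i v).aemeasurable.ae_eq_mk
  refine ⟨T', ⟨fun i v => (hT i v).aemeasurable.measurable_mk, fun i v => (hT i v).congr (hae i v).symm,
    hind.congr fun iv => hae iv.1 iv.2⟩, fun n => ?_⟩
  have hall : ∀ᵐ ω ∂P, ∀ i v, T i v ω = T' i v ω := by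
    rw [ae_all_iff]; intro i; rw [ae_all_iff]; exact fun v => hae i v
  filter_upwards [hall] with ω hω
  have hring : ∀ r v, ringTime T' r v ω = ringTime T r v ω := fun r v => by
    simp only [ringTime, hω]
  have hcount : ∀ r, recordCount k T' n r ω = recordCount k T n r ω := fun r =>
    Finset.sum_congr rfl fun v _ => by congr 1; simp only [IsRecord, hring]
  simp only [scaledCutNumber, cutNumber, hcount]

lemma exists_isChain {U E : ℕ → Ω' → ℝ}
    (hU : ∀ j, HasLaw (U j) (volume.restrict (Icc (0 : ℝ) 1)) Q)
    (hE : ∀ j, HasLaw (E j) (expMeasure 1) Q) (hind : iIndepFun (Sum.elim U E) Q) :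
    ∃ U' E', IsChain U' E' Q ∧ ∀ᵐ ω ∂Q, (∀ p, limitB k U' E' p ω = limitB k U E p ω) ∧
      limitVar k U' E' ω = limitVar k U E ω := by
  set U' : ℕ → Ω' → ℝ := fun j => (hU j).aemeasurable.mk (U j)
  set E' : ℕ → Ω' → ℝ := fun j => (hE j).aemeasurable.mk (E j)
  have hUae : ∀ j, U j =ᵐ[Q] U' j := fun j => (hU j).aemeasurable.ae_eq_mk
  have hEae : ∀ j, E j =ᵐ[Q] E' j := fun j => (hE j).aemeasurable.ae_eq_mk
  refine ⟨U', E', ⟨fun j => (hU j).aemeasurable.measurable_mk, fun j => (hE j).aemeasurable.measurable_mk,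
    fun j => (hU j).congr (hUae j).symm, fun j => (hE j).congr (hEae j).symm,
    hind.congr fun s => ?_⟩, ?_⟩
  · cases s with
    | inl j => exact hUae j
    | inr j => exact hEae j
  · filter_upwards [ae_all_iff.2 hUae, ae_all_iff.2 hEae] with ω h1 h2
    have hB : ∀ p, limitB k U' E' p ω = limitB k U E p ω := fun p => by
      simp only [limitB, limitS, h1, h2]
    exact ⟨hB, by simp only [limitVar, hB]⟩

lemma eta_one_nonneg (hk : 2 ≤ k) : 0 ≤ eta k 1 := by
  have hk' : (2 : ℝ) ≤ k := by exact_mod_cast hk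
  have h1 := Real.Gamma_pos_of_pos (s := 1 / (k : ℝ)) (by positivity)
  have h2 : (0 : ℝ) < k - 1 := by linarith
  rw [eta, Nat.cast_one, Real.Gamma_one]
  positivity

lemma gam_nonneg (hk : 2 ≤ k) : 0 ≤ gam k := by
  have hk' : (2 : ℝ) ≤ k := by exact_mod_cast hk
  have h1 := Real.Gamma_pos_of_pos (s := 2 / (k : ℝ)) (by positivity)
  have h2 : (0 : ℝ) < k - 1 := by linarith
  have h3 : 0 ≤ lam k := by
    rw [lam]
    split_ifs with h
    · positivity
    · have hlt : 2 < k := lt_of_le_of_ne hk (Ne.symm h)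
      have h4 := cot_pi_div_nonneg hlt
      have h5 : (0 : ℝ) < k - 2 := by
        have : (2 : ℝ) < k := by exact_mod_cast hlt
        linarith
      have h6 := Real.pi_pos
      positivity
  rw [gam]
  positivity

lemma rho_nonneg (hk : 2 ≤ k) (p : ℕ) : 0 ≤ rho k p := by
  have hk' : (2 : ℝ) ≤ k := by exact_mod_cast hk
  have h1 : (p : ℝ) / k ≤ p := div_le_self p.cast_nonneg (by linarith)
  have h2 := Real.Gamma_pos_of_pos (s := (p : ℝ) + 1 - (p : ℝ) / k) (by linarith)
  have h3 : 0 ≤ Real.sin (Real.pi / k) := Real.sin_nonneg_of_nonneg_of_le_pi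
    (by have := Real.pi_pos; positivity) (div_le_self Real.pi_pos.le (by linarith))
  have h4 := Real.pi_pos
  rw [rho]
  positivity

lemma memLp_of_lintegral_pow_ne_top [IsProbabilityMeasure Q] {B : Ω' → ℝ} (hB : AEMeasurable B Q)
    (hb : ∀ r : ℕ, ∫⁻ ω, ‖B ω‖ₑ ^ r ∂Q ≠ ∞) {p : ℝ} (hp : 0 < p) :
    MemLp B (ENNReal.ofReal p) Q := by
  refine ⟨hB.aestronglyMeasurable, ?_⟩
  rw [eLpNorm_lt_top_iff_lintegral_rpow_enorm_lt_top (by simpa using hp) ENNReal.ofReal_ne_top,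
    ENNReal.toReal_ofReal hp.le]
  exact (lintegral_rpow_le_one_add _ hp.le).trans_lt (ENNReal.add_lt_top.2 ⟨by simp, (hb _).lt_top⟩)

/-- Jensen's inequality for the convex function `x ^ p` on `[0, ∞)`. -/
lemma pow_integral_le [IsProbabilityMeasure Q] {B : Ω' → ℝ} (hB0 : ∀ᵐ ω ∂Q, 0 ≤ B ω)
    (hB : Integrable B Q) (p : ℕ) (hBp : Integrable (fun ω => B ω ^ p) Q) :
    (∫ ω, B ω ∂Q) ^ p ≤ ∫ ω, B ω ^ p ∂Q :=
  (convexOn_pow p).map_integral_le (continuous_pow p).continuousOn isClosed_Ici hB0 hB hBp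

end Main

end KCut
end

theorem mainTheorem1 {Ω Ω' : Type*} [MeasurableSpace Ω] [MeasurableSpace Ω']
    (P : Measure Ω) [IsProbabilityMeasure P] (Q : Measure Ω') [IsProbabilityMeasure Q]
    (k : ℕ) (hk : 2 ≤ k)
    -- the holding times of the alarm clocks are i.i.d. `Exp(1)`
    (T : ℕ → ℕ → Ω → ℝ)
    (hT : ∀ i v, HasLaw (T i v) (expMeasure 1) P)
    (hTindep : iIndepFun (fun iv : ℕ × ℕ => T iv.1 iv.2) P)
    -- `U_1, E_1, U_2, E_2, …` are mutually independent, uniform on `[0,1]` and `Exp(1)`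
    (U E : ℕ → Ω' → ℝ)
    (hU : ∀ j, HasLaw (U j) (volume.restrict (Set.Icc (0 : ℝ) 1)) Q)
    (hE : ∀ j, HasLaw (E j) (expMeasure 1) Q)
    (hUEindep : iIndepFun (Sum.elim U E) Q) :
    -- the series that defines `𝓑_k` converges almost surely
    (∀ᵐ ω ∂Q, Summable fun p => KCut.limitB k U E p ω) ∧
    -- convergence in distribution
    TendstoInDistribution (fun n => KCut.scaledCutNumber k T n) atTop (KCut.limitVar k U E)
      (fun _ => P) Q ∧
    -- `𝓑_k` has finite moments of all orders
    (∀ p : ℝ, 0 < p → MemLp (KCut.limitVar k U E) (ENNReal.ofReal p) Q) ∧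
    -- convergence in `L^p` for all `p > 0`, for copies on a common probability space
    (∃ (Ω₀ : Type) (_ : MeasurableSpace Ω₀) (P₀ : Measure Ω₀) (_ : IsProbabilityMeasure P₀)
        (Y : ℕ → Ω₀ → ℝ) (Z : Ω₀ → ℝ),
      (∀ n, IdentDistrib (Y n) (KCut.scaledCutNumber k T n) P₀ P) ∧
      IdentDistrib Z (KCut.limitVar k U E) P₀ Q ∧
      ∀ p : ℝ, 0 < p →
        Tendsto (fun n => eLpNorm (Y n - Z) (ENNReal.ofReal p) P₀) atTop (𝓝 0)) ∧
    -- convergence of all moments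
    (∀ p : ℝ, 0 < p →
      Tendsto (fun n => ∫ ω, KCut.scaledCutNumber k T n ω ^ p ∂P) atTop
        (𝓝 (∫ ω, KCut.limitVar k U E ω ^ p ∂Q))) ∧
    -- the moments of `𝓑_k`
    (∫ ω, KCut.limitVar k U E ω ∂Q) = KCut.eta k 1 ∧
    (∫ ω, KCut.limitVar k U E ω ^ 2 ∂Q) = KCut.gam k ∧
    (∀ p : ℕ, (∫ ω, KCut.limitVar k U E ω ^ p ∂Q) ∈
      Set.Icc (KCut.eta k 1 ^ p) (KCut.rho k p)) := by
  obtain ⟨T', hclock, hTae⟩ := KCut.exists_isClock (k := k) hT hTindep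
  obtain ⟨U', E', hchain, hUEae⟩ := KCut.exists_isChain (k := k) hU hE hUEindep
  have hdist : TendstoInDistribution (fun n => KCut.scaledCutNumber k T n) atTop
      (KCut.limitVar k U E) (fun _ => P) Q :=
    (hclock.tendstoInDistribution_scaledCutNumber hchain hk).congr hTae
      (by filter_upwards [hUEae] with ω hω using hω.2)
  have hgood : ∀ᵐ ω ∂Q, (Summable fun p => KCut.limitB k U E p ω) ∧ 0 ≤ KCut.limitVar k U E ω ∧
      ENNReal.ofReal (KCut.limitVar k U E ω) = KCut.pathIntegral k U' E' ω := by
    filter_upwards [hchain.ae_limitVar hk, hUEae] with ω ⟨_, h1, h2, h3⟩ ⟨h4, h5⟩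
    simp only [h4, h5] at h1 h2 h3
    exact ⟨h1, h2, h3⟩
  have hBm := hdist.aemeasurable_limit
  have hB0 : ∀ᵐ ω ∂Q, 0 ≤ KCut.limitVar k U E ω := hgood.mono fun ω h => h.2.1
  have hBpow : ∀ r : ℕ, ∫⁻ ω, ENNReal.ofReal (KCut.limitVar k U E ω ^ r) ∂Q
      = ∫⁻ ω, KCut.pathIntegral k U' E' ω ^ r ∂Q := fun r => by
    refine lintegral_congr_ae ?_
    filter_upwards [hgood] with ω hω
    rw [ENNReal.ofReal_pow hω.2.1, hω.2.2]
  have hBfin : ∀ r : ℕ, ∫⁻ ω, ENNReal.ofReal (KCut.limitVar k U E ω ^ r) ∂Q ≠ ⊤ := fun r => by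
    rw [hBpow r]
    exact ne_top_of_le_ne_top ENNReal.ofReal_ne_top (hchain.lintegral_pathIntegral_pow_le hk r)
  have hBenorm : ∀ r : ℕ, ∫⁻ ω, ‖KCut.limitVar k U E ω‖ₑ ^ r ∂Q ≠ ⊤ := fun r => by
    convert! hBfin r using 1
    refine lintegral_congr_ae ?_
    filter_upwards [hB0] with ω hω
    rw [Real.enorm_eq_ofReal hω, ENNReal.ofReal_pow hω]
  have hBint : ∀ r : ℕ, Integrable (fun ω => KCut.limitVar k U E ω ^ r) Q := fun r => by
    refine ⟨(hBm.pow_const r).aestronglyMeasurable, ?_⟩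
    rw [hasFiniteIntegral_iff_enorm]
    simp_rw [enorm_pow]
    exact (hBenorm r).lt_top
  have hBval : ∀ r : ℕ, ∫ ω, KCut.limitVar k U E ω ^ r ∂Q
      = (∫⁻ ω, KCut.pathIntegral k U' E' ω ^ r ∂Q).toReal := fun r => by
    rw [integral_eq_lintegral_of_nonneg_ae (by filter_upwards [hB0] with ω hω using pow_nonneg hω r)
      (hBint r).aestronglyMeasurable, hBpow r]
  have hXb : ∀ r : ℕ, ∃ C : ENNReal, C ≠ ⊤ ∧
      ∀ n, ∫⁻ ω, ‖KCut.scaledCutNumber k T n ω‖ₑ ^ r ∂P ≤ C := fun r => by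
    obtain ⟨C, hC⟩ := hclock.exists_lintegral_scaledCutNumber_pow_le hk r
    refine ⟨ENNReal.ofReal C, ENNReal.ofReal_ne_top, fun n => le_trans (le_of_eq ?_) (hC n)⟩
    refine lintegral_congr_ae ?_
    filter_upwards [hTae n] with ω hω
    rw [hω, Real.enorm_eq_ofReal (KCut.scaledCutNumber_nonneg k T n ω)]
  have hmean : ∫ ω, KCut.limitVar k U E ω ∂Q = KCut.eta k 1 := by
    have h := hBval 1
    simp only [pow_one] at h
    rw [h, hchain.lintegral_pathIntegral hk, ENNReal.toReal_ofReal (KCut.eta_one_nonneg hk)]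
  -- The copies converge almost surely; moment bounds and nonnegativity pass to them because both
  -- depend only on the laws.
  obtain ⟨P₀, hP₀, Y, Z, hYX, hZB, hlim⟩ := KCut.exists_ae_tendsto_of_tendstoInDistribution hdist
  have hYb : ∀ r : ℕ, ∃ C : ENNReal, C ≠ ⊤ ∧ ∀ n, ∫⁻ x, ‖Y n x‖ₑ ^ r ∂P₀ ≤ C := fun r => by
    obtain ⟨C, hC, hCn⟩ := hXb r
    refine ⟨C, hC, fun n => le_trans (le_of_eq ?_) (hCn n)⟩
    exact ((hYX n).comp (by fun_prop : Measurable fun x : ℝ => ‖x‖ₑ ^ r)).lintegral_eq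
  have hZb : ∀ r : ℕ, ∫⁻ x, ‖Z x‖ₑ ^ r ∂P₀ ≠ ⊤ := fun r => by
    have h := (hZB.comp (by fun_prop : Measurable fun x : ℝ => ‖x‖ₑ ^ r)).lintegral_eq
    exact h.trans_ne (hBenorm r)
  have hYm := fun n => (hYX n).aemeasurable_fst
  have hZm := hZB.aemeasurable_fst
  have hY0 : ∀ n, ∀ᵐ x ∂P₀, 0 ≤ Y n x := fun n =>
    (hYX n).symm.ae_snd measurableSet_Ici (ae_of_all _ (KCut.scaledCutNumber_nonneg k T n))
  have hZ0 : ∀ᵐ x ∂P₀, 0 ≤ Z x := hZB.symm.ae_snd measurableSet_Ici hB0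
  refine ⟨hgood.mono fun ω h => h.1, hdist,
    fun p hp => KCut.memLp_of_lintegral_pow_ne_top hBm hBenorm hp,
    ⟨ℝ, inferInstance, P₀, hP₀, Y, Z, hYX, hZB,
      fun p hp => KCut.tendsto_eLpNorm_sub hYm hZm hlim hYb hZb hp⟩,
    fun p hp => ?_, hmean, ?_, fun p => ⟨?_, ?_⟩⟩
  · have h := KCut.tendsto_integral_rpow hYm hZm hlim hY0 hZ0 hYb hZb hp
    have hpm : Measurable fun x : ℝ => x ^ p := by fun_prop
    have e1 : ∀ n, ∫ x, Y n x ^ p ∂P₀ = ∫ ω, KCut.scaledCutNumber k T n ω ^ p ∂P := fun n =>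
      ((hYX n).comp hpm).integral_eq
    have e2 : ∫ x, Z x ^ p ∂P₀ = ∫ ω, KCut.limitVar k U E ω ^ p ∂Q := (hZB.comp hpm).integral_eq
    simpa only [e1, e2] using h
  · rw [hBval 2, hchain.lintegral_pathIntegral_sq_eq_gam hk,
      ENNReal.toReal_ofReal (KCut.gam_nonneg hk)]
  · rw [← hmean]
    refine KCut.pow_integral_le hB0 ?_ p (hBint p)
    simpa using hBint 1
  · rw [hBval p]
    exact ENNReal.toReal_le_of_le_ofReal (KCut.rho_nonneg hk p)
      (hchain.lintegral_pathIntegral_pow_le hk p)
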